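/- Let $k\ge 3$. **The Lie algebras.** Let $\mathfrak h_k$ be the real vector space with basis $h_0,\dots,h_k$, and let $\varepsilon_0,\dots,\varepsilon_k\in\mathfrak h_k^*$ be given by $\varepsilon_0(h_0)=-1$, $\varepsilon_i(h_i)=1$ for $1\le i\le k$, and $\varepsilon_i(h_j)=0$ for $i\ne j$. Put $$\alpha_i=\varepsilon_i-\varepsilon_{i+1},\quad \alpha_i^\vee=h_i-h_{i+1}\quad(1\le i\le k-1),\qquad \alpha_k=\varepsilon_0-\varepsilon_1-\varepsilon_2-\varepsilon_3,\quad \alpha_k^\vee=h_0-h_1-h_2-h_3 ;$$ the matrix $c_{ij}=\alpha_j(\alpha_i^\vee)$ is the generalized Cartan matrix of type $E_k$. Let $\mathfrak g_k$ be the real Lie algebra (of type $E_{k(k)}$) generated by $e_1,\dots,e_k,f_1,\dots,f_k$ and the vector space $\mathfrak h_k$ with the relations $[h,h']=0$, $[h,e_i]=\alpha_i(h)e_i$, $[h,f_i]=-\alpha_i(h)f_i$, $[e_i,f_j]=\delta_{ij}\alpha_i^\vee$ for $h,h'\in\mathfrak h_k$, and $\operatorname{ad}(e_i)^{1-c_{ij}}(e_j)=0=\operatorname{ad}(f_i)^{1-c_{ij}}(f_j)$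 for $i\neq j$. Let $\mathfrak p_k\subset\mathfrak g_k$ be the maximal parabolic subalgebra generated by $\mathfrak h_k$, $e_1,\dots,e_k$ and $f_1,\dots,f_{k-1}$. **The Sullivan minimal model.** Let $\mathbb R[s_1,\dots,s_k]$ be the free graded commutative algebra on variables of degree $-1$, and let $V$ be the graded vector space with basis $g_4,g_7$ of degrees $4,7$. The Sullivan minimal model $M(\mathcal T^kS^4)$ of the $k$-toroidification of $S^4$ is the free graded commutative real algebra on $(\mathbb R[s_1,\dots,s_k]\otimes V)^{>0}\oplus\mathbb Rw_1\oplus\dots\oplus\mathbb Rw_k$, $|w_i|=2$. Here $s_i$ denotes also the derivation of degree $-1$ that extends multiplication by $s_i$ (products of degree $\le 0$ being zero) and satisfies $s_iw_j=0$. The differential $d$ is the derivation of degree $1$ with $$dg_4=\sum_{i=1}^k w_i\, s_ig_4,\qquad dg_7=-\tfrac12 g_4^2+\sum_{i=1}^k w_i\, s_ig_7,\qquad dw_i=0,\qquad ds_i+s_id=0,$$ and the augmentation sends all generators to $0$. Let $\operatorname{Der}M(\mathcal T^kS^4)$ be the Lie algebra of degree-$0$ derivations of $M(\mathcal T^kS^4)$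 that commute with $d$ and are annihilated by the augmentation. **Theorem.** There is a unique Lie algebra homomorphism $\mathfrak p_k\to\operatorname{Der}M(\mathcal T^kS^4)$ that satisfies the following formulas, in which brackets with $s_i$ are commutators of operators on $M(\mathcal T^kS^4)$: * $e_kg_4=e_kg_7=e_ks_ig_4=e_ks_ig_7=e_ks_is_jg_7=e_ks_1s_2s_3g_4=0$ for $i,j\in\{1,2,3\}$; $e_kw_i=0$ for $1\le i\le k$; $e_ks_is_jg_4=\operatorname{sgn}\bigl(\begin{smallmatrix}1&2&3\\ i&j&l\end{smallmatrix}\bigr)w_l$ for $\{i,j,l\}=\{1,2,3\}$; $e_ks_1s_2s_3g_7=g_4$; $[e_k,s_i]=0$ for $4\le i\le k$; * $hg_4=-\varepsilon_0(h)g_4$, $hg_7=-2\varepsilon_0(h)g_7$, $[h,s_i]=\varepsilon_i(h)s_i$, $hw_i=-\varepsilon_i(h)w_i$ for $h\in\mathfrak h_k$, $1\le i\le k$; * $e_ig_4=e_ig_7=0$, $e_iw_j=\delta_{ij}w_{i+1}$, $[e_i,s_j]=-\delta_{i+1,j}s_i$ for $1\le i\le k-1$, $1\le j\le k$; * $f_ig_4=f_ig_7=0$,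 $f_iw_j=\delta_{i+1,j}w_i$, $[f_i,s_j]=-\delta_{ij}s_{i+1}$ for $1\le i\le k-1$, $1\le j\le k$. This action is linear: every element of $\mathfrak p_k$ maps the span of the free generators of $M(\mathcal T^kS^4)$ into itself. -/

import Mathlib

/-- The defining relation `a b = (-1)^(|a| |b|) b a` of the free graded commutative algebra on a
type `ι` of generators of degree `deg`. (Over `ℝ` it gives `a a = 0` for `|a|` odd.) -/
inductive FreeGC.Rel {ι : Type} (deg : ι → ℕ) : FreeAlgebra ℝ ι → FreeAlgebra ℝ ι → Prop
  | swap (a b : ι) : FreeGC.Rel deg (FreeAlgebra.ι ℝ a * FreeAlgebra.ι ℝ b)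
      ((-1 : ℝ) ^ (deg a * deg b) • (FreeAlgebra.ι ℝ b * FreeAlgebra.ι ℝ a))

/-- The free graded commutative unital real algebra `S(V)`, where the graded vector space `V` has
the homogeneous basis `ι` with degrees `deg`. -/
def FreeGC {ι : Type} (deg : ι → ℕ) : Type := RingQuot (FreeGC.Rel deg)

namespace FreeGC

noncomputable instance {ι : Type} (deg : ι → ℕ) : Ring (FreeGC deg) :=
  inferInstanceAs (Ring (RingQuot (FreeGC.Rel deg)))

noncomputable instance {ι : Type} (deg : ι → ℕ) : Algebra ℝ (FreeGC deg) :=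
  inferInstanceAs (Algebra ℝ (RingQuot (FreeGC.Rel deg)))

/-- The projection of the free algebra onto `S(V)`. -/
noncomputable def mk {ι : Type} (deg : ι → ℕ) : FreeAlgebra ℝ ι →ₐ[ℝ] FreeGC deg :=
  RingQuot.mkAlgHom ℝ (FreeGC.Rel deg)

/-- The generator of `S(V)` attached to a basis element of `V`. -/
noncomputable def gen {ι : Type} (deg : ι → ℕ) (a : ι) : FreeGC deg :=
  mk deg (FreeAlgebra.ι ℝ a)

theorem gen_swap {ι : Type} (deg : ι → ℕ) (a b : ι) :
    gen deg a * gen deg b = (-1 : ℝ) ^ (deg a * deg b) • (gen deg b * gen deg a) := by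
  have h : mk deg _ = mk deg _ := RingQuot.mkAlgHom_rel ℝ (FreeGC.Rel.swap (deg := deg) a b)
  rw [map_mul, map_smul, map_mul] at h
  exact h

/-- The universal property of `S(V)`. -/
noncomputable def lift {ι : Type} {deg : ι → ℕ} {B : Type} [Ring B] [Algebra ℝ B] (f : ι → B)
    (hf : ∀ a b, f a * f b = (-1 : ℝ) ^ (deg a * deg b) • (f b * f a)) : FreeGC deg →ₐ[ℝ] B :=
  RingQuot.liftAlgHom ℝ ⟨FreeAlgebra.lift ℝ f, by
    rintro _ _ ⟨a, b⟩
    simp only [map_mul, map_smul, FreeAlgebra.lift_ι_apply]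
    exact hf a b⟩

theorem lift_gen {ι : Type} {deg : ι → ℕ} {B : Type} [Ring B] [Algebra ℝ B] (f : ι → B)
    (hf : ∀ a b, f a * f b = (-1 : ℝ) ^ (deg a * deg b) • (f b * f a)) (a : ι) :
    lift f hf (gen deg a) = f a := by
  have h := RingQuot.liftAlgHom_mkAlgHom_apply ℝ (FreeAlgebra.lift ℝ f)
    (s := FreeGC.Rel deg) (by
      rintro _ _ ⟨a, b⟩
      simp only [map_mul, map_smul, FreeAlgebra.lift_ι_apply]
      exact hf a b) (FreeAlgebra.ι ℝ a)
  rw [FreeAlgebra.lift_ι_apply] at h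
  exact h

/-- The monomial attached to a word in the generators. -/
noncomputable def mono {ι : Type} (deg : ι → ℕ) (l : List ι) : FreeGC deg :=
  (l.map (gen deg)).prod

theorem mono_cons {ι : Type} (deg : ι → ℕ) (a : ι) (l : List ι) :
    mono deg (a :: l) = gen deg a * mono deg l := by
  simp [mono]

theorem mono_nil {ι : Type} (deg : ι → ℕ) : mono deg [] = 1 := by
  simp [mono]

theorem mono_append {ι : Type} (deg : ι → ℕ) (l m : List ι) :
    mono deg (l ++ m) = mono deg l * mono deg m := by
  simp [mono]

theorem span_mono {ι : Type} (deg : ι → ℕ) :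
    Submodule.span ℝ (Set.range (mono deg)) = ⊤ := by
  have key : ∀ y : FreeAlgebra ℝ ι, mk deg y ∈
      (Submodule.span ℝ (Set.range (mono deg)) : Submodule ℝ (FreeGC deg)) := by
    intro y
    induction y using FreeAlgebra.induction with
    | grade0 r =>
      rw [AlgHom.commutes, Algebra.algebraMap_eq_smul_one]
      refine Submodule.smul_mem _ _ (Submodule.subset_span ⟨[], mono_nil deg⟩)
    | grade1 x =>
      refine Submodule.subset_span ⟨[x], ?_⟩
      rw [mono_cons, mono_nil, mul_one]; rfl
    | mul a b ha hb =>
      rw [map_mul]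
      have h1 := Submodule.mul_mem_mul ha hb
      rw [Submodule.span_mul_span] at h1
      refine Submodule.span_mono ?_ h1
      rintro _ ⟨_, ⟨l, rfl⟩, _, ⟨m, rfl⟩, rfl⟩
      exact ⟨l ++ m, mono_append deg l m⟩
    | add a b ha hb =>
      rw [map_add]
      exact Submodule.add_mem _ ha hb
  rw [eq_top_iff]
  rintro x -
  obtain ⟨y, rfl⟩ := RingQuot.mkAlgHom_surjective ℝ (FreeGC.Rel deg) x
  exact key y

theorem mono_induction {ι : Type} {deg : ι → ℕ} {P : FreeGC deg → Prop}
    (hm : ∀ l, P (mono deg l)) (h0 : P 0) (ha : ∀ x y, P x → P y → P (x + y))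
    (hs : ∀ (r : ℝ) x, P x → P (r • x)) (x : FreeGC deg) : P x := by
  have hx : x ∈ Submodule.span ℝ (Set.range (mono deg)) := by rw [span_mono]; trivial
  induction hx using Submodule.span_induction with
  | mem x h => obtain ⟨l, rfl⟩ := h; exact hm l
  | zero => exact h0
  | add x y _ _ h1 h2 => exact ha x y h1 h2
  | smul r x _ h => exact hs r x h

/-- The component of degree `n`: it is spanned by the words of total degree `n`. -/
noncomputable def grading {ι : Type} (deg : ι → ℕ) (n : ℕ) : Submodule ℝ (FreeGC deg) :=
  Submodule.span ℝ {x | ∃ l : List ι, (l.map deg).sum = n ∧ mono deg l = x}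

theorem mono_mem {ι : Type} (deg : ι → ℕ) (l : List ι) :
    mono deg l ∈ grading deg (l.map deg).sum :=
  Submodule.subset_span ⟨l, rfl, rfl⟩

theorem gen_mem {ι : Type} (deg : ι → ℕ) (a : ι) : gen deg a ∈ grading deg (deg a) :=
  Submodule.subset_span ⟨[a], by simp, by simp [mono]⟩

theorem grading_induction {ι : Type} {deg : ι → ℕ} {n : ℕ} {P : FreeGC deg → Prop}
    (hm : ∀ l : List ι, (l.map deg).sum = n → P (mono deg l)) (h0 : P 0)
    (ha : ∀ x y, P x → P y → P (x + y))
    (hs : ∀ (r : ℝ) x, P x → P (r • x)) (x : FreeGC deg) (hx : x ∈ grading deg n) : P x := by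
  induction hx using Submodule.span_induction with
  | mem x h => obtain ⟨l, hl, rfl⟩ := h; exact hm l hl
  | zero => exact h0
  | add x y _ _ h1 h2 => exact ha x y h1 h2
  | smul r x _ h => exact hs r x h

theorem one_mem {ι : Type} (deg : ι → ℕ) : (1 : FreeGC deg) ∈ grading deg 0 :=
  Submodule.subset_span ⟨[], by simp, by simp [mono]⟩

theorem mul_mem {ι : Type} {deg : ι → ℕ} {m n : ℕ} {x y : FreeGC deg}
    (hx : x ∈ grading deg m) (hy : y ∈ grading deg n) : x * y ∈ grading deg (m + n) := by
  have h1 := Submodule.mul_mem_mul hx hy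
  unfold grading at h1
  rw [Submodule.span_mul_span] at h1
  refine Submodule.span_mono ?_ h1
  rintro _ ⟨_, ⟨l, hl, rfl⟩, _, ⟨l', hl', rfl⟩, rfl⟩
  exact ⟨l ++ l', by simp [hl, hl'], mono_append deg l l'⟩

theorem gen_mul_mono {ι : Type} (deg : ι → ℕ) (a : ι) (l : List ι) :
    gen deg a * mono deg l =
      (-1 : ℝ) ^ (deg a * (l.map deg).sum) • (mono deg l * gen deg a) := by
  induction l with
  | nil => simp [mono]
  | cons b l ih =>
    rw [mono_cons, ← mul_assoc, gen_swap, smul_mul_assoc, mul_assoc, ih, mul_smul_comm, smul_smul,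
      mul_assoc]
    congr 1
    rw [List.map_cons, List.sum_cons, mul_add, pow_add]

theorem mono_mul_mono {ι : Type} (deg : ι → ℕ) (l m : List ι) :
    mono deg l * mono deg m =
      (-1 : ℝ) ^ ((l.map deg).sum * (m.map deg).sum) • (mono deg m * mono deg l) := by
  induction l with
  | nil => simp [mono]
  | cons b l ih =>
    rw [mono_cons, mul_assoc, ih, mul_smul_comm, ← mul_assoc, gen_mul_mono, smul_mul_assoc,
      smul_smul, mul_assoc]
    congr 1
    rw [List.map_cons, List.sum_cons, add_mul, pow_add, mul_comm]

theorem graded_comm {ι : Type} {deg : ι → ℕ} {m n : ℕ} {x y : FreeGC deg}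
    (hx : x ∈ grading deg m) (hy : y ∈ grading deg n) :
    x * y = (-1 : ℝ) ^ (m * n) • (y * x) := by
  refine grading_induction (P := fun x => x * y = (-1 : ℝ) ^ (m * n) • (y * x))
    ?_ (by simp) ?_ ?_ x hx
  · intro l hl
    refine grading_induction
      (P := fun y => mono deg l * y = (-1 : ℝ) ^ (m * n) • (y * mono deg l))
      ?_ (by simp) ?_ ?_ y hy
    · intro l' hl'
      rw [mono_mul_mono, hl, hl']
    · intro a b h1 h2
      rw [mul_add, add_mul, h1, h2, smul_add]
    · intro r a h1
      rw [mul_smul_comm, smul_mul_assoc, h1, smul_comm]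
  · intro a b h1 h2
    rw [mul_add, add_mul, h1, h2, smul_add]
  · intro r a h1
    rw [mul_smul_comm, smul_mul_assoc, h1, smul_comm]

/-- The algebra map `x ↦ x T^n` for `x` of degree `n`; it separates the components. -/
noncomputable def toPoly {ι : Type} (deg : ι → ℕ) : FreeGC deg →ₐ[ℝ] Polynomial (FreeGC deg) :=
  lift (fun a => Polynomial.monomial (deg a) (gen deg a)) (by
    intro a b
    rw [Polynomial.monomial_mul_monomial, Polynomial.monomial_mul_monomial, gen_swap,
      Polynomial.smul_monomial, add_comm])

theorem toPoly_of_mem {ι : Type} {deg : ι → ℕ} {n : ℕ} (x : FreeGC deg)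
    (hx : x ∈ grading deg n) : toPoly deg x = Polynomial.monomial n x := by
  revert x
  refine grading_induction ?_ (by simp) ?_ ?_
  · intro l hl
    subst hl
    induction l with
    | nil => simp [mono]
    | cons a l ih =>
      rw [mono_cons, map_mul, ih, toPoly, lift_gen, Polynomial.monomial_mul_monomial]
      simp
  · intro a b h1 h2
    rw [map_add, map_add, h1, h2]
  · intro r a h1
    rw [map_smul, h1, Polynomial.smul_monomial]

theorem isInternal {ι : Type} (deg : ι → ℕ) : DirectSum.IsInternal (grading deg) := by
  classical
  rw [DirectSum.isInternal_submodule_iff_iSupIndep_and_iSup_eq_top]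
  constructor
  · rw [iSupIndep_iff_forall_dfinsupp]
    intro i x f hf
    have h1 : ∀ g : (Π₀ i, grading deg i),
        toPoly deg (g.lsum ℕ (fun i => (grading deg i).subtype)) =
          g.sum (fun i (y : grading deg i) => Polynomial.monomial i (y : FreeGC deg)) := by
      intro g
      rw [DFinsupp.lsum_apply_apply, DFinsupp.sumAddHom_apply, DFinsupp.sum, map_sum]
      refine Finset.sum_congr rfl fun j _ => ?_
      exact toPoly_of_mem _ (g j).2
    have h2 := congrArg (fun p => Polynomial.coeff p i) (h1 (f.erase i))
    simp only [hf, toPoly_of_mem _ x.2, Polynomial.coeff_monomial_same, DFinsupp.sum,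
      Polynomial.finsetSum_coeff, Polynomial.coeff_monomial] at h2
    refine Subtype.ext ?_
    rw [h2]
    refine Finset.sum_eq_zero fun j _ => ?_
    split_ifs with h
    · subst h; simp
    · rfl
  · rw [eq_top_iff, ← span_mono deg, Submodule.span_le]
    rintro _ ⟨l, rfl⟩
    exact Submodule.mem_iSup_of_mem _ (mono_mem deg l)

/-- The sign automorphism `x ↦ (-1)^|x| x`. -/
noncomputable def sgn {ι : Type} (deg : ι → ℕ) : FreeGC deg →ₐ[ℝ] FreeGC deg :=
  lift (fun a => (-1 : ℝ) ^ deg a • gen deg a) (by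
    intro a b
    simp only [smul_mul_assoc, mul_smul_comm, gen_swap deg a b, smul_smul]
    congr 1; ring)

theorem sgn_gen {ι : Type} (deg : ι → ℕ) (a : ι) :
    sgn deg (gen deg a) = (-1 : ℝ) ^ deg a • gen deg a := lift_gen _ _ a

theorem sgn_of_mem {ι : Type} {deg : ι → ℕ} {n : ℕ} (x : FreeGC deg)
    (hx : x ∈ grading deg n) : sgn deg x = (-1 : ℝ) ^ n • x := by
  revert x
  refine grading_induction ?_ (by simp) ?_ ?_
  · intro l hl
    subst hl
    induction l with
    | nil => simp [mono]
    | cons a l ih =>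
      rw [mono_cons, map_mul, ih, sgn_gen, smul_mul_smul_comm, List.map_cons, List.sum_cons,
        pow_add]
  · intro a b h1 h2
    rw [map_add, h1, h2, smul_add]
  · intro r a h1
    rw [map_smul, h1, smul_comm]

/-- The algebra map `x ↦ [[(-1)^|x| x, D x], [0, x]]`, where `D` is the odd derivation with
prescribed homogeneous values `f` (of parity opposite to `deg`) on the generators. -/
noncomputable def oddDerMatrix {ι : Type} {deg : ι → ℕ} (f : ι → FreeGC deg)
    (hf : ∀ a, ∃ n, Odd (n + deg a) ∧ f a ∈ grading deg n) :
    FreeGC deg →ₐ[ℝ] Matrix (Fin 2) (Fin 2) (FreeGC deg) :=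
  lift (fun a => !![(-1 : ℝ) ^ deg a • gen deg a, f a; 0, gen deg a]) (by
    intro a b
    obtain ⟨m, hm, ha⟩ := hf a
    obtain ⟨n, hn, hb⟩ := hf b
    have e1 : (-1 : ℝ) ^ m = -(-1) ^ deg a := by
      have h : (-1 : ℝ) ^ (m + deg a) = -1 := hm.neg_one_pow
      rw [pow_add] at h
      rcases neg_one_pow_eq_or ℝ (deg a) with h2 | h2 <;> rw [h2] at h ⊢ <;> linarith
    have e2 : (-1 : ℝ) ^ n = -(-1) ^ deg b := by
      have h : (-1 : ℝ) ^ (n + deg b) = -1 := hn.neg_one_pow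
      rw [pow_add] at h
      rcases neg_one_pow_eq_or ℝ (deg b) with h2 | h2 <;> rw [h2] at h ⊢ <;> linarith
    have h1 := graded_comm ha (gen_mem deg b)
    have h2 := graded_comm (gen_mem deg a) hb
    have e3 : (-1 : ℝ) ^ (deg a) * (-1) ^ (deg a) = 1 := by
      rw [← pow_add]; exact Even.neg_one_pow ⟨_, rfl⟩
    have s1 : (-1 : ℝ) ^ (m * deg b) = (-1) ^ (deg a * deg b) * (-1) ^ deg b := by
      rw [pow_mul, e1, neg_pow, pow_mul]; ring
    have s2 : (-1 : ℝ) ^ (deg a * n) = (-1) ^ (deg a * deg b) * (-1) ^ deg a := by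
      rw [mul_comm, pow_mul, e2, neg_pow, mul_comm (deg a), pow_mul]; ring
    ext i j
    fin_cases i <;> fin_cases j
    · simp [Matrix.mul_apply, smul_smul, gen_swap deg a b]
      congr 1; ring
    · simp [Matrix.mul_apply, h1, h2, s1, s2, smul_smul]
      rw [show (-1 : ℝ) ^ deg a * ((-1) ^ (deg a * deg b) * (-1) ^ deg a)
        = (-1) ^ (deg a * deg b) by rw [mul_left_comm, e3, mul_one]]
      abel
    · simp [Matrix.mul_apply]
    · simp [Matrix.mul_apply, gen_swap deg a b])

/-- The odd derivation of `S(V)` with prescribed values `f` on the generators. -/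
noncomputable def oddDer {ι : Type} {deg : ι → ℕ} (f : ι → FreeGC deg)
    (hf : ∀ a, ∃ n, Odd (n + deg a) ∧ f a ∈ grading deg n) :
    FreeGC deg →ₗ[ℝ] FreeGC deg where
  toFun x := oddDerMatrix f hf x 0 1
  map_add' x y := by simp
  map_smul' r x := by simp

theorem oddDer_gen {ι : Type} {deg : ι → ℕ} (f : ι → FreeGC deg)
    (hf : ∀ a, ∃ n, Odd (n + deg a) ∧ f a ∈ grading deg n) (a : ι) :
    oddDer f hf (gen deg a) = f a := by
  change oddDerMatrix f hf (gen deg a) 0 1 = f a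
  rw [oddDerMatrix, lift_gen]
  simp

theorem oddDerMatrix_diag {ι : Type} {deg : ι → ℕ} (f : ι → FreeGC deg)
    (hf : ∀ a, ∃ n, Odd (n + deg a) ∧ f a ∈ grading deg n) (x : FreeGC deg) :
    oddDerMatrix f hf x 0 0 = sgn deg x ∧ oddDerMatrix f hf x 1 0 = 0 ∧
      oddDerMatrix f hf x 1 1 = x := by
  revert x
  refine mono_induction ?_ (by simp) ?_ ?_
  · intro l
    induction l with
    | nil => simp [mono]
    | cons a l ih =>
      obtain ⟨h1, h2, h3⟩ := ih
      rw [mono_cons, map_mul, map_mul]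
      simp only [Matrix.mul_apply, Fin.sum_univ_two, h1, h2, h3]
      rw [oddDerMatrix, lift_gen, sgn_gen]
      simp
  · rintro x y ⟨h1, h2, h3⟩ ⟨h4, h5, h6⟩
    simp [h1, h2, h3, h4, h5, h6]
  · rintro r x ⟨h1, h2, h3⟩
    simp [h1, h2, h3]

theorem oddDer_mul {ι : Type} {deg : ι → ℕ} (f : ι → FreeGC deg)
    (hf : ∀ a, ∃ n, Odd (n + deg a) ∧ f a ∈ grading deg n) (x y : FreeGC deg) :
    oddDer f hf (x * y) = oddDer f hf x * y + sgn deg x * oddDer f hf y := by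
  change oddDerMatrix f hf (x * y) 0 1 =
    oddDerMatrix f hf x 0 1 * y + sgn deg x * oddDerMatrix f hf y 0 1
  rw [map_mul, Matrix.mul_apply, Fin.sum_univ_two, (oddDerMatrix_diag f hf x).1,
    (oddDerMatrix_diag f hf y).2.2, add_comm]

theorem oddDer_one {ι : Type} {deg : ι → ℕ} (f : ι → FreeGC deg)
    (hf : ∀ a, ∃ n, Odd (n + deg a) ∧ f a ∈ grading deg n) : oddDer f hf 1 = 0 := by
  have h := oddDer_mul f hf 1 1
  simpa using h

theorem sgn_oddDer {ι : Type} {deg : ι → ℕ} (f : ι → FreeGC deg)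
    (hf : ∀ a, ∃ n, Odd (n + deg a) ∧ f a ∈ grading deg n) (x : FreeGC deg) :
    sgn deg (oddDer f hf x) = -oddDer f hf (sgn deg x) := by
  revert x
  refine mono_induction ?_ (by simp) ?_ ?_
  · intro l
    induction l with
    | nil => simp [mono_nil, oddDer_one]
    | cons a l ih =>
      obtain ⟨n, hn, ha⟩ := hf a
      have e1 : (-1 : ℝ) ^ n = -(-1) ^ deg a := by
        have h : (-1 : ℝ) ^ (n + deg a) = -1 := hn.neg_one_pow
        rw [pow_add] at h
        rcases neg_one_pow_eq_or ℝ (deg a) with h2 | h2 <;> rw [h2] at h ⊢ <;> linarith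
      rw [mono_cons, oddDer_mul, map_mul, oddDer_mul, map_add, map_mul, map_mul, ih, oddDer_gen,
        sgn_gen, map_smul, map_smul, sgn_gen, oddDer_gen, sgn_of_mem _ ha, e1]
      simp only [neg_smul, neg_mul, mul_neg, neg_add]
  · intro x y h1 h2
    simp only [map_add, h1, h2, neg_add]
  · intro r x h1
    simp only [map_smul, h1, smul_neg]

theorem sgn_sgn {ι : Type} {deg : ι → ℕ} (x : FreeGC deg) : sgn deg (sgn deg x) = x := by
  revert x
  refine mono_induction ?_ (by simp) ?_ ?_
  · intro l
    rw [sgn_of_mem _ (mono_mem deg l), map_smul, sgn_of_mem _ (mono_mem deg l), smul_smul,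
      ← pow_add, Even.neg_one_pow ⟨_, rfl⟩, one_smul]
  · intro x y h1 h2
    simp only [map_add, h1, h2]
  · intro r x h1
    simp only [map_smul, h1]

/-- Two odd derivations anticommute if they do so on the generators. -/
theorem oddDer_anticomm {ι : Type} {deg : ι → ℕ} (f g : ι → FreeGC deg)
    (hf : ∀ a, ∃ n, Odd (n + deg a) ∧ f a ∈ grading deg n)
    (hg : ∀ a, ∃ n, Odd (n + deg a) ∧ g a ∈ grading deg n)
    (h : ∀ a, oddDer f hf (g a) + oddDer g hg (f a) = 0) (x : FreeGC deg) :
    oddDer f hf (oddDer g hg x) + oddDer g hg (oddDer f hf x) = 0 := by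
  revert x
  refine mono_induction ?_ (by simp) ?_ ?_
  · intro l
    induction l with
    | nil => simp [mono_nil, oddDer_one]
    | cons a l ih =>
      have e1 := sgn_oddDer f hf (gen deg a)
      have e2 := sgn_oddDer g hg (gen deg a)
      rw [oddDer_gen] at e1 e2
      rw [mono_cons]
      simp only [oddDer_mul, map_add, sgn_sgn, oddDer_gen, e1, e2]
      rw [eq_neg_of_add_eq_zero_left (h a), eq_neg_of_add_eq_zero_left ih]
      simp only [neg_mul, mul_neg]
      abel
  · intro x y h1 h2
    simp only [map_add]
    rw [add_add_add_comm, h1, h2, add_zero]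
  · intro r x h1
    simp only [map_smul]
    rw [← smul_add, h1, smul_zero]

end FreeGC

/-- The structure of an augmented differential graded-commutative algebra (DGCA), with
nonnegative grading and differential of degree `1`, on a real algebra `A`. -/
structure AugDGCA (A : Type) [Ring A] [Algebra ℝ A] where
  /-- the homogeneous components -/
  grading : ℕ → Submodule ℝ A
  one_mem : 1 ∈ grading 0
  mul_mem : ∀ {m n : ℕ} {x y : A}, x ∈ grading m → y ∈ grading n → x * y ∈ grading (m + n)
  isInternal : DirectSum.IsInternal grading
  graded_comm : ∀ {m n : ℕ} {x y : A}, x ∈ grading m → y ∈ grading n →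
    x * y = (-1 : ℝ) ^ (m * n) • (y * x)
  /-- the differential -/
  d : A →ₗ[ℝ] A
  d_mem : ∀ {n : ℕ} {x : A}, x ∈ grading n → d x ∈ grading (n + 1)
  d_mul : ∀ {m : ℕ} {x : A}, x ∈ grading m → ∀ y, d (x * y) = d x * y + (-1 : ℝ) ^ m • (x * d y)
  d_d : ∀ x, d (d x) = 0
  /-- the augmentation -/
  aug : A →ₐ[ℝ] ℝ
  aug_mem : ∀ {n : ℕ} {x : A}, x ∈ grading n → n ≠ 0 → aug x = 0
  aug_d : ∀ x, aug (d x) = 0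

attribute [local instance 100] LieRing.ofAssociativeRing

/-- The Lie algebra (under the commutator) of derivations of an augmented DGCA: the linear maps
of degree `0` which satisfy the Leibniz rule and are compatible with the differential and with the
augmentation. -/
def AugDGCA.der {A : Type} [Ring A] [Algebra ℝ A] (X : AugDGCA A) :
    LieSubalgebra ℝ (Module.End ℝ A) where
  carrier := {D | (∀ n, ∀ x ∈ X.grading n, D x ∈ X.grading n) ∧
    (∀ x y, D (x * y) = D x * y + x * D y) ∧ (∀ x, D (X.d x) = X.d (D x)) ∧ ∀ x, X.aug (D x) = 0}
  add_mem' := by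
    rintro D E ⟨h1, h2, h3, h4⟩ ⟨k1, k2, k3, k4⟩
    refine ⟨fun n x hx => Submodule.add_mem _ (h1 n x hx) (k1 n x hx), fun x y => ?_, fun x => ?_,
      fun x => ?_⟩
    · simp only [LinearMap.add_apply, h2, k2, add_mul, mul_add]; abel
    · simp only [LinearMap.add_apply, h3, k3, map_add]
    · simp only [LinearMap.add_apply, map_add, h4, k4, add_zero]
  zero_mem' := ⟨fun n x _ => by simp, fun x y => by simp, fun x => by simp, fun x => by simp⟩
  smul_mem' := by
    rintro r D ⟨h1, h2, h3, h4⟩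
    refine ⟨fun n x hx => Submodule.smul_mem _ r (h1 n x hx), fun x y => ?_, fun x => ?_,
      fun x => ?_⟩
    · simp only [LinearMap.smul_apply, h2, smul_add, smul_mul_assoc, mul_smul_comm]
    · simp only [LinearMap.smul_apply, h3, map_smul]
    · simp only [LinearMap.smul_apply, map_smul, h4, smul_zero]
  lie_mem' := by
    rintro D E ⟨h1, h2, h3, h4⟩ ⟨k1, k2, k3, k4⟩
    refine ⟨fun n x hx => ?_, fun x y => ?_, fun x => ?_, fun x => ?_⟩
    · exact Submodule.sub_mem _ (h1 n _ (k1 n x hx)) (k1 n _ (h1 n x hx))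
    · simp only [LieRing.of_associative_ring_bracket, LinearMap.sub_apply, Module.End.mul_apply,
        h2, k2, map_add, sub_mul, mul_sub]
      abel
    · simp only [LieRing.of_associative_ring_bracket, LinearMap.sub_apply, Module.End.mul_apply,
        h3, k3, map_sub]
    · simp only [LieRing.of_associative_ring_bracket, LinearMap.sub_apply, Module.End.mul_apply,
        map_sub, h4, k4, sub_zero]

/-- The generators of the model of the toroidification of the `4`-sphere:
`s_I g₄` for `|I| ≤ 3`, `s_I g₇` for `|I| ≤ 6` (the products of positive degree), and `w_i`. The
set `I = {i₁ < ⋯ < i_p}` stands for the product `s_{i₁} ⋯ s_{i_p}` in the free graded commutative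
algebra on the variables `s_1, …, s_k` of degree `-1`. The element `i : Fin k` stands for the index
`i + 1` of `{1, …, k}`. -/
inductive ToroidGen (k : ℕ) : Type
  | g4 (I : Finset (Fin k)) (h : I.card ≤ 3) : ToroidGen k
  | g7 (I : Finset (Fin k)) (h : I.card ≤ 6) : ToroidGen k
  | w (i : Fin k) : ToroidGen k

/-- The degrees: `|g₄| = 4`, `|g₇| = 7`, `|s_i| = -1`, `|w_i| = 2`. -/
def ToroidGen.deg {k : ℕ} : ToroidGen k → ℕ
  | .g4 I _ => 4 - I.card
  | .g7 I _ => 7 - I.card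
  | .w _ => 2

/-- The underlying algebra `S(U^{>0}) ⊗ ℝ[w_1, …, w_k]` of the model of the toroidification. -/
abbrev ToroidAlg (k : ℕ) : Type := FreeGC (ToroidGen.deg (k := k))

namespace Toroid

/-- The element `s_I g₄`, which is zero when its degree `4 - |I|` is not positive. -/
noncomputable def sg4 {k : ℕ} (I : Finset (Fin k)) : ToroidAlg k :=
  if h : I.card ≤ 3 then FreeGC.gen _ (.g4 I h) else 0

/-- The element `s_I g₇`, which is zero when its degree `7 - |I|` is not positive. -/
noncomputable def sg7 {k : ℕ} (I : Finset (Fin k)) : ToroidAlg k :=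
  if h : I.card ≤ 6 then FreeGC.gen _ (.g7 I h) else 0

/-- The generator `g₄`. -/
noncomputable def g4 (k : ℕ) : ToroidAlg k := sg4 ∅

/-- The generator `g₇`. -/
noncomputable def g7 (k : ℕ) : ToroidAlg k := sg7 ∅

/-- The generators `w_i`. -/
noncomputable def w {k : ℕ} (i : Fin k) : ToroidAlg k := FreeGC.gen _ (.w i)

/-- The sign in `s_i s_I = ± s_{I ∪ {i}}`, or zero if `i ∈ I`. -/
def sSign {k : ℕ} (i : Fin k) (I : Finset (Fin k)) : ℝ :=
  if i ∈ I then 0 else (-1) ^ (I.filter (· < i)).card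

/-- Multiplication by `s_i` on the generators, and `s_i w_j = 0`. -/
noncomputable def sFun {k : ℕ} (i : Fin k) : ToroidGen k → ToroidAlg k
  | .g4 I _ => sSign i I • sg4 (insert i I)
  | .g7 I _ => sSign i I • sg7 (insert i I)
  | .w _ => 0

theorem sg4_mem {k : ℕ} (I : Finset (Fin k)) (n : ℕ) (h : I.card ≤ 3 → n + I.card = 4) :
    sg4 I ∈ FreeGC.grading (ToroidGen.deg (k := k)) n := by
  unfold sg4
  split_ifs with h3
  · have h1 := FreeGC.gen_mem (ToroidGen.deg (k := k)) (.g4 I h3)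
    have h2 : ToroidGen.deg (.g4 I h3) = n := by
      have := h h3
      simp only [ToroidGen.deg]; omega
    rwa [h2] at h1
  · exact Submodule.zero_mem _

theorem sg7_mem {k : ℕ} (I : Finset (Fin k)) (n : ℕ) (h : I.card ≤ 6 → n + I.card = 7) :
    sg7 I ∈ FreeGC.grading (ToroidGen.deg (k := k)) n := by
  unfold sg7
  split_ifs with h3
  · have h1 := FreeGC.gen_mem (ToroidGen.deg (k := k)) (.g7 I h3)
    have h2 : ToroidGen.deg (.g7 I h3) = n := by
      have := h h3
      simp only [ToroidGen.deg]; omega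
    rwa [h2] at h1
  · exact Submodule.zero_mem _

theorem deg_pos {k : ℕ} (a : ToroidGen k) : 0 < a.deg := by
  cases a <;> simp only [ToroidGen.deg] <;> omega

theorem sFun_mem {k : ℕ} (i : Fin k) (a : ToroidGen k) :
    sFun i a ∈ FreeGC.grading (ToroidGen.deg (k := k)) (a.deg - 1) := by
  cases a with
  | g4 I h =>
    by_cases hi : i ∈ I
    · simp [sFun, sSign, hi]
    · refine Submodule.smul_mem _ _ (sg4_mem _ _ fun h' => ?_)
      rw [Finset.card_insert_of_notMem hi] at h' ⊢
      simp only [ToroidGen.deg]; omega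
  | g7 I h =>
    by_cases hi : i ∈ I
    · simp [sFun, sSign, hi]
    · refine Submodule.smul_mem _ _ (sg7_mem _ _ fun h' => ?_)
      rw [Finset.card_insert_of_notMem hi] at h' ⊢
      simp only [ToroidGen.deg]; omega
  | w j => exact Submodule.zero_mem _

theorem sFun_odd {k : ℕ} (i : Fin k) (a : ToroidGen k) : ∃ n, Odd (n + a.deg) ∧
    sFun i a ∈ FreeGC.grading (ToroidGen.deg (k := k)) n := by
  refine ⟨a.deg - 1, ⟨a.deg - 1, ?_⟩, sFun_mem i a⟩
  have := deg_pos a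
  omega

/-- The operator `s_i`, a derivation of degree `-1`. -/
noncomputable def s {k : ℕ} (i : Fin k) : Module.End ℝ (ToroidAlg k) :=
  FreeGC.oddDer (sFun i) (sFun_odd i)

theorem s_mem {k : ℕ} (i : Fin k) {n : ℕ} {x : ToroidAlg k}
    (hx : x ∈ FreeGC.grading (ToroidGen.deg (k := k)) (n + 1)) :
    s i x ∈ FreeGC.grading (ToroidGen.deg (k := k)) n := by
  refine FreeGC.grading_induction (P := fun x => s i x ∈ FreeGC.grading _ n) ?_ (by simp) ?_ ?_ x hx
  · clear hx x
    intro l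
    induction l generalizing n with
    | nil => intro h; simp at h
    | cons a l ih =>
      intro h
      rw [List.map_cons, List.sum_cons] at h
      have ha := deg_pos a
      rw [FreeGC.mono_cons, s, FreeGC.oddDer_mul, FreeGC.oddDer_gen]
      refine Submodule.add_mem _ ?_ ?_
      · have h1 := FreeGC.mul_mem (sFun_mem i a) (FreeGC.mono_mem ToroidGen.deg l)
        rwa [show a.deg - 1 + (l.map ToroidGen.deg).sum = n by omega] at h1
      · rw [FreeGC.sgn_gen, smul_mul_assoc]
        refine Submodule.smul_mem _ _ ?_
        rcases Nat.eq_zero_or_pos (l.map ToroidGen.deg).sum with h0 | h0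
        · have hl : l = [] := by
            cases l with
            | nil => rfl
            | cons b l =>
              have := deg_pos b
              simp at h0; omega
          subst hl
          rw [FreeGC.mono_nil, FreeGC.oddDer_one, mul_zero]
          exact Submodule.zero_mem _
        · have h1 := FreeGC.mul_mem (FreeGC.gen_mem ToroidGen.deg a)
            (ih (n := (l.map ToroidGen.deg).sum - 1) (by omega))
          rwa [show a.deg + ((l.map ToroidGen.deg).sum - 1) = n by omega] at h1
  · intro x y h1 h2
    rw [map_add]; exact Submodule.add_mem _ h1 h2
  · intro r x h1
    rw [map_smul]; exact Submodule.smul_mem _ _ h1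

/-- The operator `s_{i₁} ⋯ s_{i_p}` for the word `[i₁, …, i_p]`. -/
noncomputable def sWord {k : ℕ} (l : List (Fin k)) : Module.End ℝ (ToroidAlg k) := (l.map s).prod

/-- The operator `s_I = s_{i₁} ⋯ s_{i_p}` for `I = {i₁ < ⋯ < i_p}`. -/
noncomputable def sSet {k : ℕ} (I : Finset (Fin k)) : Module.End ℝ (ToroidAlg k) :=
  sWord (I.sort (· ≤ ·))

theorem sWord_cons {k : ℕ} (i : Fin k) (l : List (Fin k)) (x : ToroidAlg k) :
    sWord (i :: l) x = s i (sWord l x) := by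
  simp [sWord]

theorem sWord_mem {k : ℕ} (l : List (Fin k)) {n : ℕ} {x : ToroidAlg k}
    (hx : x ∈ FreeGC.grading (ToroidGen.deg (k := k)) (n + l.length)) :
    sWord l x ∈ FreeGC.grading (ToroidGen.deg (k := k)) n := by
  induction l generalizing n with
  | nil => simpa [sWord] using hx
  | cons i l ih =>
    rw [sWord_cons]
    refine s_mem i (ih ?_)
    rwa [List.length_cons, ← Nat.add_assoc, Nat.add_right_comm] at hx

/-- `d g₄ = ∑ w_i s_i g₄`. -/
noncomputable def dg4 (k : ℕ) : ToroidAlg k := ∑ i, w i * s i (g4 k)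

/-- `d g₇ = -½ g₄² + ∑ w_i s_i g₇`. -/
noncomputable def dg7 (k : ℕ) : ToroidAlg k :=
  -(1 / 2 : ℝ) • (g4 k * g4 k) + ∑ i, w i * s i (g7 k)

/-- The differential on the generators: `d (s_I v) = (-1)^|I| s_I (d v)`, and `d w_i = 0`. -/
noncomputable def dFun {k : ℕ} : ToroidGen k → ToroidAlg k
  | .g4 I _ => (-1 : ℝ) ^ I.card • sSet I (dg4 k)
  | .g7 I _ => (-1 : ℝ) ^ I.card • sSet I (dg7 k)
  | .w _ => 0

theorem g4_mem (k : ℕ) : g4 k ∈ FreeGC.grading (ToroidGen.deg (k := k)) 4 :=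
  sg4_mem _ _ (by simp)

theorem g7_mem (k : ℕ) : g7 k ∈ FreeGC.grading (ToroidGen.deg (k := k)) 7 :=
  sg7_mem _ _ (by simp)

theorem w_mem {k : ℕ} (i : Fin k) : w i ∈ FreeGC.grading (ToroidGen.deg (k := k)) 2 := by
  have h := FreeGC.gen_mem (ToroidGen.deg (k := k)) (.w i)
  rwa [show ToroidGen.deg (ToroidGen.w i) = 2 from rfl] at h

theorem dg4_mem (k : ℕ) : dg4 k ∈ FreeGC.grading (ToroidGen.deg (k := k)) 5 := by
  refine Submodule.sum_mem _ fun i _ => ?_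
  exact FreeGC.mul_mem (m := 2) (n := 3) (w_mem i) (s_mem i (n := 3) (g4_mem k))

theorem dg7_mem (k : ℕ) : dg7 k ∈ FreeGC.grading (ToroidGen.deg (k := k)) 8 := by
  refine Submodule.add_mem _ (Submodule.smul_mem _ _ ?_) (Submodule.sum_mem _ fun i _ => ?_)
  · exact FreeGC.mul_mem (m := 4) (n := 4) (g4_mem k) (g4_mem k)
  · exact FreeGC.mul_mem (m := 2) (n := 6) (w_mem i) (s_mem i (n := 6) (g7_mem k))

theorem dFun_mem {k : ℕ} (a : ToroidGen k) :
    dFun a ∈ FreeGC.grading (ToroidGen.deg (k := k)) (a.deg + 1) := by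
  cases a with
  | g4 I h =>
    refine Submodule.smul_mem _ _ (sWord_mem _ ?_)
    rw [Finset.length_sort, show ToroidGen.deg (.g4 I h) + 1 + I.card = 5 by
      simp only [ToroidGen.deg]; omega]
    exact dg4_mem k
  | g7 I h =>
    refine Submodule.smul_mem _ _ (sWord_mem _ ?_)
    rw [Finset.length_sort, show ToroidGen.deg (.g7 I h) + 1 + I.card = 8 by
      simp only [ToroidGen.deg]; omega]
    exact dg7_mem k
  | w i => exact Submodule.zero_mem _

theorem dFun_odd {k : ℕ} (a : ToroidGen k) : ∃ n, Odd (n + a.deg) ∧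
    dFun a ∈ FreeGC.grading (ToroidGen.deg (k := k)) n :=
  ⟨a.deg + 1, ⟨a.deg, by omega⟩, dFun_mem a⟩

/-- The differential of the model of the toroidification. -/
noncomputable def d (k : ℕ) : Module.End ℝ (ToroidAlg k) := FreeGC.oddDer dFun dFun_odd

theorem d_mem {k : ℕ} {n : ℕ} {x : ToroidAlg k}
    (hx : x ∈ FreeGC.grading (ToroidGen.deg (k := k)) n) :
    d k x ∈ FreeGC.grading (ToroidGen.deg (k := k)) (n + 1) := by
  refine FreeGC.grading_induction (P := fun x => d k x ∈ FreeGC.grading _ (n + 1))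
    ?_ (by simp) ?_ ?_ x hx
  · clear hx x
    intro l h
    subst h
    induction l with
    | nil => rw [FreeGC.mono_nil, d, FreeGC.oddDer_one]; exact Submodule.zero_mem _
    | cons a l ih =>
      rw [FreeGC.mono_cons, d, FreeGC.oddDer_mul, FreeGC.oddDer_gen, List.map_cons, List.sum_cons]
      refine Submodule.add_mem _ ?_ ?_
      · have h1 := FreeGC.mul_mem (dFun_mem a) (FreeGC.mono_mem ToroidGen.deg l)
        rwa [Nat.add_right_comm] at h1
      · rw [FreeGC.sgn_gen, smul_mul_assoc]
        rw [add_assoc]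
        exact Submodule.smul_mem _ _ (FreeGC.mul_mem (FreeGC.gen_mem ToroidGen.deg a) ih)
  · intro x y h1 h2
    rw [map_add]; exact Submodule.add_mem _ h1 h2
  · intro r x h1
    rw [map_smul]; exact Submodule.smul_mem _ _ h1

theorem sSign_anticomm {k : ℕ} (i j : Fin k) (I : Finset (Fin k)) :
    sSign j I * sSign i (insert j I) + sSign i I * sSign j (insert i I) = 0 := by
  wlog hij : i ≤ j generalizing i j
  · rw [add_comm]; exact this j i (le_of_not_ge hij)
  rcases hij.eq_or_lt with rfl | hij
  · simp [sSign]
  by_cases hi : i ∈ I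
  · simp [sSign, hi]
  by_cases hj : j ∈ I
  · simp [sSign, hj]
  have h1 : Finset.filter (· < i) (insert j I) = Finset.filter (· < i) I := by
    rw [Finset.filter_insert, if_neg (not_lt.mpr hij.le)]
  have h2 : Finset.filter (· < j) (insert i I) = insert i (Finset.filter (· < j) I) := by
    rw [Finset.filter_insert, if_pos hij]
  have h3 : i ∉ Finset.filter (· < j) I := fun h => hi (Finset.mem_filter.mp h).1
  simp only [sSign, Finset.mem_insert, hi, hj, hij.ne, hij.ne', or_self, if_false, h1, h2,
    Finset.card_insert_of_notMem h3, pow_succ]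
  ring

theorem s_sg4 {k : ℕ} (i : Fin k) (I : Finset (Fin k)) :
    s i (sg4 I) = sSign i I • sg4 (insert i I) := by
  by_cases h : I.card ≤ 3
  · rw [sg4, dif_pos h, s, FreeGC.oddDer_gen, sFun]
  · have h2 : ¬ (insert i I).card ≤ 3 := fun h' =>
      h ((Finset.card_le_card (Finset.subset_insert i I)).trans h')
    rw [sg4, dif_neg h, sg4, dif_neg h2, map_zero, smul_zero]

theorem s_sg7 {k : ℕ} (i : Fin k) (I : Finset (Fin k)) :
    s i (sg7 I) = sSign i I • sg7 (insert i I) := by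
  by_cases h : I.card ≤ 6
  · rw [sg7, dif_pos h, s, FreeGC.oddDer_gen, sFun]
  · have h2 : ¬ (insert i I).card ≤ 6 := fun h' =>
      h ((Finset.card_le_card (Finset.subset_insert i I)).trans h')
    rw [sg7, dif_neg h, sg7, dif_neg h2, map_zero, smul_zero]

theorem s_w {k : ℕ} (i j : Fin k) : s i (w j) = 0 := by
  rw [s, w, FreeGC.oddDer_gen, sFun]

theorem d_w {k : ℕ} (j : Fin k) : d k (w j) = 0 := by
  rw [d, w, FreeGC.oddDer_gen, dFun]

theorem s_anticomm {k : ℕ} (i j : Fin k) (x : ToroidAlg k) :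
    s i (s j x) + s j (s i x) = 0 := by
  refine FreeGC.oddDer_anticomm _ _ (sFun_odd i) (sFun_odd j) (fun a => ?_) x
  change s i (sFun j a) + s j (sFun i a) = 0
  cases a with
  | g4 I h =>
    simp only [sFun, map_smul, s_sg4, smul_smul]
    rw [Finset.insert_comm, ← add_smul, sSign_anticomm, zero_smul]
  | g7 I h =>
    simp only [sFun, map_smul, s_sg7, smul_smul]
    rw [Finset.insert_comm, ← add_smul, sSign_anticomm, zero_smul]
  | w l => simp [sFun]

theorem s_s {k : ℕ} (i : Fin k) (x : ToroidAlg k) : s i (s i x) = 0 := by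
  have h := s_anticomm i i x
  rwa [← two_smul ℝ, smul_eq_zero_iff_right two_ne_zero] at h

theorem s_mul {k : ℕ} (i : Fin k) (x y : ToroidAlg k) :
    s i (x * y) = s i x * y + FreeGC.sgn _ x * s i y :=
  FreeGC.oddDer_mul _ (sFun_odd i) x y

theorem d_mul {k : ℕ} (x y : ToroidAlg k) :
    d k (x * y) = d k x * y + FreeGC.sgn _ x * d k y :=
  FreeGC.oddDer_mul _ dFun_odd x y

theorem sgn_w {k : ℕ} (i : Fin k) : FreeGC.sgn (ToroidGen.deg (k := k)) (w i) = w i := by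
  rw [FreeGC.sgn_of_mem _ (w_mem i)]; norm_num

theorem s_sWord {k : ℕ} (i : Fin k) (l : List (Fin k)) (hl : l.Pairwise (· < ·))
    (x : ToroidAlg k) :
    s i (sWord l x) = if i ∈ l then 0 else
      (-1 : ℝ) ^ (l.countP (· < i)) • sWord (l.orderedInsert (· ≤ ·) i) x := by
  induction l with
  | nil => simp [sWord]
  | cons a l ih =>
    rw [List.pairwise_cons] at hl
    have ih := ih hl.2
    rcases lt_trichotomy i a with h | rfl | h
    · have h1 : i ∉ a :: l := by
        intro h'
        rcases List.mem_cons.mp h' with h' | h'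
        · exact h.ne h'
        · exact absurd (hl.1 i h') (not_lt.mpr h.le)
      have h2 : (a :: l).countP (· < i) = 0 := by
        rw [List.countP_eq_zero]
        intro b hb
        rcases List.mem_cons.mp hb with rfl | hb
        · simpa using h.le
        · simpa using (h.trans (hl.1 b hb)).le
      rw [if_neg h1, h2, List.orderedInsert_cons_of_le _ _ h.le, sWord_cons i]
      simp
    · rw [sWord_cons, s_s, if_pos List.mem_cons_self]
    · rw [sWord_cons, eq_neg_of_add_eq_zero_left (s_anticomm i a _), ih]
      by_cases hi : i ∈ l
      · rw [if_pos hi, if_pos (List.mem_cons_of_mem _ hi), map_zero, neg_zero]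
      · have h1 : i ∉ a :: l := by simp [hi, h.ne']
        rw [if_neg hi, if_neg h1, List.orderedInsert_of_not_le _ _ (not_le.mpr h), map_smul,
          sWord_cons, List.countP_cons]
        simp [h, pow_succ]

theorem s_sSet {k : ℕ} (i : Fin k) (I : Finset (Fin k)) (x : ToroidAlg k) :
    s i (sSet I x) = sSign i I • sSet (insert i I) x := by
  rw [sSet, s_sWord _ _ (Finset.sortedLT_sort I).pairwise, sSign]
  by_cases hi : i ∈ I
  · simp [hi]
  · rw [if_neg (by simpa using hi), if_neg hi]
    have h1 : (I.sort (· ≤ ·)).countP (· < i) = (I.filter (· < i)).card := by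
      rw [Finset.card_def, Finset.filter_val, ← Multiset.countP_eq_card_filter,
        ← Finset.sort_eq I (· ≤ ·), Multiset.coe_countP]
    have h2 : (I.sort (· ≤ ·)).orderedInsert (· ≤ ·) i = (insert i I).sort (· ≤ ·) := by
      refine List.Perm.eq_of_pairwise' (r := (· ≤ ·)) ?_ (Finset.pairwise_sort _ _) ?_
      · exact (Finset.pairwise_sort I (· ≤ ·)).orderedInsert _ _
      · refine (List.perm_orderedInsert _ _ _).trans ?_
        rw [List.perm_ext_iff_of_nodup _ (Finset.sort_nodup _ _)]
        · intro a; simp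
        · simp [hi]
    rw [h1, h2, sSet]

theorem sWord_g4 {k : ℕ} (l : List (Fin k)) :
    ∃ (c : ℝ) (I : Finset (Fin k)), sWord l (g4 k) = c • sg4 I ∧ (c = 0 ∨ I.card = l.length) := by
  induction l with
  | nil => exact ⟨1, ∅, by simp [sWord, g4], by simp⟩
  | cons i l ih =>
    obtain ⟨c, I, h1, h2⟩ := ih
    refine ⟨c * sSign i I, insert i I, by rw [sWord_cons, h1, map_smul, s_sg4, smul_smul], ?_⟩
    rcases h2 with rfl | h2
    · simp
    · by_cases hi : i ∈ I
      · simp [sSign, hi]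
      · right; rw [Finset.card_insert_of_notMem hi, h2, List.length_cons]

theorem sWord_g7 {k : ℕ} (l : List (Fin k)) :
    ∃ (c : ℝ) (I : Finset (Fin k)), sWord l (g7 k) = c • sg7 I ∧ (c = 0 ∨ I.card = l.length) := by
  induction l with
  | nil => exact ⟨1, ∅, by simp [sWord, g7], by simp⟩
  | cons i l ih =>
    obtain ⟨c, I, h1, h2⟩ := ih
    refine ⟨c * sSign i I, insert i I, by rw [sWord_cons, h1, map_smul, s_sg7, smul_smul], ?_⟩
    rcases h2 with rfl | h2
    · simp
    · by_cases hi : i ∈ I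
      · simp [sSign, hi]
      · right; rw [Finset.card_insert_of_notMem hi, h2, List.length_cons]

theorem sWord_g4_zero {k : ℕ} (l : List (Fin k)) (hl : 4 ≤ l.length) : sWord l (g4 k) = 0 := by
  obtain ⟨c, I, h1, h2⟩ := sWord_g4 l
  rcases h2 with rfl | h2
  · rw [h1, zero_smul]
  · rw [h1, sg4, dif_neg (by omega), smul_zero]

theorem sWord_g7_zero {k : ℕ} (l : List (Fin k)) (hl : 7 ≤ l.length) : sWord l (g7 k) = 0 := by
  obtain ⟨c, I, h1, h2⟩ := sWord_g7 l
  rcases h2 with rfl | h2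
  · rw [h1, zero_smul]
  · rw [h1, sg7, dif_neg (by omega), smul_zero]

theorem sWord_append {k : ℕ} (l m : List (Fin k)) (x : ToroidAlg k) :
    sWord (l ++ m) x = sWord l (sWord m x) := by
  simp [sWord]

theorem sWord_w_mul {k : ℕ} (l : List (Fin k)) (i : Fin k) (x : ToroidAlg k) :
    sWord l (w i * x) = w i * sWord l x := by
  induction l with
  | nil => simp [sWord]
  | cons j l ih => rw [sWord_cons, sWord_cons, ih, s_mul, s_w, sgn_w, zero_mul, zero_add]

theorem sgn_sWord_g4 {k : ℕ} (l : List (Fin k)) :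
    ∃ c : ℝ, FreeGC.sgn _ (sWord l (g4 k)) = c • sWord l (g4 k) := by
  induction l with
  | nil => exact ⟨(-1) ^ 4, FreeGC.sgn_of_mem _ (g4_mem k)⟩
  | cons i l ih =>
    obtain ⟨c, hc⟩ := ih
    refine ⟨-c, ?_⟩
    rw [sWord_cons, s, FreeGC.sgn_oddDer, hc, map_smul, neg_smul]

theorem sWord_g4_sq {k : ℕ} (l : List (Fin k)) :
    sWord l (g4 k * g4 k) ∈ Submodule.span ℝ {x : ToroidAlg k | ∃ A B : List (Fin k),
      A.length + B.length = l.length ∧ sWord A (g4 k) * sWord B (g4 k) = x} := by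
  induction l with
  | nil => exact Submodule.subset_span ⟨[], [], rfl, by simp [sWord]⟩
  | cons i l ih =>
    rw [sWord_cons]
    generalize sWord l (g4 k * g4 k) = y at ih
    induction ih using Submodule.span_induction with
    | mem x h =>
      obtain ⟨A, B, h, rfl⟩ := h
      obtain ⟨c, hc⟩ := sgn_sWord_g4 A
      rw [s_mul, hc, smul_mul_assoc]
      refine Submodule.add_mem _ (Submodule.subset_span ⟨i :: A, B, ?_, ?_⟩)
        (Submodule.smul_mem _ _ (Submodule.subset_span ⟨A, i :: B, ?_, ?_⟩))
      · simp only [List.length_cons]; omega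
      · rw [sWord_cons]
      · simp only [List.length_cons]; omega
      · rw [sWord_cons]
    | zero => rw [map_zero]; exact Submodule.zero_mem _
    | add x y _ _ h1 h2 => rw [map_add]; exact Submodule.add_mem _ h1 h2
    | smul r x _ h => rw [map_smul]; exact Submodule.smul_mem _ _ h

theorem sWord_g4_sq_zero {k : ℕ} (l : List (Fin k)) (hl : 7 ≤ l.length) :
    sWord l (g4 k * g4 k) = 0 := by
  have h := sWord_g4_sq l
  have h2 : {x : ToroidAlg k | ∃ A B : List (Fin k),
      A.length + B.length = l.length ∧ sWord A (g4 k) * sWord B (g4 k) = x} ⊆ {0} := by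
    rintro _ ⟨A, B, h, rfl⟩
    rcases le_or_gt 4 A.length with hA | hA
    · rw [sWord_g4_zero A hA, zero_mul]; rfl
    · rw [sWord_g4_zero B (by omega), mul_zero]; rfl
  have h3 := Submodule.span_mono (R := ℝ) h2 h
  rwa [Submodule.span_zero_singleton, Submodule.mem_bot] at h3

theorem sWord_dg4_zero {k : ℕ} (l : List (Fin k)) (hl : 4 ≤ l.length) : sWord l (dg4 k) = 0 := by
  rw [dg4, map_sum]
  refine Finset.sum_eq_zero fun i _ => ?_
  have h := sWord_g4_zero (l ++ [i]) (by rw [List.length_append]; omega)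
  rw [sWord_append] at h
  have h2 : sWord [i] (g4 k) = s i (g4 k) := by simp [sWord]
  rw [h2] at h
  rw [sWord_w_mul, h, mul_zero]

theorem sWord_dg7_zero {k : ℕ} (l : List (Fin k)) (hl : 7 ≤ l.length) : sWord l (dg7 k) = 0 := by
  rw [dg7, map_add, map_smul, sWord_g4_sq_zero l hl, smul_zero, zero_add, map_sum]
  refine Finset.sum_eq_zero fun i _ => ?_
  have h := sWord_g7_zero (l ++ [i]) (by rw [List.length_append]; omega)
  rw [sWord_append] at h
  have h2 : sWord [i] (g7 k) = s i (g7 k) := by simp [sWord]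
  rw [h2] at h
  rw [sWord_w_mul, h, mul_zero]

theorem d_sg4 {k : ℕ} (I : Finset (Fin k)) :
    d k (sg4 I) = (-1 : ℝ) ^ I.card • sSet I (dg4 k) := by
  by_cases h : I.card ≤ 3
  · rw [sg4, dif_pos h, d, FreeGC.oddDer_gen, dFun]
  · rw [sg4, dif_neg h, sSet, sWord_dg4_zero, map_zero, smul_zero]
    rw [Finset.length_sort]; omega

theorem d_sg7 {k : ℕ} (I : Finset (Fin k)) :
    d k (sg7 I) = (-1 : ℝ) ^ I.card • sSet I (dg7 k) := by
  by_cases h : I.card ≤ 6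
  · rw [sg7, dif_pos h, d, FreeGC.oddDer_gen, dFun]
  · rw [sg7, dif_neg h, sSet, sWord_dg7_zero, map_zero, smul_zero]
    rw [Finset.length_sort]; omega

theorem d_g4 (k : ℕ) : d k (g4 k) = ∑ i, w i * s i (g4 k) := by
  rw [g4, d_sg4]; simp [sSet, sWord, dg4, g4]

theorem d_g7 (k : ℕ) :
    d k (g7 k) = -(1 / 2 : ℝ) • (g4 k * g4 k) + ∑ i, w i * s i (g7 k) := by
  rw [g7, d_sg7]; simp [sSet, sWord, dg7, g7]

/-- The relation `[d, s_i] = 0` (a graded commutator of odd operators). -/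
theorem d_s {k : ℕ} (i : Fin k) (x : ToroidAlg k) : d k (s i x) + s i (d k x) = 0 := by
  refine FreeGC.oddDer_anticomm _ _ dFun_odd (sFun_odd i) (fun a => ?_) x
  change d k (sFun i a) + s i (dFun a) = 0
  cases a with
  | g4 I h =>
    simp only [sFun, dFun, map_smul, d_sg4, s_sSet]
    by_cases hi : i ∈ I
    · simp [sSign, hi]
    · rw [Finset.card_insert_of_notMem hi, pow_succ, smul_comm]
      simp
  | g7 I h =>
    simp only [sFun, dFun, map_smul, d_sg7, s_sSet]
    by_cases hi : i ∈ I
    · simp [sSign, hi]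
    · rw [Finset.card_insert_of_notMem hi, pow_succ, smul_comm]
      simp
  | w l => simp [sFun, dFun]

theorem sum_w_s_s {k : ℕ} (x : ToroidAlg k) :
    ∑ i, w i * s i (∑ j, w j * s j x) = 0 := by
  have hw : ∀ i j : Fin k, w i * w j = w j * w i := fun i j => by
    rw [FreeGC.graded_comm (w_mem i) (w_mem j)]; norm_num
  have h1 : ∀ i : Fin k, w i * s i (∑ j, w j * s j x) = ∑ j, w i * w j * s i (s j x) := by
    intro i
    rw [map_sum, Finset.mul_sum]
    refine Finset.sum_congr rfl fun j _ => ?_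
    rw [s_mul, s_w, sgn_w, zero_mul, zero_add, mul_assoc]
  simp only [h1]
  have h2 : ∑ i : Fin k, ∑ j, w i * w j * s i (s j x) =
      -∑ i : Fin k, ∑ j, w i * w j * s i (s j x) := by
    conv_lhs => rw [Finset.sum_comm]
    rw [← Finset.sum_neg_distrib]
    refine Finset.sum_congr rfl fun i _ => ?_
    rw [← Finset.sum_neg_distrib]
    refine Finset.sum_congr rfl fun j _ => ?_
    rw [eq_neg_of_add_eq_zero_left (s_anticomm j i x), hw, mul_neg]
  rw [eq_neg_iff_add_eq_zero, ← two_smul ℝ, smul_eq_zero_iff_right two_ne_zero] at h2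
  exact h2

theorem d_dg4 (k : ℕ) : d k (dg4 k) = 0 := by
  have h : d k (dg4 k) = -∑ i, w i * s i (d k (g4 k)) := by
    rw [dg4, map_sum, ← Finset.sum_neg_distrib]
    refine Finset.sum_congr rfl fun i _ => ?_
    rw [d_mul, d_w, sgn_w, zero_mul, zero_add, eq_neg_of_add_eq_zero_left (d_s i _), mul_neg]
  rw [h, d_g4, sum_w_s_s, neg_zero]

theorem d_dg7 (k : ℕ) : d k (dg7 k) = 0 := by
  have h : d k (∑ i, w i * s i (g7 k)) = -∑ i, w i * s i (d k (g7 k)) := by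
    rw [map_sum, ← Finset.sum_neg_distrib]
    refine Finset.sum_congr rfl fun i _ => ?_
    rw [d_mul, d_w, sgn_w, zero_mul, zero_add, eq_neg_of_add_eq_zero_left (d_s i _), mul_neg]
  have hg : FreeGC.sgn _ (g4 k) = g4 k := by
    rw [FreeGC.sgn_of_mem _ (g4_mem k)]; norm_num
  have h1 : ∀ x : ToroidAlg k, x * g4 k = g4 k * x := by
    refine FreeGC.mono_induction ?_ (by simp) ?_ ?_
    · intro l
      rw [FreeGC.graded_comm (FreeGC.mono_mem _ l) (g4_mem k), Even.neg_one_pow, one_smul]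
      exact Even.mul_left ⟨2, rfl⟩ _
    · intro x y hx hy
      rw [add_mul, mul_add, hx, hy]
    · intro r x hx
      rw [smul_mul_assoc, mul_smul_comm, hx]
  have h2 : ∀ i : Fin k, s i (g4 k * g4 k) = (2 : ℝ) • (s i (g4 k) * g4 k) := fun i => by
    rw [s_mul, hg, ← h1, two_smul]
  have h3 : d k (g4 k * g4 k) = (2 : ℝ) • (d k (g4 k) * g4 k) := by
    rw [d_mul, hg, ← h1, two_smul]
  have h4 : ∀ i : Fin k, w i * s i (d k (g7 k)) =
      -(w i * s i (g4 k) * g4 k) + w i * s i (∑ j, w j * s j (g7 k)) := fun i => by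
    rw [d_g7, map_add, map_smul, h2, mul_add, smul_smul, mul_assoc]
    norm_num
  rw [dg7, map_add, map_smul, h, h3, smul_smul, d_g4]
  simp only [h4]
  rw [Finset.sum_add_distrib, sum_w_s_s, add_zero, Finset.sum_neg_distrib, Finset.sum_mul]
  norm_num

theorem d_sWord_zero {k : ℕ} (l : List (Fin k)) (x : ToroidAlg k) (hx : d k x = 0) :
    d k (sWord l x) = 0 := by
  induction l with
  | nil => simpa [sWord] using hx
  | cons i l ih =>
    rw [sWord_cons, eq_neg_of_add_eq_zero_left (d_s i _), ih, map_zero, neg_zero]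

theorem d_d {k : ℕ} (x : ToroidAlg k) : d k (d k x) = 0 := by
  have h := FreeGC.oddDer_anticomm (dFun (k := k)) dFun dFun_odd dFun_odd ?_ x
  · change d k (d k x) + d k (d k x) = 0 at h
    rwa [← two_smul ℝ, smul_eq_zero_iff_right two_ne_zero] at h
  · intro a
    change d k (dFun a) + d k (dFun a) = 0
    have h : d k (dFun a) = 0 := by
      cases a with
      | g4 I h => rw [dFun, map_smul, sSet, d_sWord_zero _ _ (d_dg4 k), smul_zero]
      | g7 I h => rw [dFun, map_smul, sSet, d_sWord_zero _ _ (d_dg7 k), smul_zero]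
      | w i => rw [dFun, map_zero]
    rw [h, add_zero]

/-- The augmentation, which sends all generators to zero. -/
noncomputable def aug (k : ℕ) : ToroidAlg k →ₐ[ℝ] ℝ :=
  FreeGC.lift (fun _ => 0) (by simp)

theorem aug_mem {k : ℕ} {n : ℕ} {x : ToroidAlg k}
    (hx : x ∈ FreeGC.grading (ToroidGen.deg (k := k)) n) (hn : n ≠ 0) : aug k x = 0 := by
  refine FreeGC.grading_induction (P := fun x => aug k x = 0) ?_ (by simp) ?_ ?_ x hx
  · intro l hl
    cases l with
    | nil => exact absurd hl.symm hn
    | cons a l => rw [FreeGC.mono_cons, map_mul, aug, FreeGC.lift_gen, zero_mul]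
  · intro x y h1 h2
    rw [map_add, h1, h2, add_zero]
  · intro r x h
    rw [map_smul, h, smul_zero]

theorem aug_d {k : ℕ} (x : ToroidAlg k) : aug k (d k x) = 0 := by
  revert x
  refine FreeGC.mono_induction ?_ (by simp) ?_ ?_
  · intro l
    exact aug_mem (d_mem (FreeGC.mono_mem _ l)) (Nat.succ_ne_zero _)
  · intro x y h1 h2
    rw [map_add, map_add, h1, h2, add_zero]
  · intro r x h
    rw [map_smul, map_smul, h, smul_zero]

end Toroid

/-- The Sullivan minimal model `M(T^k S⁴)` of the `k`-toroidification of the `4`-sphere: the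
algebraic toroidification of `M(S⁴) = (ℝ[g₄, g₇], d g₄ = 0, d g₇ = -½ g₄²)`. -/
noncomputable def toroidModel (k : ℕ) : AugDGCA (ToroidAlg k) where
  grading := FreeGC.grading ToroidGen.deg
  one_mem := FreeGC.one_mem _
  mul_mem := FreeGC.mul_mem
  isInternal := FreeGC.isInternal _
  graded_comm := FreeGC.graded_comm
  d := Toroid.d k
  d_mem := Toroid.d_mem
  d_mul := fun hx y => by
    rw [Toroid.d_mul, FreeGC.sgn_of_mem _ hx, smul_mul_assoc]
  d_d := Toroid.d_d
  aug := Toroid.aug k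
  aug_mem := Toroid.aug_mem
  aug_d := Toroid.aug_d

/-- A derivation of `S(V)` is linear if it is induced by a linear map `V → V ⊂ S(V)`. -/
def IsLinearDer {ι : Type} {deg : ι → ℕ} (D : Module.End ℝ (FreeGC deg)) : Prop :=
  ∀ a, D (FreeGC.gen deg a) ∈ Submodule.span ℝ (Set.range (FreeGC.gen deg))

/-- The Cartan subalgebra `𝔥_k`; the vector `v` stands for `∑ v_j h_j` in the basis
`h_0, …, h_k`. -/
abbrev CartanE (k : ℕ) : Type := Fin (k + 1) → ℝ

/-- The functionals `ε_j`: `ε_0(h_0) = -1`, `ε_i(h_i) = 1` for `1 ≤ i ≤ k`, and `ε_i(h_j) = 0`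
for `i ≠ j`. -/
def epsE (k : ℕ) (j : Fin (k + 1)) : CartanE k →ₗ[ℝ] ℝ :=
  if j = 0 then -LinearMap.proj j else LinearMap.proj j

/-- The simple roots `α_i = ε_i - ε_{i+1}` for `1 ≤ i ≤ k - 1` and
`α_k = ε_0 - ε_1 - ε_2 - ε_3`. Here, as in all that follows, the element `i : Fin k` stands for the
index `i + 1` of `{1, …, k}`. -/
def rootE (k : ℕ) (i : Fin k) : CartanE k →ₗ[ℝ] ℝ :=
  if hi : i.val + 1 < k then epsE k i.succ - epsE k (⟨i.val + 1, hi⟩ : Fin k).succ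
  else epsE k 0 - ∑ j : Fin k with j.val < 3, epsE k j.succ

/-- The simple coroots `h_i - h_{i+1}` for `1 ≤ i ≤ k - 1` and `h_0 - h_1 - h_2 - h_3`. -/
def corootE (k : ℕ) (i : Fin k) : CartanE k :=
  if hi : i.val + 1 < k then Pi.single i.succ 1 - Pi.single (⟨i.val + 1, hi⟩ : Fin k).succ 1
  else Pi.single 0 1 - ∑ j : Fin k with j.val < 3, Pi.single j.succ 1

/-- The edges of the Dynkin diagram of type `E_k`: the chain `1 - 2 - ⋯ - (k-1)` and, if `k ≥ 4`,
the edge `3 - k`. -/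
def adjE (k : ℕ) (i j : Fin k) : Prop :=
  (i.val + 1 = j.val ∧ j.val + 1 < k) ∨ (j.val + 1 = i.val ∧ i.val + 1 < k) ∨
    (i.val = 2 ∧ 3 < k ∧ j.val + 1 = k) ∨ (j.val = 2 ∧ 3 < k ∧ i.val + 1 = k)

instance (k : ℕ) (i j : Fin k) : Decidable (adjE k i j) :=
  inferInstanceAs (Decidable (_ ∨ _))

/-- The generalized Cartan matrix of type `E_k`. -/
def cartanE (k : ℕ) : Matrix (Fin k) (Fin k) ℤ := fun i j =>
  if i = j then 2 else if adjE k i j then -1 else 0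

theorem rootE_apply_of_lt {k : ℕ} (i : Fin k) (hi : i.val + 1 < k) (v : CartanE k) :
    rootE k i v = v i.succ - v (⟨i.val + 1, hi⟩ : Fin k).succ := by
  simp [rootE, hi, epsE, Fin.succ_ne_zero]

theorem rootE_apply_of_eq {k : ℕ} (hk : 3 ≤ k) (i : Fin k) (hi : ¬ i.val + 1 < k)
    (v : CartanE k) : rootE k i v = -v 0 - (v (⟨0, by omega⟩ : Fin k).succ +
      v (⟨1, by omega⟩ : Fin k).succ + v (⟨2, by omega⟩ : Fin k).succ) := by
  have h : (Finset.univ.filter fun j : Fin k => j.val < 3) =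
      {⟨0, by omega⟩, ⟨1, by omega⟩, ⟨2, by omega⟩} := by
    ext j
    simp only [Finset.mem_filter, Finset.mem_univ, true_and, Finset.mem_insert,
      Finset.mem_singleton, Fin.ext_iff]
    omega
  simp only [rootE, hi, dif_neg, not_false_iff, h, epsE]
  rw [Finset.sum_insert (by simp), Finset.sum_insert (by simp), Finset.sum_singleton]
  simp [add_assoc]

theorem corootE_apply_of_lt {k : ℕ} (i : Fin k) (hi : i.val + 1 < k) (j : Fin (k + 1)) :
    corootE k i j = (if j.val = i.val + 1 then 1 else 0) - if j.val = i.val + 2 then 1 else 0 := by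
  simp [corootE, hi, Pi.single_apply, Fin.ext_iff]

theorem corootE_apply_of_eq {k : ℕ} (hk : 3 ≤ k) (i : Fin k) (hi : ¬ i.val + 1 < k)
    (j : Fin (k + 1)) : corootE k i j = (if j.val = 0 then 1 else 0) -
      if j.val = 0 then 0 else if j.val < 4 then 1 else 0 := by
  have h : (Finset.univ.filter fun j : Fin k => j.val < 3) =
      {⟨0, by omega⟩, ⟨1, by omega⟩, ⟨2, by omega⟩} := by
    ext j
    simp only [Finset.mem_filter, Finset.mem_univ, true_and, Finset.mem_insert,
      Finset.mem_singleton, Fin.ext_iff]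
    omega
  simp only [corootE, hi, dif_neg, not_false_iff, h]
  rw [Finset.sum_insert (by simp), Finset.sum_insert (by simp), Finset.sum_singleton]
  simp only [Pi.sub_apply, Pi.add_apply, Pi.single_apply, Fin.ext_iff, Fin.val_zero, Fin.val_succ]
  split_ifs <;> first | omega | norm_num

theorem cartanE_cast {k : ℕ} (i j : Fin k) : (cartanE k i j : ℝ) =
    if i.val = j.val then 2 else if (i.val + 1 = j.val ∧ j.val + 1 < k) ∨
      (j.val + 1 = i.val ∧ i.val + 1 < k) ∨ (i.val = 2 ∧ 3 < k ∧ j.val + 1 = k) ∨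
      (j.val = 2 ∧ 3 < k ∧ i.val + 1 = k) then -1 else 0 := by
  unfold cartanE
  by_cases h : i = j
  · simp [h]
  · by_cases h2 : adjE k i j
    · rw [if_neg h, if_pos h2, if_neg (fun h' => h (Fin.ext h')), if_pos]
      · norm_num
      · exact h2
    · rw [if_neg h, if_neg h2, if_neg (fun h' => h (Fin.ext h')), if_neg]
      · norm_num
      · exact h2

set_option maxHeartbeats 1000000 in
/-- The entries of the generalized Cartan matrix are the values of the roots on the coroots. -/
theorem rootE_corootE {k : ℕ} (hk : 3 ≤ k) (i j : Fin k) :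
    rootE k i (corootE k j) = cartanE k j i := by
  have hi' := i.isLt
  have hj' := j.isLt
  by_cases hi : i.val + 1 < k <;> by_cases hj : j.val + 1 < k
  · rw [rootE_apply_of_lt _ hi, corootE_apply_of_lt _ hj, corootE_apply_of_lt _ hj]
    simp only [cartanE_cast, Fin.val_succ]
    split_ifs <;> first | omega | norm_num
  · rw [rootE_apply_of_lt _ hi, corootE_apply_of_eq hk _ hj, corootE_apply_of_eq hk _ hj]
    simp only [cartanE_cast, Fin.val_succ, Nat.add_eq_zero_iff, one_ne_zero, and_false, if_false]
    split_ifs <;> first | omega | norm_num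
  · rw [rootE_apply_of_eq hk _ hi]
    simp only [corootE_apply_of_lt _ hj]
    simp only [cartanE_cast, Fin.val_succ, Fin.val_zero]
    have e1 : ¬ 0 = j.val + 1 := by omega
    have e2 : ¬ 0 = j.val + 2 := by omega
    simp only [e1, e2, if_false, Nat.zero_add, Nat.reduceAdd, Nat.reduceEqDiff]
    split_ifs <;> first | contradiction | omega | norm_num
  · rw [rootE_apply_of_eq hk _ hi]
    simp only [corootE_apply_of_eq hk _ hj]
    have h : j.val = i.val := by omega
    simp only [cartanE_cast, Fin.val_succ, Fin.val_zero, h, if_true]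
    norm_num

/-- The generators of the Lie algebra `𝔤_k`: the Chevalley generators `e_i`, `f_i` and the basis
`h_0, …, h_k` of the Cartan subalgebra. -/
inductive ChevGen (k : ℕ) : Type
  | e (i : Fin k) : ChevGen k
  | f (i : Fin k) : ChevGen k
  | h (j : Fin (k + 1)) : ChevGen k

namespace ChevGen

/-- The free generator `e_i`. -/
noncomputable def freeE {k : ℕ} (i : Fin k) : FreeLieAlgebra ℝ (ChevGen k) :=
  FreeLieAlgebra.of ℝ (.e i)

/-- The free generator `f_i`. -/
noncomputable def freeF {k : ℕ} (i : Fin k) : FreeLieAlgebra ℝ (ChevGen k) :=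
  FreeLieAlgebra.of ℝ (.f i)

/-- The element `∑ v_j h_j` of the free Lie algebra. -/
noncomputable def freeH {k : ℕ} (v : CartanE k) : FreeLieAlgebra ℝ (ChevGen k) :=
  ∑ j, v j • FreeLieAlgebra.of ℝ (.h j)

/-- The elements which are set to zero in `𝔤_k`. -/
inductive IsRelator (k : ℕ) : FreeLieAlgebra ℝ (ChevGen k) → Prop
  | hh (v v' : CartanE k) : IsRelator k ⁅freeH v, freeH v'⁆
  | he (v : CartanE k) (i : Fin k) : IsRelator k (⁅freeH v, freeE i⁆ - rootE k i v • freeE i)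
  | hf (v : CartanE k) (i : Fin k) : IsRelator k (⁅freeH v, freeF i⁆ + rootE k i v • freeF i)
  | ef_eq (i : Fin k) : IsRelator k (⁅freeE i, freeF i⁆ - freeH (corootE k i))
  | ef_ne (i j : Fin k) (hij : i ≠ j) : IsRelator k ⁅freeE i, freeF j⁆
  | serre_e (i j : Fin k) (hij : i ≠ j) :
      IsRelator k ((LieAlgebra.ad ℝ _ (freeE i) ^ (1 - cartanE k i j).toNat) (freeE j))
  | serre_f (i j : Fin k) (hij : i ≠ j) :
      IsRelator k ((LieAlgebra.ad ℝ _ (freeF i) ^ (1 - cartanE k i j).toNat) (freeF j))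

/-- The ideal generated by the relations of `𝔤_k`. -/
noncomputable def relIdeal (k : ℕ) : LieIdeal ℝ (FreeLieAlgebra ℝ (ChevGen k)) :=
  LieSubmodule.lieSpan ℝ _ {x | IsRelator k x}

end ChevGen

/-- The real Lie algebra `𝔤_k` of type `E_{k(k)}`, given by generators and relations. -/
def LieE (k : ℕ) : Type := FreeLieAlgebra ℝ (ChevGen k) ⧸ ChevGen.relIdeal k

namespace LieE

noncomputable instance (k : ℕ) : LieRing (LieE k) :=
  inferInstanceAs (LieRing (FreeLieAlgebra ℝ (ChevGen k) ⧸ ChevGen.relIdeal k))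

noncomputable instance (k : ℕ) : LieAlgebra ℝ (LieE k) :=
  inferInstanceAs (LieAlgebra ℝ (FreeLieAlgebra ℝ (ChevGen k) ⧸ ChevGen.relIdeal k))

/-- The projection of the free Lie algebra onto `𝔤_k`. -/
noncomputable def mk (k : ℕ) : FreeLieAlgebra ℝ (ChevGen k) →ₗ⁅ℝ⁆ LieE k :=
  { (LieSubmodule.Quotient.mk' (ChevGen.relIdeal k) :
      FreeLieAlgebra ℝ (ChevGen k) →ₗ[ℝ] FreeLieAlgebra ℝ (ChevGen k) ⧸ ChevGen.relIdeal k) with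
    map_lie' := rfl }

/-- The Chevalley generator `e_i` of `𝔤_k`. -/
noncomputable def e {k : ℕ} (i : Fin k) : LieE k := mk k (ChevGen.freeE i)

/-- The Chevalley generator `f_i` of `𝔤_k`. -/
noncomputable def f {k : ℕ} (i : Fin k) : LieE k := mk k (ChevGen.freeF i)

/-- The element `∑ v_j h_j` of the Cartan subalgebra of `𝔤_k`. -/
noncomputable def h {k : ℕ} (v : CartanE k) : LieE k := mk k (ChevGen.freeH v)

/-- The maximal parabolic subalgebra `𝔭_k` of `𝔤_k`, generated by the Cartan subalgebra and by all
the Chevalley generators except `f_k`. -/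
noncomputable def parabolic (k : ℕ) : LieSubalgebra ℝ (LieE k) :=
  LieSubalgebra.lieSpan ℝ (LieE k)
    (Set.range e ∪ f '' {i | i.val + 1 < k} ∪ Set.range h)

/-- The generator `e_i` of `𝔭_k`. -/
noncomputable def pe {k : ℕ} (i : Fin k) : parabolic k :=
  ⟨e i, LieSubalgebra.subset_lieSpan (Or.inl (Or.inl ⟨i, rfl⟩))⟩

/-- The generator `f_i` of `𝔭_k`, for `i ≠ k`. -/
noncomputable def pf {k : ℕ} (i : Fin k) (hi : i.val + 1 < k) : parabolic k :=
  ⟨f i, LieSubalgebra.subset_lieSpan (Or.inl (Or.inr ⟨i, hi, rfl⟩))⟩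

/-- The elements `∑ v_j h_j` of `𝔭_k`. -/
noncomputable def ph {k : ℕ} (v : CartanE k) : parabolic k :=
  ⟨h v, LieSubalgebra.subset_lieSpan (Or.inr ⟨v, rfl⟩)⟩

end LieE

/-- The formulas for the action of the generators of `𝔭_k` on `g₄`, `g₇`, `w_i`, together with
their commutators with the operators `s_i`. The inclusion `Fin.castLE hk` of `Fin 3` into `Fin k`
picks out the indices `1, 2, 3`, and `last` is the index `k`. -/
structure IsParabolicAction (k : ℕ) (hk : 3 ≤ k)
    (ρ : LieE.parabolic k →ₗ⁅ℝ⁆ (toroidModel k).der) : Prop where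
  ek_g4 : ∀ last : Fin k, last.val + 1 = k → (ρ (LieE.pe last)).1 (Toroid.g4 k) = 0
  ek_g7 : ∀ last : Fin k, last.val + 1 = k → (ρ (LieE.pe last)).1 (Toroid.g7 k) = 0
  ek_s_g4 : ∀ last : Fin k, last.val + 1 = k → ∀ i : Fin 3,
    (ρ (LieE.pe last)).1 (Toroid.s (i.castLE hk) (Toroid.g4 k)) = 0
  ek_s_g7 : ∀ last : Fin k, last.val + 1 = k → ∀ i : Fin 3,
    (ρ (LieE.pe last)).1 (Toroid.s (i.castLE hk) (Toroid.g7 k)) = 0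
  ek_ss_g7 : ∀ last : Fin k, last.val + 1 = k → ∀ i j : Fin 3,
    (ρ (LieE.pe last)).1
      (Toroid.s (i.castLE hk) (Toroid.s (j.castLE hk) (Toroid.g7 k))) = 0
  ek_sss_g4 : ∀ last : Fin k, last.val + 1 = k →
    (ρ (LieE.pe last)).1 (Toroid.s (Fin.castLE hk 0) (Toroid.s (Fin.castLE hk 1)
      (Toroid.s (Fin.castLE hk 2) (Toroid.g4 k)))) = 0
  ek_w : ∀ last : Fin k, last.val + 1 = k → ∀ i : Fin k,
    (ρ (LieE.pe last)).1 (Toroid.w i) = 0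
  ek_ss_g4 : ∀ last : Fin k, last.val + 1 = k → ∀ p : Equiv.Perm (Fin 3),
    (ρ (LieE.pe last)).1
      (Toroid.s ((p 0).castLE hk) (Toroid.s ((p 1).castLE hk) (Toroid.g4 k))) =
        ((Equiv.Perm.sign p : ℤ) : ℝ) • Toroid.w ((p 2).castLE hk)
  ek_sss_g7 : ∀ last : Fin k, last.val + 1 = k →
    (ρ (LieE.pe last)).1 (Toroid.s (Fin.castLE hk 0) (Toroid.s (Fin.castLE hk 1)
      (Toroid.s (Fin.castLE hk 2) (Toroid.g7 k)))) = Toroid.g4 k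
  ek_s : ∀ last : Fin k, last.val + 1 = k → ∀ i : Fin k, 3 ≤ i.val →
    ⁅(ρ (LieE.pe last)).1, Toroid.s i⁆ = 0
  h_g4 : ∀ v, (ρ (LieE.ph v)).1 (Toroid.g4 k) = -epsE k 0 v • Toroid.g4 k
  h_g7 : ∀ v, (ρ (LieE.ph v)).1 (Toroid.g7 k) = (-2 * epsE k 0 v) • Toroid.g7 k
  h_s : ∀ v, ∀ i : Fin k, ⁅(ρ (LieE.ph v)).1, Toroid.s i⁆ = epsE k i.succ v • Toroid.s i
  h_w : ∀ v, ∀ i : Fin k, (ρ (LieE.ph v)).1 (Toroid.w i) = -epsE k i.succ v • Toroid.w i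
  e_g4 : ∀ i : Fin k, i.val + 1 < k → (ρ (LieE.pe i)).1 (Toroid.g4 k) = 0
  e_g7 : ∀ i : Fin k, i.val + 1 < k → (ρ (LieE.pe i)).1 (Toroid.g7 k) = 0
  e_w : ∀ (i : Fin k) (hi : i.val + 1 < k) (j : Fin k), (ρ (LieE.pe i)).1 (Toroid.w j) =
    if i = j then Toroid.w ⟨i.val + 1, hi⟩ else 0
  e_s : ∀ (i : Fin k) (_ : i.val + 1 < k) (j : Fin k), ⁅(ρ (LieE.pe i)).1, Toroid.s j⁆ =
    if i.val + 1 = j.val then -Toroid.s i else 0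
  f_g4 : ∀ (i : Fin k) (hi : i.val + 1 < k), (ρ (LieE.pf i hi)).1 (Toroid.g4 k) = 0
  f_g7 : ∀ (i : Fin k) (hi : i.val + 1 < k), (ρ (LieE.pf i hi)).1 (Toroid.g7 k) = 0
  f_w : ∀ (i : Fin k) (hi : i.val + 1 < k) (j : Fin k), (ρ (LieE.pf i hi)).1 (Toroid.w j) =
    if i.val + 1 = j.val then Toroid.w i else 0
  f_s : ∀ (i : Fin k) (hi : i.val + 1 < k) (j : Fin k), ⁅(ρ (LieE.pf i hi)).1, Toroid.s j⁆ =
    if i = j then -Toroid.s ⟨i.val + 1, hi⟩ else 0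

/-!
The action is constructed on the space of generators of `M(T^k S⁴)`. Before the elements of degree
`≤ 0` are discarded, this space is `Gen k = Λ(s) g₄ ⊕ Λ(s) g₇ ⊕ ⟨w_1, …, w_k⟩`, and with the operators
`cr i` (multiplication by `s_i`) and `an i` (contraction with the dual vector) the formulas for the
generators of `𝔭_k` become
* `opN i m`, the action of `𝔤𝔩_k` with `s_m ↦ s_i` and `w_i ↦ -w_m`; `e_i` and `f_i` (`i < k`) act by
  `-opN i (i+1)` and `-opN (i+1) i`, and `h_i` by `opN i i`;
* `opC`, by which `h_0` acts: it multiplies `g₄` by `1` and `g₇` by `2`;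
* `opT a b c`, the trivector `∂_a ∂_b ∂_c` that sends `s_a s_b s_c g₇` to `g₄` and `s_a s_b g₄` to
  `w_c`; `e_k` acts by `opT 1 2 3`.

The canonical anticommutation relations between the `cr i` and `an i` give the brackets of these
operators (`TrivectorRel`), and these imply all relations among the generators of `𝔭_k`
(`TrivectorRel.parabolicRel`).

As `𝔭_k` is defined as a subalgebra of `𝔤_k` and not by a presentation, a representation on a space
`V` that satisfies these relations is obtained from a representation of `𝔤_k`: on the free module
`T(f_1, …, f_k) ⊗ V` the `f_i` act by multiplication and the `e_j` and `h` by being moved to the right.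
Divided by the Serre relations of the `f_i` and by `f_i ⊗ v - 1 ⊗ f_i v` for `i < k`, this is a
`𝔤_k`-module that contains `V`, and `𝔭_k` preserves `V` (`LieE.exists_parabolic_rep`).

An operator on `Gen k` that is homogeneous of degree `0` induces a derivation of the model
(`Fock.exists_isLift`). Whether it commutes with `d` has to be checked on few elements only, since
`d` anticommutes with the `s_i`: on `g₄`, `g₇`, `w_i` for `opN` and `opC`, and on `s_I g₄`, `s_I g₇` with
`I ⊆ {a, b, c}` for `opT a b c`, which commutes with the other `s_i` (`Fock.IsLift.comm_d`). On `s_I g₄`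
the terms of `[opT, d]` cancel because the `w_i` commute with each other; on `s_I g₇` the sum
`∑ w_i s_i` contributes `w_a s_I' g₄`, …, which is balanced by the value of `opT` on `s_I (g₄²)`.

The same reduction gives uniqueness: a derivation for which the commutators with the `s_i` are
prescribed for `i ∉ {1, 2, 3}` is determined by its values on the `w_i` and on `s_I g₄`, `s_I g₇` with
`I ⊆ {1, 2, 3}` (`Fock.der_ext`). Finally, all derivations obtained from `Gen k` are linear.
-/

/-! ### Serre relations and the relations of `𝔭_k` -/

/-- A relation between two Lie algebras that is additive, homogeneous and compatible with the
brackets, total and functional is the graph of a homomorphism. -/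
theorem exists_lieHom_of_graph {P B : Type} [LieRing P] [LieAlgebra ℝ P] [LieRing B]
    [LieAlgebra ℝ B] (R : P → B → Prop)
    (hadd : ∀ {x y : P} {a b : B}, R x a → R y b → R (x + y) (a + b))
    (hsmul : ∀ (r : ℝ) {x : P} {a : B}, R x a → R (r • x) (r • a))
    (hlie : ∀ {x y : P} {a b : B}, R x a → R y b → R ⁅x, y⁆ ⁅a, b⁆)
    (htot : ∀ x, ∃ a, R x a) (hfun : ∀ a, R 0 a → a = 0) :
    ∃ φ : P →ₗ⁅ℝ⁆ B, ∀ x a, R x a ↔ φ x = a := by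
  have huniq : ∀ {x : P} {a b : B}, R x a → R x b → a = b := by
    intro x a b h1 h2
    have h3 := hadd h1 (hsmul (-1) h2)
    rw [neg_one_smul, neg_one_smul, add_neg_cancel] at h3
    exact sub_eq_zero.mp (by rw [sub_eq_add_neg]; exact hfun _ h3)
  choose φ hφ using htot
  exact ⟨{ toFun := φ
           map_add' := fun x y => huniq (hφ _) (hadd (hφ x) (hφ y))
           map_smul' := fun r x => huniq (hφ _) (hsmul r (hφ x))
           map_lie' := fun {x y} => huniq (hφ _) (hlie (hφ x) (hφ y)) },
    fun x a => ⟨fun h => huniq (hφ x) h, fun h => h ▸ hφ x⟩⟩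

/-- The Serre element `ad(X_i)^(1 - c_ij) (X_j)`. -/
noncomputable def serreElt {k : ℕ} {L : Type} [LieRing L] [LieAlgebra ℝ L] (X : Fin k → L)
    (i j : Fin k) : L :=
  (LieAlgebra.ad ℝ L (X i) ^ (1 - cartanE k i j).toNat) (X j)

section Serre

variable {k : ℕ} {L : Type} [LieRing L] [LieAlgebra ℝ L]

theorem serreElt_of_not_adj (X : Fin k → L) {i j : Fin k} (hij : i ≠ j) (h : ¬ adjE k i j) :
    serreElt X i j = ⁅X i, X j⁆ := by
  simp [serreElt, cartanE, hij, h]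

theorem serreElt_of_adj (X : Fin k → L) {i j : Fin k} (hij : i ≠ j) (h : adjE k i j) :
    serreElt X i j = ⁅X i, ⁅X i, X j⁆⁆ := by
  simp [serreElt, cartanE, hij, h, pow_two]

theorem adjE_symm {i j : Fin k} (h : adjE k i j) : adjE k j i := by
  unfold adjE at *; omega

/-- The Serre elements in the `F_i` commute with the `E_l`: this uses only the relations of `E_l`,
`F_i`, `H` other than the Serre relations. -/
theorem lie_serreElt (hk : 3 ≤ k) (E F : Fin k → L) (H : CartanE k →ₗ[ℝ] L)
    (hf : ∀ v i, ⁅H v, F i⁆ = -(rootE k i v • F i))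
    (ef : ∀ i j, ⁅E i, F j⁆ = if i = j then H (corootE k i) else 0)
    (l : Fin k) {i j : Fin k} (hij : i ≠ j) : ⁅E l, serreElt F i j⁆ = 0 := by
  by_cases h : adjE k i j
  · have h' := adjE_symm h
    rw [serreElt_of_adj F hij h, leibniz_lie, leibniz_lie (E l), ef, ef]
    by_cases hli : l = i
    · subst hli
      simp only [if_true, if_neg hij, lie_zero, add_zero, leibniz_lie (H _), hf,
        rootE_corootE hk, lie_smul, lie_neg, neg_lie, smul_lie]
      simp only [cartanE, if_true, if_neg hij, if_pos h]
      module
    · simp only [if_neg hli, zero_lie, zero_add]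
      split_ifs with hlj
      · have hF : ⁅F i, H (corootE k l)⁆ = rootE k i (corootE k l) • F i := by
          rw [← lie_skew, hf, neg_neg]
        rw [hF, lie_smul, lie_self, smul_zero]
      · simp
  · have h' : ¬ adjE k j i := fun h' => h (adjE_symm h')
    rw [serreElt_of_not_adj F hij h, leibniz_lie, ef, ef]
    by_cases hli : l = i
    · subst hli
      simp only [if_true, if_neg hij, lie_zero, add_zero, hf, rootE_corootE hk]
      simp [cartanE, hij, h]
    · simp only [if_neg hli, zero_lie, zero_add]
      split_ifs with hlj
      · rw [← lie_skew, hf, rootE_corootE hk]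
        subst hlj
        simp [cartanE, hli, h']
      · simp

theorem lie_ad_pow {h x y : L} {a b : ℝ} (hx : ⁅h, x⁆ = a • x) (hy : ⁅h, y⁆ = b • y) (n : ℕ) :
    ⁅h, (LieAlgebra.ad ℝ L x ^ n) y⁆ = (n * a + b) • (LieAlgebra.ad ℝ L x ^ n) y := by
  induction n with
  | zero => simp [hy]
  | succ n ih =>
    rw [pow_succ', Module.End.mul_apply, LieAlgebra.ad_apply, leibniz_lie, hx, ih]
    simp only [smul_lie, lie_smul, Nat.cast_succ]
    module

end Serre

theorem lie_comp_of_intertwine {V N : Type} [AddCommGroup V] [Module ℝ V] [AddCommGroup N]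
    [Module ℝ N] (φ : V →ₗ[ℝ] N) {a b : Module.End ℝ V} {A B : Module.End ℝ N}
    (hA : ∀ v, A (φ v) = φ (a v)) (hB : ∀ v, B (φ v) = φ (b v)) (v : V) :
    ⁅A, B⁆ (φ v) = φ (⁅a, b⁆ v) := by
  simp [LieRing.of_associative_ring_bracket, hA, hB]

/-- A map that intertwines two families of operators intertwines their Serre elements. -/
theorem serreElt_comp_of_intertwine {k : ℕ} {V N : Type} [AddCommGroup V] [Module ℝ V]
    [AddCommGroup N] [Module ℝ N] (φ : V →ₗ[ℝ] N) {a : Fin k → Module.End ℝ V}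
    {A : Fin k → Module.End ℝ N} (h : ∀ i v, A i (φ v) = φ (a i v)) (i j : Fin k) (v : V) :
    serreElt A i j (φ v) = φ (serreElt a i j v) := by
  unfold serreElt
  generalize (1 - cartanE k i j).toNat = n
  induction n generalizing v with
  | zero => exact h j v
  | succ n ih =>
    rw [pow_succ', pow_succ', Module.End.mul_apply, Module.End.mul_apply]
    exact lie_comp_of_intertwine φ (h i) ih v

/-- The relations satisfied in `𝔭_k` by the generators `e_i`, `f_i` (`i ≠ k`) and `h`. The element
`F_k`, for which there is no relation with `E_k`, plays no role; it may be taken to be zero. -/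
structure ParabolicRel (k : ℕ) {L : Type} [LieRing L] [LieAlgebra ℝ L] (E F : Fin k → L)
    (H : CartanE k →ₗ[ℝ] L) : Prop where
  hh : ∀ v v', ⁅H v, H v'⁆ = 0
  he : ∀ v i, ⁅H v, E i⁆ = rootE k i v • E i
  hf : ∀ v i, ⁅H v, F i⁆ = -(rootE k i v • F i)
  ef_eq : ∀ i, i.val + 1 < k → ⁅E i, F i⁆ = H (corootE k i)
  ef_ne : ∀ i j, i ≠ j → ⁅E i, F j⁆ = 0
  serre_e : ∀ i j, i ≠ j → serreElt E i j = 0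
  serre_f : ∀ i j, i ≠ j → serreElt F i j = 0

/-! ### The module induced from a representation of `𝔭_k` -/

namespace Induced

variable {k : ℕ} {V : Type} [AddCommGroup V] [Module ℝ V]

/-- The space `T(f_1, …, f_k) ⊗ V`: the word `l` and the vector `v` give `single l v`. -/
abbrev Mod (k : ℕ) (V : Type) [AddCommGroup V] [Module ℝ V] : Type := List (Fin k) →₀ V

/-- The operator `f_i`: left multiplication of words. -/
noncomputable def opF (i : Fin k) : Module.End ℝ (Mod k V) :=
  Finsupp.lmapDomain V ℝ (List.cons i)

theorem opF_single (i : Fin k) (l : List (Fin k)) (v : V) :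
    opF i (Finsupp.single l v) = Finsupp.single (i :: l) v := by
  simp [opF]

/-- Two linear maps on `T(f) ⊗ V` agree if they do so on `1 ⊗ V` and if agreement on `x` implies
agreement on `f_i x`. -/
theorem hom_ext_of_opF {N : Type} [AddCommGroup N] [Module ℝ N] {A B : Mod k V →ₗ[ℝ] N}
    (h0 : ∀ v, A (Finsupp.single [] v) = B (Finsupp.single [] v))
    (h1 : ∀ i x, A x = B x → A (opF i x) = B (opF i x)) (x : Mod k V) : A x = B x := by
  suffices h : A = B by rw [h]
  refine Finsupp.lhom_ext fun l v => ?_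
  induction l with
  | nil => exact h0 v
  | cons i l ih => rw [← opF_single]; exact h1 i _ ih

/-- The functional `v ↦ ∑ α_i(v)`, the sum being over the letters `i` of a word. -/
noncomputable def weight (l : List (Fin k)) : CartanE k →ₗ[ℝ] ℝ := (l.map (rootE k)).sum

variable (H : CartanE k →ₗ[ℝ] Module.End ℝ V) (E F : Fin k → Module.End ℝ V)

/-- The operators of the Cartan subalgebra. -/
noncomputable def opH : CartanE k →ₗ[ℝ] Module.End ℝ (Mod k V) where
  toFun v := Finsupp.lsum ℝ fun l => Finsupp.lsingle l ∘ₗ (H v - weight l v • LinearMap.id)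
  map_add' v v' := by
    refine Finsupp.lhom_ext fun l x => ?_
    rw [LinearMap.add_apply]
    simp only [Finsupp.lsum_single, LinearMap.comp_apply, Finsupp.lsingle_apply,
      ← Finsupp.single_add]
    simp only [map_add, LinearMap.sub_apply, LinearMap.add_apply, LinearMap.smul_apply,
      LinearMap.id_apply]
    congr 1; module
  map_smul' r v := by
    refine Finsupp.lhom_ext fun l x => ?_
    rw [LinearMap.smul_apply]
    simp only [Finsupp.lsum_single, LinearMap.comp_apply, Finsupp.lsingle_apply,
      Finsupp.smul_single]
    simp only [map_smul, LinearMap.sub_apply, LinearMap.smul_apply, LinearMap.id_apply,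
      RingHom.id_apply, smul_eq_mul]
    congr 1; module

theorem opH_single (v : CartanE k) (l : List (Fin k)) (x : V) :
    opH H v (Finsupp.single l x) = Finsupp.single l (H v x - weight l v • x) := by
  simp [opH, Finsupp.lsum_single]

/-- The value of `e_j` on a word, found by moving `e_j` to the right. -/
noncomputable def opEAux (j : Fin k) : List (Fin k) → V →ₗ[ℝ] Mod k V
  | [] => Finsupp.lsingle [] ∘ₗ E j
  | i :: l => opF i ∘ₗ opEAux j l +
      if j = i then opH H (corootE k j) ∘ₗ Finsupp.lsingle l else 0

/-- The operators `e_j`. -/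
noncomputable def opE (j : Fin k) : Module.End ℝ (Mod k V) := Finsupp.lsum ℝ (opEAux H E j)

theorem opE_single_nil (j : Fin k) (v : V) :
    opE H E j (Finsupp.single [] v) = Finsupp.single [] (E j v) := by
  simp [opE, opEAux]

theorem opE_opF (j i : Fin k) (x : Mod k V) : opE H E j (opF i x) =
    opF i (opE H E j x) + (if j = i then opH H (corootE k j) else 0) x := by
  suffices h : opE H E j ∘ₗ opF i =
      opF i ∘ₗ opE H E j + (if j = i then opH H (corootE k j) else 0) from LinearMap.congr_fun h x
  refine Finsupp.lhom_ext fun l v => ?_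
  rw [LinearMap.comp_apply, opF_single, opE, LinearMap.add_apply, LinearMap.comp_apply,
    Finsupp.lsum_single, Finsupp.lsum_single, opEAux]
  split_ifs <;> simp

theorem opH_opF (v : CartanE k) (i : Fin k) (x : Mod k V) :
    opH H v (opF i x) = opF i (opH H v x) - rootE k i v • opF i x := by
  suffices h : opH H v ∘ₗ opF i = opF i ∘ₗ opH H v - rootE k i v • opF i from
    LinearMap.congr_fun h x
  refine Finsupp.lhom_ext fun l y => ?_
  simp only [LinearMap.comp_apply, LinearMap.sub_apply, LinearMap.smul_apply, opF_single,
    opH_single, Finsupp.smul_single, ← Finsupp.single_sub, weight, List.map_cons, List.sum_cons,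
    LinearMap.add_apply]
  congr 1; module

theorem opH_single_nil (v : CartanE k) (x : V) :
    opH H v (Finsupp.single [] x) = Finsupp.single [] (H v x) := by
  simp [opH_single, weight]

variable {H E F}

theorem lie_opE_opF (j i : Fin k) : ⁅opE H E j, opF (V := V) i⁆ =
    if j = i then opH H (corootE k j) else 0 := by
  refine LinearMap.ext fun x => ?_
  rw [LieRing.of_associative_ring_bracket, LinearMap.sub_apply, Module.End.mul_apply,
    Module.End.mul_apply, opE_opF, add_sub_cancel_left]

theorem lie_opH_opF (v : CartanE k) (i : Fin k) :
    ⁅opH H v, opF (V := V) i⁆ = -(rootE k i v • opF i) := by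
  refine LinearMap.ext fun x => ?_
  simp [LieRing.of_associative_ring_bracket, opH_opF]

theorem lie_opH_opH (r : ParabolicRel k E F H) (v v' : CartanE k) : ⁅opH H v, opH H v'⁆ = 0 := by
  refine Finsupp.lhom_ext fun l x => ?_
  have h := LinearMap.congr_fun (r.hh v v') x
  simp only [LieRing.of_associative_ring_bracket, LinearMap.sub_apply, Module.End.mul_apply,
    LinearMap.zero_apply, sub_eq_zero] at h
  simp only [LieRing.of_associative_ring_bracket, LinearMap.sub_apply, Module.End.mul_apply,
    opH_single, LinearMap.zero_apply, ← Finsupp.single_sub, map_sub, map_smul, h]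
  rw [Finsupp.single_eq_zero]
  module

theorem lie_opH_opE (r : ParabolicRel k E F H) (v : CartanE k) (j : Fin k) :
    ⁅opH H v, opE H E j⁆ = rootE k j v • opE H E j := by
  refine LinearMap.ext fun x => ?_
  refine hom_ext_of_opF (fun y => ?_) (fun i y ih => ?_) x
  · have h := LinearMap.congr_fun (r.he v j) y
    simp only [LieRing.of_associative_ring_bracket, LinearMap.sub_apply, Module.End.mul_apply,
      LinearMap.smul_apply] at h
    simp only [LieRing.of_associative_ring_bracket, LinearMap.sub_apply, Module.End.mul_apply,
      LinearMap.smul_apply, opE_single_nil, opH_single_nil, ← Finsupp.single_sub, h,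
      Finsupp.smul_single]
  · have h := LinearMap.congr_fun (lie_opH_opH r v (corootE k j)) y
    simp only [LieRing.of_associative_ring_bracket, LinearMap.sub_apply, Module.End.mul_apply,
      LinearMap.smul_apply, LinearMap.zero_apply, sub_eq_zero] at ih h ⊢
    rw [sub_eq_iff_eq_add] at ih
    by_cases hij : j = i
    · subst hij
      simp only [opE_opF, opH_opF, map_add, map_sub, map_smul, ih, if_true, h]
      module
    · simp only [opE_opF, opH_opF, map_add, map_sub, map_smul, ih, hij, if_false,
        LinearMap.zero_apply, add_zero]
      module

theorem serreElt_opE (hk : 3 ≤ k) (r : ParabolicRel k E F H) {i j : Fin k} (hij : i ≠ j) :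
    serreElt (opE H E) i j = 0 := by
  have hc : ∀ l : Fin k, ⁅opF (V := V) l, serreElt (opE H E) i j⁆ = 0 := by
    intro l
    refine lie_serreElt hk (opF (V := V)) (opE H E) (-opH H) ?_ ?_ l hij
    · intro v i; rw [LinearMap.neg_apply, neg_lie, lie_opH_opE r]
    · intro i j
      rw [← lie_skew, lie_opE_opF]
      by_cases h : i = j
      · simp [h]
      · simp [h, Ne.symm h]
  refine LinearMap.ext fun x => ?_
  refine hom_ext_of_opF (fun y => ?_) (fun l y ih => ?_) x
  · rw [← Finsupp.lsingle_apply (R := ℝ),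
      serreElt_comp_of_intertwine (Finsupp.lsingle [] : V →ₗ[ℝ] Mod k V) (a := E)
        (fun i v => by simp [opE_single_nil]) i j y, r.serre_e i j hij]
    simp
  · have h := LinearMap.congr_fun (hc l) y
    simp only [LieRing.of_associative_ring_bracket, LinearMap.sub_apply, Module.End.mul_apply,
      LinearMap.zero_apply, sub_eq_zero] at h
    rw [← h, ih]; simp

/-- Spanning vectors of the submodule by which `T(f) ⊗ V` is divided: the Serre relations of the
`f_i`, and `f_i ⊗ v - 1 ⊗ f_i v` for `i ≠ k`. -/
inductive IsRel (F : Fin k → Module.End ℝ V) : Mod k V → Prop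
  | serre (i j : Fin k) (hij : i ≠ j) (x : Mod k V) : IsRel F (serreElt opF i j x)
  | act (i : Fin k) (hi : i.val + 1 < k) (v : V) :
      IsRel F (Finsupp.single [i] v - Finsupp.single [] (F i v))
  | opF (i : Fin k) (x : Mod k V) (hx : IsRel F x) : IsRel F (opF i x)

/-- The submodule by which `T(f) ⊗ V` is divided. -/
noncomputable def relSub (F : Fin k → Module.End ℝ V) : Submodule ℝ (Mod k V) :=
  Submodule.span ℝ {x | IsRel F x}

theorem relSub_le_of_isRel {F : Fin k → Module.End ℝ V} {N : Type} [AddCommGroup N] [Module ℝ N]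
    {A : Mod k V →ₗ[ℝ] N} {Z : Submodule ℝ N} (h : ∀ x, IsRel F x → A x ∈ Z) :
    relSub F ≤ Z.comap A :=
  Submodule.span_le.mpr h

theorem opF_mem (i : Fin k) : relSub F ≤ (relSub F).comap (opF i) :=
  relSub_le_of_isRel fun _ hx => Submodule.subset_span (.opF i _ hx)

theorem opH_mem (r : ParabolicRel k E F H) (v : CartanE k) :
    relSub F ≤ (relSub F).comap (opH H v) := by
  refine relSub_le_of_isRel fun x hx => ?_
  induction hx with
  | serre i j hij x =>
    have h1 := lie_ad_pow (a := -rootE k i v) (b := -rootE k j v)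
      ((lie_opH_opF (H := H) v i).trans (neg_smul _ _).symm)
      ((lie_opH_opF (H := H) v j).trans (neg_smul _ _).symm) (1 - cartanE k i j).toNat
    change ⁅opH H v, serreElt opF i j⁆ = _ • serreElt opF i j at h1
    have h2 := LinearMap.congr_fun h1 x
    simp only [LieRing.of_associative_ring_bracket, LinearMap.sub_apply, Module.End.mul_apply,
      LinearMap.smul_apply, sub_eq_iff_eq_add] at h2
    rw [h2]
    exact add_mem (Submodule.smul_mem _ _ (Submodule.subset_span (.serre i j hij x)))
      (Submodule.subset_span (.serre i j hij _))
  | act i hi y =>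
    have h := LinearMap.congr_fun (r.hf v i) y
    simp only [LieRing.of_associative_ring_bracket, LinearMap.sub_apply, Module.End.mul_apply,
      LinearMap.smul_apply, LinearMap.neg_apply, sub_eq_iff_eq_add] at h
    have h1 := Submodule.subset_span (R := ℝ) (IsRel.act (F := F) i hi (H v y - rootE k i v • y))
    change _ ∈ relSub F at h1
    convert h1 using 1
    rw [← opF_single, map_sub, opH_opF, opH_single_nil, opH_single_nil, h, map_sub (F i),
      map_smul (F i), ← opF_single, Finsupp.single_sub, map_sub, ← Finsupp.smul_single, map_smul]
    congr 2
    module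
  | opF i x hx ih =>
    rw [opH_opF]
    exact sub_mem (opF_mem i ih)
      (Submodule.smul_mem _ _ (Submodule.subset_span (.opF i x hx)))

theorem opE_mem (hk : 3 ≤ k) (r : ParabolicRel k E F H) (l : Fin k) :
    relSub F ≤ (relSub F).comap (opE H E l) := by
  refine relSub_le_of_isRel fun x hx => ?_
  induction hx with
  | serre i j hij x =>
    have h1 := lie_serreElt hk (opE H E) (opF (V := V)) (opH H) lie_opH_opF lie_opE_opF l hij
    have h2 := LinearMap.congr_fun h1 x
    simp only [LieRing.of_associative_ring_bracket, LinearMap.sub_apply, Module.End.mul_apply,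
      LinearMap.zero_apply, sub_eq_zero] at h2
    rw [h2]
    exact Submodule.subset_span (.serre i j hij _)
  | act i hi y =>
    have h1 := Submodule.subset_span (R := ℝ) (IsRel.act (F := F) i hi (E l y))
    change _ ∈ relSub F at h1
    convert h1 using 1
    have h : E l (F i y) = F i (E l y) + (if l = i then H (corootE k l) else 0) y := by
      rw [← sub_eq_iff_eq_add']
      by_cases hli : l = i
      · subst hli
        simpa [LieRing.of_associative_ring_bracket] using LinearMap.congr_fun (r.ef_eq l hi) y
      · simpa [LieRing.of_associative_ring_bracket, hli] using
          LinearMap.congr_fun (r.ef_ne l i hli) y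
    rw [← opF_single, map_sub, opE_opF, opE_single_nil, opE_single_nil, h, ← opF_single]
    split_ifs <;> simp [opH_single_nil]
  | opF i x hx ih =>
    rw [opE_opF]
    refine add_mem (opF_mem i ih) ?_
    split_ifs
    · exact opH_mem r _ (Submodule.subset_span hx)
    · simp

variable (F) in
/-- The map `T(f) ⊗ V → V` in which `f_i` acts on `V` by `F_i`. -/
noncomputable def proj : Mod k V →ₗ[ℝ] V := Finsupp.lsum ℝ fun l => (l.map F).prod

theorem proj_single_nil (v : V) : proj F (Finsupp.single [] v) = v := by
  simp [proj]

theorem proj_opF (i : Fin k) (x : Mod k V) : proj F (opF i x) = F i (proj F x) := by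
  suffices h : proj F ∘ₗ opF i = F i ∘ₗ proj F from LinearMap.congr_fun h x
  refine Finsupp.lhom_ext fun l v => ?_
  simp [proj, opF_single]

theorem proj_relSub (r : ParabolicRel k E F H) : relSub F ≤ LinearMap.ker (proj F) := by
  refine Submodule.span_le.mpr fun x hx => ?_
  induction hx with
  | serre i j hij x =>
    have h := serreElt_comp_of_intertwine (proj F) (a := opF) (A := F)
      (fun i v => (proj_opF i v).symm) i j x
    rw [r.serre_f i j hij] at h
    exact h.symm
  | act i hi v =>
    change proj F _ = 0
    rw [← opF_single, map_sub, proj_opF, proj_single_nil, proj_single_nil, sub_self]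
  | opF i x hx ih =>
    change proj F x = 0 at ih
    change proj F _ = 0
    rw [proj_opF, ih, map_zero]

end Induced

/-! ### Homomorphisms on `𝔤_k` and `𝔭_k` -/

namespace LieE

variable {k : ℕ} {L : Type} [LieRing L] [LieAlgebra ℝ L]

/-- A family of elements of a Lie algebra, indexed by the free generators of `𝔤_k`, defines a
homomorphism on `𝔤_k` if it satisfies the defining relations. -/
theorem exists_lift (E F : Fin k → L) (H : CartanE k →ₗ[ℝ] L)
    (hh : ∀ v v', ⁅H v, H v'⁆ = 0) (he : ∀ v i, ⁅H v, E i⁆ = rootE k i v • E i)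
    (hf : ∀ v i, ⁅H v, F i⁆ = -(rootE k i v • F i))
    (ef : ∀ i j, ⁅E i, F j⁆ = if i = j then H (corootE k i) else 0)
    (serre_e : ∀ i j, i ≠ j → serreElt E i j = 0) (serre_f : ∀ i j, i ≠ j → serreElt F i j = 0) :
    ∃ φ : LieE k →ₗ⁅ℝ⁆ L, (∀ i, φ (e i) = E i) ∧ (∀ i, φ (f i) = F i) ∧ ∀ v, φ (h v) = H v := by
  let g : ChevGen k → L
    | .e i => E i
    | .f i => F i
    | .h j => H (Pi.single j 1)
  let Φ : FreeLieAlgebra ℝ (ChevGen k) →ₗ⁅ℝ⁆ L := FreeLieAlgebra.lift ℝ g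
  have hE : ∀ i, Φ (ChevGen.freeE i) = E i := fun i => FreeLieAlgebra.lift_of_apply (R := ℝ) g _
  have hF : ∀ i, Φ (ChevGen.freeF i) = F i := fun i => FreeLieAlgebra.lift_of_apply (R := ℝ) g _
  have hH : ∀ v, Φ (ChevGen.freeH v) = H v := by
    intro v
    have h1 : ∀ j, Φ (FreeLieAlgebra.of ℝ (.h j)) = H (Pi.single j 1) :=
      fun j => FreeLieAlgebra.lift_of_apply (R := ℝ) g _
    have h2 : v = ∑ j, v j • Pi.single j (1 : ℝ) := by
      simpa [← Pi.single_smul] using (Finset.univ_sum_single v).symm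
    rw [ChevGen.freeH, map_sum, h2, map_sum, ← h2]
    simp only [map_smul, h1]
  have hserre : ∀ (X : Fin k → FreeLieAlgebra ℝ (ChevGen k)) i j,
      Φ ((LieAlgebra.ad ℝ _ (X i) ^ (1 - cartanE k i j).toNat) (X j)) =
        serreElt (fun i => Φ (X i)) i j := by
    intro X i j
    unfold serreElt
    generalize (1 - cartanE k i j).toNat = n
    induction n with
    | zero => rfl
    | succ n ih => simp only [pow_succ', Module.End.mul_apply, LieAlgebra.ad_apply, LieHom.map_lie,
        ih]
  have hrel : ChevGen.relIdeal k ≤ Φ.ker := by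
    refine LieSubmodule.lieSpan_le.mpr fun x hx => ?_
    rw [SetLike.mem_coe, LieHom.mem_ker]
    cases hx with
    | hh v v' => rw [LieHom.map_lie, hH, hH, hh]
    | he v i => rw [map_sub, LieHom.map_lie, map_smul, hH, hE, he, sub_self]
    | hf v i => rw [map_add, LieHom.map_lie, map_smul, hH, hF, hf, neg_add_cancel]
    | ef_eq i => rw [map_sub, LieHom.map_lie, hH, hE, hF, ef, if_pos rfl, sub_self]
    | ef_ne i j hij => rw [LieHom.map_lie, hE, hF, ef, if_neg hij]
    | serre_e i j hij => rw [hserre]; simp only [hE]; exact serre_e i j hij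
    | serre_f i j hij => rw [hserre]; simp only [hF]; exact serre_f i j hij
  obtain ⟨φ, hφ⟩ := exists_lieHom_of_graph (P := LieE k) (B := L)
    (fun x a => ∃ y, mk k y = x ∧ Φ y = a)
    (by rintro _ _ _ _ ⟨y, rfl, rfl⟩ ⟨z, rfl, rfl⟩; exact ⟨y + z, map_add _ _ _, map_add _ _ _⟩)
    (by rintro r _ _ ⟨y, rfl, rfl⟩; exact ⟨r • y, map_smul _ _ _, map_smul _ _ _⟩)
    (by rintro _ _ _ _ ⟨y, rfl, rfl⟩ ⟨z, rfl, rfl⟩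
        exact ⟨⁅y, z⁆, LieHom.map_lie _ _ _, LieHom.map_lie _ _ _⟩)
    (by
      intro x
      obtain ⟨y, hy⟩ := LieSubmodule.Quotient.surjective_mk' (ChevGen.relIdeal k) x
      exact ⟨Φ y, y, hy, rfl⟩)
    (by
      rintro _ ⟨y, hy, rfl⟩
      exact LieHom.mem_ker.mp (hrel ((LieSubmodule.Quotient.mk_eq_zero').mp hy)))
  exact ⟨φ, fun i => (hφ _ _).mp ⟨_, rfl, hE i⟩, fun i => (hφ _ _).mp ⟨_, rfl, hF i⟩,
    fun v => (hφ _ _).mp ⟨_, rfl, hH v⟩⟩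

/-- A property of elements of `𝔭_k` holds everywhere if it holds for the generators and is closed
under the Lie algebra operations. -/
theorem parabolic_induction {P : parabolic k → Prop} (he : ∀ i, P (pe i))
    (hf : ∀ i hi, P (pf i hi)) (hh : ∀ v, P (ph v)) (hadd : ∀ x y, P x → P y → P (x + y))
    (hsmul : ∀ (r : ℝ) x, P x → P (r • x)) (hlie : ∀ x y, P x → P y → P ⁅x, y⁆)
    (x : parabolic k) : P x := by
  obtain ⟨x, hx⟩ := x
  induction hx using LieSubalgebra.lieSpan_induction with
  | mem x h =>
    rcases h with (⟨i, rfl⟩ | ⟨i, hi, rfl⟩) | ⟨v, rfl⟩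
    exacts [he i, hf i hi, hh v]
  | zero =>
    have h := hsmul 0 _ (hh 0)
    rwa [zero_smul] at h
  | smul r x _ h => exact hsmul r _ h
  | add x y _ _ h1 h2 => exact hadd _ _ h1 h2
  | lie x y _ _ h1 h2 => exact hlie _ _ h1 h2

/-- Homomorphisms on `𝔭_k` agree if they agree on the generators. -/
theorem parabolic_hom_ext {φ ψ : parabolic k →ₗ⁅ℝ⁆ L} (he : ∀ i, φ (pe i) = ψ (pe i))
    (hf : ∀ i hi, φ (pf i hi) = ψ (pf i hi)) (hh : ∀ v, φ (ph v) = ψ (ph v)) : φ = ψ :=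
  LieHom.ext (parabolic_induction he hf hh (fun x y h1 h2 => by rw [map_add, map_add, h1, h2])
    (fun r x h => by rw [map_smul, map_smul, h])
    (fun x y h1 h2 => by rw [LieHom.map_lie, LieHom.map_lie, h1, h2]))

/-- A relation between `𝔭_k` and a Lie algebra that is additive, homogeneous, compatible with the
brackets and functional is the graph of a homomorphism if it is defined on the generators. -/
theorem exists_parabolic_hom_of_graph (R : parabolic k → L → Prop) {E : Fin k → L}
    {F : ∀ i : Fin k, i.val + 1 < k → L} {H : CartanE k → L}
    (hadd : ∀ {x y a b}, R x a → R y b → R (x + y) (a + b))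
    (hsmul : ∀ (r : ℝ) {x a}, R x a → R (r • x) (r • a))
    (hlie : ∀ {x y a b}, R x a → R y b → R ⁅x, y⁆ ⁅a, b⁆) (hfun : ∀ a, R 0 a → a = 0)
    (he : ∀ i, R (pe i) (E i)) (hf : ∀ i hi, R (pf i hi) (F i hi)) (hh : ∀ v, R (ph v) (H v)) :
    ∃ φ : parabolic k →ₗ⁅ℝ⁆ L, (∀ i, φ (pe i) = E i) ∧ (∀ i hi, φ (pf i hi) = F i hi) ∧
      (∀ v, φ (ph v) = H v) ∧ ∀ x, R x (φ x) := by
  obtain ⟨φ, hφ⟩ := exists_lieHom_of_graph R hadd hsmul hlie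
    (parabolic_induction (fun i => ⟨_, he i⟩) (fun i hi => ⟨_, hf i hi⟩) (fun v => ⟨_, hh v⟩)
      (fun x y ⟨a, h1⟩ ⟨b, h2⟩ => ⟨_, hadd h1 h2⟩) (fun r x ⟨a, h1⟩ => ⟨_, hsmul r h1⟩)
      (fun x y ⟨a, h1⟩ ⟨b, h2⟩ => ⟨_, hlie h1 h2⟩)) hfun
  exact ⟨φ, fun i => (hφ _ _).mp (he i), fun i hi => (hφ _ _).mp (hf i hi),
    fun v => (hφ _ _).mp (hh v), fun x => (hφ _ _).mpr rfl⟩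

variable {V : Type} [AddCommGroup V] [Module ℝ V]

open Induced in
/-- The relations in `ParabolicRel` present `𝔭_k`: operators on a vector space `V` that satisfy
them define a representation of `𝔭_k`. Indeed `𝔤_k` acts on the `𝔤_k`-module induced from `V`, and
`V` is a `𝔭_k`-submodule of it. -/
theorem exists_parabolic_rep (hk : 3 ≤ k) {E F : Fin k → Module.End ℝ V}
    {H : CartanE k →ₗ[ℝ] Module.End ℝ V} (r : ParabolicRel k E F H) :
    ∃ φ : parabolic k →ₗ⁅ℝ⁆ Module.End ℝ V, (∀ i, φ (pe i) = E i) ∧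
      (∀ i hi, φ (pf i hi) = F i) ∧ ∀ v, φ (ph v) = H v := by
  let q := (relSub F).mkQ
  let E' : Fin k → Module.End ℝ (Mod k V ⧸ relSub F) := fun i =>
    (relSub F).mapQ (relSub F) (opE H E i) (opE_mem hk r i)
  let F' : Fin k → Module.End ℝ (Mod k V ⧸ relSub F) := fun i =>
    (relSub F).mapQ (relSub F) (opF i) (opF_mem i)
  let H' : CartanE k →ₗ[ℝ] Module.End ℝ (Mod k V ⧸ relSub F) :=
    { toFun := fun v => (relSub F).mapQ (relSub F) (opH H v) (opH_mem r v)
      map_add' := fun v v' => Submodule.linearMap_qext _ (LinearMap.ext fun x => by simp)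
      map_smul' := fun c v => Submodule.linearMap_qext _ (LinearMap.ext fun x => by simp) }
  have hE : ∀ i x, E' i (q x) = q (opE H E i x) := fun _ _ => rfl
  have hF : ∀ i x, F' i (q x) = q (opF i x) := fun _ _ => rfl
  have hH : ∀ v x, H' v (q x) = q (opH H v x) := fun _ _ => rfl
  have hext : ∀ {A B : Module.End ℝ (Mod k V ⧸ relSub F)}, (∀ x, A (q x) = B (q x)) → A = B :=
    fun h => Submodule.linearMap_qext _ (LinearMap.ext h)
  obtain ⟨Φ, ΦE, ΦF, ΦH⟩ := exists_lift E' F' H'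
    (fun v v' => hext fun x => by
      rw [lie_comp_of_intertwine q (hH v) (hH v'), lie_opH_opH r]; simp)
    (fun v i => hext fun x => by
      rw [lie_comp_of_intertwine q (hH v) (hE i), lie_opH_opE r]; simp [hE])
    (fun v i => hext fun x => by
      rw [lie_comp_of_intertwine q (hH v) (hF i), lie_opH_opF]; simp [hF])
    (fun i j => hext fun x => by
      rw [lie_comp_of_intertwine q (hE i) (hF j), lie_opE_opF]; split_ifs <;> simp [hH])
    (fun i j hij => hext fun x => by
      rw [serreElt_comp_of_intertwine q hE, serreElt_opE hk r hij]; simp)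
    (fun i j hij => hext fun x => by
      rw [serreElt_comp_of_intertwine q hF, LinearMap.zero_apply]
      exact (Submodule.Quotient.mk_eq_zero _).mpr (Submodule.subset_span (.serre i j hij x)))
  let ι : V →ₗ[ℝ] Mod k V ⧸ relSub F := q ∘ₗ Finsupp.lsingle []
  have hι : ∀ v, ι v = 0 → v = 0 := by
    intro v hv
    have h1 := proj_relSub r ((Submodule.Quotient.mk_eq_zero _).mp hv)
    rw [LinearMap.mem_ker] at h1
    exact (proj_single_nil (F := F) v).symm.trans h1
  have ιE : ∀ i v, Φ (e i) (ι v) = ι (E i v) := fun i v => by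
    rw [ΦE]; exact (hE _ _).trans (congrArg q (opE_single_nil H E i v))
  have ιH : ∀ w v, Φ (h w) (ι v) = ι (H w v) := fun w v => by
    rw [ΦH]; exact (hH _ _).trans (congrArg q (opH_single_nil H w v))
  have ιF : ∀ i : Fin k, i.val + 1 < k → ∀ v, Φ (f i) (ι v) = ι (F i v) := fun i hi v => by
    rw [ΦF]
    refine (hF _ _).trans ?_
    refine (Submodule.Quotient.eq _).mpr (Submodule.subset_span ?_)
    rw [Finsupp.lsingle_apply, Finsupp.lsingle_apply, opF_single]
    exact .act i hi v
  let Ψ := Φ.comp (parabolic k).incl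
  obtain ⟨φ, φE, φF, φH, -⟩ := exists_parabolic_hom_of_graph (k := k) (L := Module.End ℝ V)
    (fun x X => ∀ v, Ψ x (ι v) = ι (X v))
    (fun h1 h2 v => by
      rw [map_add, LinearMap.add_apply, h1, h2, LinearMap.add_apply, map_add])
    (fun c _ _ h1 v => by
      rw [map_smul, LinearMap.smul_apply, h1, LinearMap.smul_apply, map_smul])
    (fun h1 h2 v => by
      rw [LieHom.map_lie]
      exact lie_comp_of_intertwine ι h1 h2 v)
    (fun X hX => LinearMap.ext fun v => hι _ (by
      rw [← hX v, map_zero, LinearMap.zero_apply])) ιE ιF ιH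
  exact ⟨φ, φE, φF, φH⟩

end LieE

/-! ### Operators on the space of generators -/

namespace Fock

open Toroid

variable {k : ℕ}

/-- The exterior algebra `Λ(s_1, …, s_k)`; the set `I` stands for the monomial `s_I`. -/
abbrev Ext (k : ℕ) : Type := Finset (Fin k) →₀ ℝ

/-- Multiplication by `s_i`. -/
noncomputable def cr (i : Fin k) : Module.End ℝ (Ext k) :=
  Finsupp.lsum ℝ fun I => Finsupp.lsingle (insert i I) ∘ₗ LinearMap.lsmul ℝ ℝ (sSign i I)

/-- Contraction with the basis vector dual to `s_i`. -/
noncomputable def an (i : Fin k) : Module.End ℝ (Ext k) :=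
  Finsupp.lsum ℝ fun I =>
    if i ∈ I then Finsupp.lsingle (I.erase i) ∘ₗ LinearMap.lsmul ℝ ℝ (sSign i (I.erase i)) else 0

/-- The sign operator `(-1)^|I|`. -/
noncomputable def par : Module.End ℝ (Ext k) :=
  Finsupp.lsum ℝ fun I => Finsupp.lsingle I ∘ₗ LinearMap.lsmul ℝ ℝ ((-1) ^ I.card)

/-- The coefficient of `1`. -/
noncomputable def vac : Ext k →ₗ[ℝ] ℝ := Finsupp.lapply ∅

theorem cr_single (i : Fin k) (I : Finset (Fin k)) (c : ℝ) :
    cr i (Finsupp.single I c) = Finsupp.single (insert i I) (sSign i I * c) := by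
  simp [cr, Finsupp.lsum_single]

theorem an_single (i : Fin k) (I : Finset (Fin k)) (c : ℝ) : an i (Finsupp.single I c) =
    if i ∈ I then Finsupp.single (I.erase i) (sSign i (I.erase i) * c) else 0 := by
  rw [an, Finsupp.lsum_single]
  split_ifs <;> simp

theorem an_single_of_notMem {i : Fin k} {I : Finset (Fin k)} (h : i ∉ I) (c : ℝ) :
    an i (Finsupp.single I c) = 0 := by
  rw [an_single, if_neg h]

theorem an_single_insert {i : Fin k} {I : Finset (Fin k)} (h : i ∉ I) (c : ℝ) :
    an i (Finsupp.single (insert i I) c) = Finsupp.single I (sSign i I * c) := by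
  rw [an_single, if_pos (Finset.mem_insert_self _ _), Finset.erase_insert h]

theorem par_single (I : Finset (Fin k)) (c : ℝ) :
    par (Finsupp.single I c) = Finsupp.single I ((-1) ^ I.card * c) := by
  simp [par, Finsupp.lsum_single]

theorem sSign_of_mem {i : Fin k} {I : Finset (Fin k)} (h : i ∈ I) : sSign i I = 0 := by
  simp [sSign, h]

theorem sSign_mul_self {i : Fin k} {I : Finset (Fin k)} (h : i ∉ I) :
    sSign i I * sSign i I = 1 := by
  rw [sSign, if_neg h, ← pow_add, Even.neg_one_pow ⟨_, rfl⟩]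

theorem cr_cr (i j : Fin k) (x : Ext k) : cr i (cr j x) = -cr j (cr i x) := by
  induction x using Finsupp.induction_linear with
  | zero => simp
  | add x y h1 h2 => simp only [map_add, h1, h2, neg_add]
  | single I c =>
    have h := sSign_anticomm i j I
    simp only [cr_single, Finset.insert_comm j i, ← Finsupp.single_neg]
    congr 1
    linear_combination c * h

theorem an_cr (i j : Fin k) (x : Ext k) :
    an i (cr j x) = (if i = j then (1 : ℝ) else 0) • x - cr j (an i x) := by
  rw [eq_sub_iff_add_eq]
  induction x using Finsupp.induction_linear with
  | zero => simp
  | add x y h1 h2 => simp only [map_add, smul_add, ← h1, ← h2]; abel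
  | single I c =>
    rw [cr_single]
    by_cases hij : i = j
    · subst hij
      by_cases hi : i ∈ I
      · obtain ⟨K, hK, rfl⟩ : ∃ K, i ∉ K ∧ insert i K = I :=
          ⟨I.erase i, Finset.notMem_erase _ _, Finset.insert_erase hi⟩
        rw [sSign_of_mem hi, an_single_insert hK, cr_single, ← mul_assoc, sSign_mul_self hK]
        simp
      · rw [an_single_insert hi, an_single_of_notMem hi, ← mul_assoc, sSign_mul_self hi]
        simp
    · rw [if_neg hij, zero_smul]
      by_cases hj : j ∈ I
      · by_cases hi : i ∈ I
        · rw [sSign_of_mem hj, an_single, an_single, if_pos hi, cr_single,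
            sSign_of_mem (Finset.mem_erase.mpr ⟨Ne.symm hij, hj⟩)]
          simp
        · rw [sSign_of_mem hj, an_single_of_notMem hi]
          simp
      · by_cases hi : i ∈ I
        · obtain ⟨K, hK, rfl⟩ : ∃ K, i ∉ K ∧ insert i K = I :=
            ⟨I.erase i, Finset.notMem_erase _ _, Finset.insert_erase hi⟩
          have hj' : j ∉ K := fun h => hj (Finset.mem_insert_of_mem h)
          have hi' : i ∉ insert j K := by simp [hij, hK]
          rw [Finset.insert_comm, an_single_insert hi', an_single_insert hK, cr_single,
            ← Finsupp.single_add, Finsupp.single_eq_zero]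
          have h1 := sSign_anticomm i j K
          have h2 := sSign_mul_self hj'
          have h3 := sSign_mul_self hj
          linear_combination (sSign j K * sSign j (insert i K) * c) * h1 -
            (sSign i (insert j K) * sSign j (insert i K) * c) * h2 -
              (sSign i K * sSign j K * c) * h3
        · rw [an_single_of_notMem (by simp [hij, hi]), an_single_of_notMem hi]
          simp

theorem an_an (i j : Fin k) (x : Ext k) : an i (an j x) = -an j (an i x) := by
  rw [eq_neg_iff_add_eq_zero]
  induction x using Finsupp.induction_linear with
  | zero => simp
  | add x y h1 h2 => simp only [map_add]; rw [add_add_add_comm, h1, h2, add_zero]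
  | single I c =>
    by_cases hij : i = j
    · subst hij
      rw [an_single]
      split_ifs
      · rw [an_single_of_notMem (Finset.notMem_erase _ _), add_zero]
      · simp
    by_cases hi : i ∈ I
    · by_cases hj : j ∈ I
      · obtain ⟨K, hK, hK', rfl⟩ : ∃ K, i ∉ K ∧ j ∉ K ∧ insert i (insert j K) = I := by
          refine ⟨(I.erase i).erase j, fun h => ?_, Finset.notMem_erase _ _, ?_⟩
          · simp at h
          · rw [Finset.insert_erase (Finset.mem_erase.mpr ⟨Ne.symm hij, hj⟩),
              Finset.insert_erase hi]
        have hi' : i ∉ insert j K := by simp [hij, hK]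
        have hj' : j ∉ insert i K := by simp [Ne.symm hij, hK']
        rw [an_single_insert hi', an_single_insert hK', Finset.insert_comm, an_single_insert hj',
          an_single_insert hK, ← Finsupp.single_add, Finsupp.single_eq_zero]
        linear_combination c * sSign_anticomm i j K
      · rw [an_single_of_notMem hj, an_single, if_pos hi,
          an_single_of_notMem (fun h => hj (Finset.mem_of_mem_erase h))]
        simp
    · rw [an_single_of_notMem hi, an_single]
      split_ifs
      · rw [an_single_of_notMem (fun h => hi (Finset.mem_of_mem_erase h))]
        simp
      · simp

theorem an_self (i : Fin k) (x : Ext k) : an i (an i x) = 0 :=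
  self_eq_neg.mp (an_an i i x)

theorem par_cr (i : Fin k) (x : Ext k) : par (cr i x) = -cr i (par x) := by
  induction x using Finsupp.induction_linear with
  | zero => simp
  | add x y h1 h2 => simp only [map_add, h1, h2, neg_add]
  | single I c =>
    rw [cr_single, par_single, par_single, cr_single, ← Finsupp.single_neg]
    by_cases hi : i ∈ I
    · simp [sSign_of_mem hi]
    · rw [Finset.card_insert_of_notMem hi]
      congr 1; ring

theorem par_an (i : Fin k) (x : Ext k) : par (an i x) = -an i (par x) := by
  induction x using Finsupp.induction_linear with
  | zero => simp
  | add x y h1 h2 => simp only [map_add, h1, h2, neg_add]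
  | single I c =>
    by_cases hi : i ∈ I
    · obtain ⟨K, hK, rfl⟩ : ∃ K, i ∉ K ∧ insert i K = I :=
        ⟨I.erase i, Finset.notMem_erase _ _, Finset.insert_erase hi⟩
      rw [par_single, an_single_insert hK, an_single_insert hK, par_single,
        Finset.card_insert_of_notMem hK, ← Finsupp.single_neg]
      congr 1; ring
    · rw [par_single, an_single_of_notMem hi, an_single_of_notMem hi]
      simp

theorem vac_cr (i : Fin k) (x : Ext k) : vac (cr i x) = 0 := by
  induction x using Finsupp.induction_linear with
  | zero => simp
  | add x y h1 h2 => simp only [map_add, h1, h2, add_zero]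
  | single I c =>
    rw [cr_single, vac, Finsupp.lapply_apply,
      Finsupp.single_eq_of_ne (Finset.insert_ne_empty i I).symm]

/-- The space `Λ(s) g₄ ⊕ Λ(s) g₇ ⊕ ⟨w_1, …, w_k⟩`. Its quotient by the elements of degree `≤ 0` in
the first two summands is the space of generators of the model. -/
abbrev Gen (k : ℕ) : Type := Ext k × Ext k × (Fin k → ℝ)

/-- The operator `s_i`. -/
noncomputable def opS (i : Fin k) : Module.End ℝ (Gen k) where
  toFun u := (cr i u.1, cr i u.2.1, 0)
  map_add' u v := by simp
  map_smul' c u := by simp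

/-- The operator of `𝔤𝔩_k` with `s_m ↦ s_i` and, dually, `w_i ↦ -w_m`. -/
noncomputable def opN (i m : Fin k) : Module.End ℝ (Gen k) where
  toFun u := (cr i (an m u.1), cr i (an m u.2.1), -(u.2.2 i • Pi.single m 1))
  map_add' u v := by
    refine Prod.ext (by simp) (Prod.ext (by simp) ?_)
    simp only [Prod.snd_add, Pi.add_apply]; module
  map_smul' c u := by
    refine Prod.ext (by simp) (Prod.ext (by simp) ?_)
    simp only [Prod.smul_snd, Pi.smul_apply, RingHom.id_apply, smul_eq_mul]; module

/-- The scaling operator `g₄ ↦ g₄`, `g₇ ↦ 2 g₇`. -/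
noncomputable def opC : Module.End ℝ (Gen k) where
  toFun u := (u.1, (2 : ℝ) • u.2.1, 0)
  map_add' u v := by simp
  map_smul' c u := by simp [smul_comm c]

/-- The operator of the trivector `∂_a ∧ ∂_b ∧ ∂_c`: it sends `s_a s_b s_c g₇` to `g₄` and
`s_a s_b g₄` to `w_c`. The sign operator makes it commute with the other `s_i`, as `g₄` and `g₇`
have different parity. -/
noncomputable def opT (a b c : Fin k) : Module.End ℝ (Gen k) :=
  (-(an c ∘ₗ an b ∘ₗ an a ∘ₗ par ∘ₗ LinearMap.fst ℝ _ _ ∘ₗ LinearMap.snd ℝ _ _)).prod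
    (LinearMap.prod 0
      (((vac ∘ₗ an b ∘ₗ an a).smulRight (Pi.single c 1) +
        (vac ∘ₗ an c ∘ₗ an b).smulRight (Pi.single a 1) +
          (vac ∘ₗ an a ∘ₗ an c).smulRight (Pi.single b 1)) ∘ₗ LinearMap.fst ℝ _ _))

theorem opS_apply (i : Fin k) (u : Gen k) : opS i u = (cr i u.1, cr i u.2.1, 0) := rfl

theorem opN_apply (i m : Fin k) (u : Gen k) :
    opN i m u = (cr i (an m u.1), cr i (an m u.2.1), -(u.2.2 i • Pi.single m 1)) := rfl

theorem opC_apply (u : Gen k) : opC u = (u.1, (2 : ℝ) • u.2.1, 0) := rfl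

theorem opT_apply (a b c : Fin k) (u : Gen k) : opT a b c u =
    (-an c (an b (an a (par u.2.1))), 0,
      vac (an b (an a u.1)) • Pi.single c 1 + vac (an c (an b u.1)) • Pi.single a 1 +
        vac (an a (an c u.1)) • Pi.single b 1) := rfl

theorem single_apply' (i j : Fin k) : (Pi.single i 1 : Fin k → ℝ) j = if i = j then 1 else 0 := by
  rw [Pi.single_apply]; simp only [eq_comm]

theorem lie_apply {M : Type} [AddCommGroup M] [Module ℝ M] (A B : Module.End ℝ M) (u : M) :
    ⁅A, B⁆ u = A (B u) - B (A u) := rfl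

theorem lie_opN_opS (i m j : Fin k) :
    ⁅opN i m, opS j⁆ = (if m = j then (1 : ℝ) else 0) • opS i := by
  have h : ∀ x : Ext k, cr i (an m (cr j x)) - cr j (cr i (an m x)) =
      (if m = j then (1 : ℝ) else 0) • cr i x := fun x => by
    rw [an_cr, map_sub, map_smul, cr_cr i j]; abel
  refine LinearMap.ext fun u => Prod.ext (h u.1) (Prod.ext (h u.2.1) ?_)
  simp only [lie_apply, opN_apply, opS_apply, LinearMap.smul_apply, Prod.snd_sub, Prod.smul_snd]
  simp

theorem lie_opC_opS (j : Fin k) : ⁅opC (k := k), opS j⁆ = 0 := by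
  refine LinearMap.ext fun u => Prod.ext ?_ (Prod.ext ?_ ?_) <;>
    simp [opC_apply, opS_apply]

theorem lie_opT_opS {a b c i : Fin k} (ha : a ≠ i) (hb : b ≠ i) (hc : c ≠ i) :
    ⁅opT a b c, opS i⁆ = 0 := by
  refine LinearMap.ext fun u => Prod.ext ?_ (Prod.ext ?_ ?_)
  · simp [opT_apply, opS_apply, an_cr, ha, hb, hc, par_cr]
  · simp [opT_apply, opS_apply]
  · simp [opT_apply, opS_apply, an_cr, ha, hb, hc, vac_cr]

theorem lie_opN_opN (i m j l : Fin k) : ⁅opN i m, opN j l⁆ =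
    (if m = j then (1 : ℝ) else 0) • opN i l - (if l = i then (1 : ℝ) else 0) • opN j m := by
  have h : ∀ x : Ext k, cr i (an m (cr j (an l x))) - cr j (an l (cr i (an m x))) =
      (if m = j then (1 : ℝ) else 0) • cr i (an l x) -
        (if l = i then (1 : ℝ) else 0) • cr j (an m x) := fun x => by
    rw [an_cr, an_cr, map_sub, map_sub, map_smul, map_smul, cr_cr i j, an_an m l, map_neg, map_neg]
    abel
  refine LinearMap.ext fun u => Prod.ext (h u.1) (Prod.ext (h u.2.1) ?_)
  simp only [lie_apply, opN_apply, Prod.snd_sub, LinearMap.sub_apply, LinearMap.smul_apply,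
    Prod.smul_snd, Pi.neg_apply, Pi.smul_apply, single_apply', smul_eq_mul]
  module

theorem lie_opC_opN (i m : Fin k) : ⁅opC (k := k), opN i m⁆ = 0 := by
  refine LinearMap.ext fun u => Prod.ext ?_ (Prod.ext ?_ ?_) <;>
    simp [opC_apply, opN_apply]

theorem lie_opC_opT (a b c : Fin k) : ⁅opC (k := k), opT a b c⁆ = -opT a b c := by
  refine LinearMap.ext fun u => Prod.ext ?_ (Prod.ext ?_ ?_)
  · simp [opC_apply, opT_apply]; module
  · simp [opC_apply, opT_apply]
  · simp [opC_apply, opT_apply]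

theorem lie_opN_opT (i m a b c : Fin k) : ⁅opN i m, opT a b c⁆ =
    -((if a = i then (1 : ℝ) else 0) • opT m b c + (if b = i then (1 : ℝ) else 0) • opT a m c +
      (if c = i then (1 : ℝ) else 0) • opT a b m) := by
  refine LinearMap.ext fun u => Prod.ext ?_ (Prod.ext ?_ ?_)
  · simp only [lie_apply, opN_apply, opT_apply, Prod.fst_sub, LinearMap.neg_apply,
      LinearMap.add_apply, LinearMap.smul_apply, Prod.fst_neg, Prod.fst_add, Prod.smul_fst, par_cr,
      par_an, map_neg, an_cr, map_sub, map_smul, an_an m c, an_an m b, an_an m a]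
    module
  · simp only [lie_apply, opN_apply, opT_apply, Prod.fst_sub, Prod.snd_sub, LinearMap.neg_apply,
      LinearMap.add_apply, LinearMap.smul_apply, Prod.snd_neg, Prod.snd_add, Prod.smul_snd,
      Prod.fst_neg, Prod.fst_add, Prod.smul_fst]
    simp
  · simp only [lie_apply, opN_apply, opT_apply, Prod.snd_sub, LinearMap.neg_apply,
      LinearMap.add_apply, LinearMap.smul_apply, Prod.snd_neg, Prod.snd_add, Prod.smul_snd,
      map_neg, an_cr, map_sub, map_smul, an_an m c, an_an m b, an_an m a, vac_cr, smul_eq_mul,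
      Pi.add_apply, Pi.smul_apply]
    simp only [single_apply']
    module

theorem opT_swap (a b c : Fin k) : opT b a c = -opT a b c := by
  refine LinearMap.ext fun u => Prod.ext ?_ (Prod.ext ?_ ?_)
  · simp [opT_apply, an_an a b]
  · simp [opT_apply]
  · simp only [opT_apply, LinearMap.neg_apply, Prod.snd_neg]
    rw [an_an a b, an_an c a, an_an b c]
    simp only [map_neg]
    module

theorem opT_rotate (a b c : Fin k) : opT b c a = opT a b c := by
  refine LinearMap.ext fun u => Prod.ext ?_ (Prod.ext ?_ ?_)
  · simp [opT_apply, an_an a c, an_an a b]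
  · simp [opT_apply]
  · simp only [opT_apply]
    module

theorem opT_eq_zero (a b : Fin k) : opT a a b = 0 :=
  LinearMap.ext fun u => self_eq_neg.mp (LinearMap.congr_fun (opT_swap a a b) u)

theorem lie_opT_opT (a b c d : Fin k) : ⁅opT a b c, opT a b d⁆ = 0 := by
  have h1 : ∀ (i j : Fin k) (x : Ext k), an i (an j (an i x)) = 0 := fun i j x => by
    rw [an_an j i, map_neg, an_self, neg_zero]
  have h2 : ∀ (i j l : Fin k) (x : Ext k), an i (an j (an l (an i x))) = 0 := fun i j l x => by
    rw [an_an l i, map_neg, map_neg, h1, neg_zero]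
  refine LinearMap.ext fun u => Prod.ext ?_ (Prod.ext ?_ ?_)
  · simp [opT_apply]
  · simp [opT_apply]
  · simp [opT_apply, h1, h2, an_an a d, an_an a c]

end Fock

/-! ### The relations of `𝔭_k` in terms of `𝔤𝔩_k` and trivectors -/

/-- The commutation relations between a scaling element `C`, a basis `N i m` of `𝔤𝔩_k` and
alternating trivectors `T a b c`. -/
structure TrivectorRel (k : ℕ) {L : Type} [LieRing L] [LieAlgebra ℝ L] (C : L)
    (N : Fin k → Fin k → L) (T : Fin k → Fin k → Fin k → L) : Prop where
  cn : ∀ i m, ⁅C, N i m⁆ = 0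
  ct : ∀ a b c, ⁅C, T a b c⁆ = -T a b c
  nn : ∀ i m j l, ⁅N i m, N j l⁆ =
    (if m = j then (1 : ℝ) else 0) • N i l - (if l = i then (1 : ℝ) else 0) • N j m
  nt : ∀ i m a b c, ⁅N i m, T a b c⁆ =
    -((if a = i then (1 : ℝ) else 0) • T m b c + (if b = i then (1 : ℝ) else 0) • T a m c +
      (if c = i then (1 : ℝ) else 0) • T a b m)
  tt : ∀ a b c d, ⁅T a b c, T a b d⁆ = 0
  rotate : ∀ a b c, T b c a = T a b c
  self : ∀ a b, T a a b = 0

namespace TrivectorRel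

variable {k : ℕ} {L : Type} [LieRing L] [LieAlgebra ℝ L] {C : L} {N : Fin k → Fin k → L}
  {T : Fin k → Fin k → Fin k → L}

variable (N T) in
/-- The image of `e_i`. -/
noncomputable def repE (hk : 3 ≤ k) (i : Fin k) : L :=
  if h : i.val + 1 < k then -N i ⟨i.val + 1, h⟩
  else T (Fin.castLE hk 0) (Fin.castLE hk 1) (Fin.castLE hk 2)

variable (N) in
/-- The image of `f_i` for `i ≠ k`. -/
noncomputable def repF (i : Fin k) : L :=
  if h : i.val + 1 < k then -N ⟨i.val + 1, h⟩ i else 0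

variable (C N) in
/-- The image of the Cartan subalgebra. -/
noncomputable def repH : CartanE k →ₗ[ℝ] L where
  toFun v := v 0 • C + ∑ i : Fin k, v i.succ • N i i
  map_add' v v' := by
    simp only [Pi.add_apply, add_smul, Finset.sum_add_distrib]; abel
  map_smul' r v := by
    simp only [Pi.smul_apply, smul_add, Finset.smul_sum, smul_smul, smul_eq_mul, RingHom.id_apply]

theorem repH_apply (v : CartanE k) :
    repH C N v = v 0 • C + ∑ i : Fin k, v i.succ • N i i := rfl

theorem repH_single_succ (i : Fin k) : repH C N (Pi.single i.succ (1 : ℝ)) = N i i := by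
  rw [repH_apply, Pi.single_eq_of_ne (Fin.succ_ne_zero i).symm, zero_smul, zero_add,
    Finset.sum_eq_single i]
  · simp
  · intro j _ hj
    rw [Pi.single_eq_of_ne (by simpa using hj), zero_smul]
  · simp

theorem repE_of_lt {L : Type} [LieRing L] {N : Fin k → Fin k → L}
    {T : Fin k → Fin k → Fin k → L} (hk : 3 ≤ k) (i : Fin k) (h : i.val + 1 < k) :
    repE N T hk i = -N i ⟨i.val + 1, h⟩ := dif_pos h

theorem repE_of_eq {L : Type} [LieRing L] {N : Fin k → Fin k → L}
    {T : Fin k → Fin k → Fin k → L} (hk : 3 ≤ k) (i : Fin k) (h : ¬ i.val + 1 < k) :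
    repE N T hk i = T (Fin.castLE hk 0) (Fin.castLE hk 1) (Fin.castLE hk 2) := dif_neg h

theorem repF_of_lt {L : Type} [LieRing L] {N : Fin k → Fin k → L} (i : Fin k) (h : i.val + 1 < k) :
    repF N i = -N ⟨i.val + 1, h⟩ i := dif_pos h

theorem lie_repH_of_lie (v : CartanE k) {S : Fin k → L} (hC : ∀ j, ⁅C, S j⁆ = 0)
    (hN : ∀ i m j, ⁅N i m, S j⁆ = (if m = j then (1 : ℝ) else 0) • S i) (j : Fin k) :
    ⁅repH C N v, S j⁆ = v j.succ • S j := by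
  rw [repH_apply, add_lie, smul_lie, hC, smul_zero, zero_add, sum_lie]
  simp only [smul_lie, hN, ite_smul, one_smul, zero_smul,
    smul_ite, smul_zero, Finset.sum_ite_eq', Finset.mem_univ, if_true]

theorem lie_repH_N (r : TrivectorRel k C N T) (v : CartanE k) (j l : Fin k) :
    ⁅repH C N v, N j l⁆ = (v j.succ - v l.succ) • N j l := by
  rw [repH_apply, add_lie, smul_lie, r.cn, smul_zero, zero_add, sum_lie]
  simp only [smul_lie, r.nn, smul_sub, Finset.sum_sub_distrib, ite_smul, one_smul, zero_smul,
    smul_ite, smul_zero, Finset.sum_ite_eq, Finset.sum_ite_eq', Finset.mem_univ, if_true,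
    sub_smul]

theorem lie_repH_T (r : TrivectorRel k C N T) (v : CartanE k) (a b c : Fin k) :
    ⁅repH C N v, T a b c⁆ = -(v 0 + v a.succ + v b.succ + v c.succ) • T a b c := by
  rw [repH_apply, add_lie, smul_lie, r.ct, sum_lie]
  simp only [smul_lie, r.nt, smul_neg, smul_add, Finset.sum_neg_distrib,
    Finset.sum_add_distrib, ite_smul, one_smul, zero_smul,
    smul_ite, smul_zero, Finset.sum_ite_eq, Finset.mem_univ, if_true]
  module

theorem lie_repH_repH (r : TrivectorRel k C N T) (v v' : CartanE k) :
    ⁅repH C N v, repH C N v'⁆ = 0 := by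
  have h : ⁅repH C N v, C⁆ = 0 := by
    rw [repH_apply, add_lie, smul_lie, lie_self, smul_zero, zero_add, sum_lie]
    refine Finset.sum_eq_zero fun i _ => ?_
    rw [smul_lie, ← lie_skew, r.cn, neg_zero, smul_zero]
  rw [repH_apply v', lie_add, lie_smul, h, smul_zero, zero_add, lie_sum]
  refine Finset.sum_eq_zero fun i _ => ?_
  rw [lie_smul, r.lie_repH_N, sub_self, zero_smul, smul_zero]

theorem lie_N_succ_T (r : TrivectorRel k C N T) (hk : 3 ≤ k) (i : Fin k) (h : i.val + 1 < k) :
    ⁅N i ⟨i.val + 1, h⟩, T (Fin.castLE hk 0) (Fin.castLE hk 1) (Fin.castLE hk 2)⁆ =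
      if i.val = 2 then -T (Fin.castLE hk 0) (Fin.castLE hk 1) ⟨i.val + 1, h⟩ else 0 := by
  obtain ⟨i, hi⟩ := i
  rw [r.nt]
  rcases lt_trichotomy i 2 with h2 | rfl | h2
  · interval_cases i
    · have : T ⟨0 + 1, h⟩ (Fin.castLE hk 1) (Fin.castLE hk 2) = 0 := r.self _ _
      simp [Fin.ext_iff, this]
    · have : T (Fin.castLE hk 0) ⟨1 + 1, h⟩ (Fin.castLE hk 2) = 0 := by
        rw [← r.rotate]; exact r.self _ _
      simp [Fin.ext_iff, this]
  · simp [Fin.ext_iff]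
  · have h0 : i ≠ 0 := by omega
    have h1 : i ≠ 1 := by omega
    simp [Fin.ext_iff, h0.symm, h1.symm, h2.ne, h2.ne']

theorem lie_N_pred_T (r : TrivectorRel k C N T) (hk : 3 ≤ k) (i : Fin k) (h : i.val + 1 < k) :
    ⁅N ⟨i.val + 1, h⟩ i, T (Fin.castLE hk 0) (Fin.castLE hk 1) (Fin.castLE hk 2)⁆ = 0 := by
  obtain ⟨i, hi⟩ := i
  rw [r.nt]
  rcases lt_or_ge i 2 with h2 | h2
  · interval_cases i
    · have : T (Fin.castLE hk 0) ⟨0, hi⟩ (Fin.castLE hk 2) = 0 := r.self _ _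
      simp [Fin.ext_iff, this]
    · have : T (Fin.castLE hk 0) (Fin.castLE hk 1) ⟨1, hi⟩ = 0 := by
        rw [← r.rotate]; exact r.self _ _
      simp [Fin.ext_iff, this]
  · rw [if_neg, if_neg, if_neg]
    · simp
    all_goals
      intro h'
      have := congrArg Fin.val h'
      simp at this
      try omega

theorem serreElt_repE (r : TrivectorRel k C N T) (hk : 3 ≤ k) {i j : Fin k}
    (hij : i ≠ j) : serreElt (repE N T hk) i j = 0 := by
  have hi' := i.isLt
  have hj' := j.isLt
  have hv : i.val ≠ j.val := fun h => hij (Fin.ext h)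
  by_cases hi : i.val + 1 < k
  · by_cases hj : j.val + 1 < k
    · by_cases h : adjE k i j
      · rw [serreElt_of_adj _ hij h, repE_of_lt hk i hi, repE_of_lt hk j hj]
        have : i.val + 1 = j.val ∨ j.val + 1 = i.val := by unfold adjE at h; omega
        simp only [neg_lie, lie_neg, r.nn, lie_sub, lie_smul, Fin.ext_iff]
        rcases this with h1 | h1
        · have h2 : ¬ i.val + 1 + 1 = i.val := by omega
          simp [← h1, h2]
        · have h2 : ¬ j.val + 1 + 1 = j.val := by omega
          simp [← h1, h2]
      · rw [serreElt_of_not_adj _ hij h, repE_of_lt hk i hi, repE_of_lt hk j hj]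
        have h1 : ¬ i.val + 1 = j.val := by unfold adjE at h; omega
        have h2 : ¬ j.val + 1 = i.val := by unfold adjE at h; omega
        simp only [neg_lie, lie_neg, r.nn, Fin.ext_iff]
        simp [h1, h2]
    · by_cases h : adjE k i j
      · have h2 : i.val = 2 := by unfold adjE at h; omega
        rw [serreElt_of_adj _ hij h, repE_of_lt hk i hi, repE_of_eq hk j hj, neg_lie, neg_lie,
          r.lie_N_succ_T, if_pos h2, lie_neg, lie_neg, r.nt]
        simp [Fin.ext_iff, h2]
      · have h2 : i.val ≠ 2 := by unfold adjE at h; omega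
        rw [serreElt_of_not_adj _ hij h, repE_of_lt hk i hi, repE_of_eq hk j hj, neg_lie,
          r.lie_N_succ_T, if_neg h2, neg_zero]
  · have hj : j.val + 1 < k := by omega
    by_cases h : adjE k i j
    · have h2 : j.val = 2 := by unfold adjE at h; omega
      rw [serreElt_of_adj _ hij h, repE_of_eq hk i hi, repE_of_lt hk j hj, lie_neg, lie_skew,
        r.lie_N_succ_T, if_pos h2, lie_neg, r.tt, neg_zero]
    · have h2 : j.val ≠ 2 := by unfold adjE at h; omega
      rw [serreElt_of_not_adj _ hij h, repE_of_eq hk i hi, repE_of_lt hk j hj, lie_neg, lie_skew,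
        r.lie_N_succ_T, if_neg h2]

theorem serreElt_repF (r : TrivectorRel k C N T) {i j : Fin k} (hij : i ≠ j) :
    serreElt (repF N) i j = 0 := by
  have hv : i.val ≠ j.val := fun h => hij (Fin.ext h)
  by_cases hi : i.val + 1 < k
  · by_cases hj : j.val + 1 < k
    · by_cases h : adjE k i j
      · rw [serreElt_of_adj _ hij h, repF_of_lt i hi, repF_of_lt j hj]
        have : i.val + 1 = j.val ∨ j.val + 1 = i.val := by unfold adjE at h; omega
        simp only [neg_lie, lie_neg, r.nn, lie_sub, lie_smul, Fin.ext_iff]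
        rcases this with h1 | h1
        · have h2 : ¬ i.val = i.val + 1 + 1 := by omega
          simp [← h1, h2]
        · have h2 : ¬ j.val = j.val + 1 + 1 := by omega
          simp [← h1, h2]
      · rw [serreElt_of_not_adj _ hij h, repF_of_lt i hi, repF_of_lt j hj]
        have h1 : ¬ i.val = j.val + 1 := by unfold adjE at h; omega
        have h2 : ¬ j.val = i.val + 1 := by unfold adjE at h; omega
        simp only [neg_lie, lie_neg, r.nn, Fin.ext_iff]
        simp [h1, h2]
    · have hF : repF N j = 0 := dif_neg hj
      by_cases h : adjE k i j
      · rw [serreElt_of_adj _ hij h, hF, lie_zero, lie_zero]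
      · rw [serreElt_of_not_adj _ hij h, hF, lie_zero]
  · have hF : repF N i = 0 := dif_neg hi
    by_cases h : adjE k i j
    · rw [serreElt_of_adj _ hij h, hF, zero_lie]
    · rw [serreElt_of_not_adj _ hij h, hF, zero_lie]

theorem parabolicRel (r : TrivectorRel k C N T) (hk : 3 ≤ k) :
    ParabolicRel k (repE N T hk) (repF N) (repH C N) where
  hh := r.lie_repH_repH
  he v i := by
    by_cases hi : i.val + 1 < k
    · rw [repE_of_lt hk i hi, lie_neg, r.lie_repH_N, rootE_apply_of_lt i hi, smul_neg]
    · rw [repE_of_eq hk i hi, r.lie_repH_T, rootE_apply_of_eq hk i hi]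
      congr 1
      rw [neg_sub_left]
      abel_nf
      rfl
  hf v i := by
    by_cases hi : i.val + 1 < k
    · rw [repF_of_lt i hi, lie_neg, r.lie_repH_N, rootE_apply_of_lt i hi]
      module
    · rw [show repF N i = 0 from dif_neg hi, lie_zero, smul_zero, neg_zero]
  ef_eq i hi := by
    rw [repE_of_lt hk i hi, repF_of_lt i hi, corootE, dif_pos hi, map_sub, repH_single_succ,
      repH_single_succ, neg_lie, lie_neg, neg_neg, r.nn]
    simp
  ef_ne i j hij := by
    by_cases hj : j.val + 1 < k
    · by_cases hi : i.val + 1 < k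
      · rw [repE_of_lt hk i hi, repF_of_lt j hj, neg_lie, lie_neg, neg_neg, r.nn]
        have hv : i.val ≠ j.val := fun h => hij (Fin.ext h)
        simp [Fin.ext_iff, hv, hv.symm]
      · rw [repE_of_eq hk i hi, repF_of_lt j hj, lie_neg, lie_skew, r.lie_N_pred_T]
    · rw [show repF N j = 0 from dif_neg hj, lie_zero]
  serre_e _ _ hij := r.serreElt_repE hk hij
  serre_f _ _ hij := r.serreElt_repF hij

end TrivectorRel

theorem Fock.trivectorRel (k : ℕ) :
    TrivectorRel k (Fock.opC (k := k)) Fock.opN Fock.opT where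
  cn := Fock.lie_opC_opN
  ct := Fock.lie_opC_opT
  nn := Fock.lie_opN_opN
  nt := Fock.lie_opN_opT
  tt := Fock.lie_opT_opT
  rotate := Fock.opT_rotate
  self := Fock.opT_eq_zero

/-! ### Derivations of free graded commutative algebras -/

namespace FreeGC

variable {ι : Type} {deg : ι → ℕ}

/-- A linear map satisfying a twisted Leibniz rule vanishes if it vanishes on the generators. -/
theorem eq_zero_of_gen {X : Module.End ℝ (FreeGC deg)} {σ : FreeGC deg → FreeGC deg}
    (hσ : σ 1 = 1) (hmul : ∀ x y, X (x * y) = X x * y + σ x * X y)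
    (hgen : ∀ a, X (gen deg a) = 0) : X = 0 := by
  have h1 : X 1 = 0 := by
    have h := hmul 1 1
    simpa [hσ] using h
  refine LinearMap.ext fun x => ?_
  rw [LinearMap.zero_apply]
  revert x
  refine mono_induction (fun l => ?_) (map_zero X) (fun x y hx hy => ?_) (fun r x hx => ?_)
  · induction l with
    | nil => rw [mono_nil, h1]
    | cons a l ih => rw [mono_cons, hmul, hgen, ih, zero_mul, mul_zero, add_zero]
  · rw [map_add, hx, hy, add_zero]
  · rw [map_smul, hx, smul_zero]

theorem sgn_one : sgn deg 1 = 1 := map_one _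

/-- A linear map of degree `0` commutes with the sign automorphism. -/
theorem sgn_comm {D : Module.End ℝ (FreeGC deg)}
    (hD : ∀ n, ∀ x ∈ grading deg n, D x ∈ grading deg n) (x : FreeGC deg) :
    sgn deg (D x) = D (sgn deg x) := by
  revert x
  refine mono_induction (fun l => ?_) (by simp) (fun x y hx hy => ?_) (fun r x hx => ?_)
  · rw [sgn_of_mem _ (mono_mem deg l), sgn_of_mem _ (hD _ _ (mono_mem deg l)), map_smul]
  · simp only [map_add, hx, hy]
  · simp only [map_smul, hx]

/-- There is a derivation of degree `0` with prescribed homogeneous values on the generators. It is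
read off from the algebra map `x ↦ [[x, D x], [0, x]]`. -/
theorem exists_derivation (f : ι → FreeGC deg) (hf : ∀ a, f a ∈ grading deg (deg a)) :
    ∃ D : Module.End ℝ (FreeGC deg), (∀ a, D (gen deg a) = f a) ∧
      (∀ x y, D (x * y) = D x * y + x * D y) ∧
      ∀ n, ∀ x ∈ grading deg n, D x ∈ grading deg n := by
  let Φ : FreeGC deg →ₐ[ℝ] Matrix (Fin 2) (Fin 2) (FreeGC deg) :=
    lift (fun a => !![gen deg a, f a; 0, gen deg a]) (by
      intro a b
      have h1 := graded_comm (hf a) (gen_mem deg b)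
      have h2 := graded_comm (gen_mem deg a) (hf b)
      ext i j
      fin_cases i <;> fin_cases j
      · simp [Matrix.mul_apply, gen_swap deg a b]
      · simp [Matrix.mul_apply, h1, h2, add_comm]
      · simp [Matrix.mul_apply]
      · simp [Matrix.mul_apply, gen_swap deg a b])
  have hΦ : ∀ a, Φ (gen deg a) = !![gen deg a, f a; 0, gen deg a] := fun a => lift_gen _ _ a
  have hdiag : ∀ x, Φ x 0 0 = x ∧ Φ x 1 1 = x := by
    have key : ∀ x, Φ x 0 0 = x ∧ Φ x 1 0 = 0 ∧ Φ x 1 1 = x := by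
      refine mono_induction (fun l => ?_) (by simp) ?_ ?_
      · induction l with
        | nil => simp [mono_nil]
        | cons a l ih =>
          rw [mono_cons, map_mul, hΦ]
          simp [Matrix.mul_apply, ih.1, ih.2.1, ih.2.2]
      · rintro x y ⟨h1, h2, h3⟩ ⟨h4, h5, h6⟩
        simp [h1, h2, h3, h4, h5, h6]
      · rintro r x ⟨h1, h2, h3⟩
        simp [h1, h2, h3]
    exact fun x => ⟨(key x).1, (key x).2.2⟩
  let D : Module.End ℝ (FreeGC deg) :=
    { toFun := fun x => Φ x 0 1
      map_add' := fun x y => by simp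
      map_smul' := fun r x => by simp }
  have hgen : ∀ a, D (gen deg a) = f a := fun a => by
    change Φ (gen deg a) 0 1 = f a
    rw [hΦ]; simp
  have hmul : ∀ x y, D (x * y) = D x * y + x * D y := fun x y => by
    change Φ (x * y) 0 1 = Φ x 0 1 * y + x * Φ y 0 1
    rw [map_mul, Matrix.mul_apply, Fin.sum_univ_two, (hdiag x).1, (hdiag y).2, add_comm]
  refine ⟨D, hgen, hmul, fun n x hx => ?_⟩
  refine grading_induction (P := fun x => D x ∈ grading deg n) (fun l hl => ?_) (by simp)
    (fun x y hx hy => ?_) (fun r x hx => ?_) x hx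
  · clear hx x
    subst hl
    induction l with
    | nil =>
      have h1 : D 1 = 0 := by
        have h := hmul 1 1
        simpa using h
      rw [mono_nil, h1]
      exact Submodule.zero_mem _
    | cons a l ih =>
      rw [mono_cons, hmul, hgen, List.map_cons, List.sum_cons]
      exact add_mem (mul_mem (hf a) (mono_mem deg l)) (mul_mem (gen_mem deg a) ih)
  · rw [map_add]; exact add_mem hx hy
  · rw [map_smul]; exact Submodule.smul_mem _ _ hx

end FreeGC

namespace Fock

open Toroid

variable {k : ℕ}

/-! ### The map onto the span of the generators -/

/-- The map `x ↦ x g₄`. -/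
noncomputable def tau4 : Ext k →ₗ[ℝ] ToroidAlg k := Finsupp.linearCombination ℝ sg4

/-- The map `x ↦ x g₇`. -/
noncomputable def tau7 : Ext k →ₗ[ℝ] ToroidAlg k := Finsupp.linearCombination ℝ sg7

/-- The map from the space `Gen k` onto the span of the generators of the model. -/
noncomputable def tau : Gen k →ₗ[ℝ] ToroidAlg k :=
  tau4.coprod (tau7.coprod (Fintype.linearCombination ℝ w))

theorem tau_apply (x y : Ext k) (z : Fin k → ℝ) :
    tau (x, y, z) = tau4 x + (tau7 y + ∑ i, z i • w i) := by
  simp [tau, Fintype.linearCombination_apply]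

theorem tau_inl (x : Ext k) : tau (x, 0, 0) = tau4 x := by simp [tau_apply]

theorem tau_inm (y : Ext k) : tau (0, y, 0) = tau7 y := by simp [tau_apply]

theorem tau_inr (z : Fin k → ℝ) : tau (0, 0, z) = ∑ i, z i • w i := by simp [tau_apply]

theorem tau_inr_single (i : Fin k) : tau (0, 0, Pi.single i 1) = w i := by
  rw [tau_inr, Finset.sum_eq_single i]
  · simp
  · intro j _ hj; rw [Pi.single_eq_of_ne hj, zero_smul]
  · simp

theorem tau4_single (I : Finset (Fin k)) : tau4 (Finsupp.single I 1) = sg4 I := by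
  simp [tau4]

theorem tau7_single (I : Finset (Fin k)) : tau7 (Finsupp.single I 1) = sg7 I := by
  simp [tau7]

theorem tau_ext {N : Type} [AddCommGroup N] [Module ℝ N] {A B : Gen k →ₗ[ℝ] N}
    (h4 : ∀ I, A (Finsupp.single I 1, 0, 0) = B (Finsupp.single I 1, 0, 0))
    (h7 : ∀ I, A (0, Finsupp.single I 1, 0) = B (0, Finsupp.single I 1, 0))
    (hw : ∀ i, A (0, 0, Pi.single i 1) = B (0, 0, Pi.single i 1)) : A = B := by
  refine LinearMap.prod_ext ?_ (LinearMap.prod_ext ?_ ?_)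
  · exact Finsupp.lhom_ext' fun I => LinearMap.ext_ring (h4 I)
  · exact Finsupp.lhom_ext' fun I => LinearMap.ext_ring (h7 I)
  · exact LinearMap.pi_ext' fun i => LinearMap.ext_ring (hw i)

theorem gen_eq_tau (a : ToroidGen k) : ∃ u : Gen k, FreeGC.gen ToroidGen.deg a = tau u := by
  cases a with
  | g4 I h => exact ⟨(Finsupp.single I 1, 0, 0), by rw [tau_inl, tau4_single, sg4, dif_pos h]⟩
  | g7 I h => exact ⟨(0, Finsupp.single I 1, 0), by rw [tau_inm, tau7_single, sg7, dif_pos h]⟩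
  | w i => exact ⟨(0, 0, Pi.single i 1), by rw [tau_inr_single, w]⟩

theorem tau_mem_span (u : Gen k) :
    tau u ∈ Submodule.span ℝ (Set.range (FreeGC.gen (ToroidGen.deg (k := k)))) := by
  obtain ⟨x, y, z⟩ := u
  rw [tau_apply]
  refine add_mem ?_ (add_mem ?_ (sum_mem fun i _ => Submodule.smul_mem _ _
    (Submodule.subset_span ⟨_, rfl⟩)))
  · rw [tau4, Finsupp.linearCombination_apply]
    refine sum_mem fun I _ => Submodule.smul_mem _ _ ?_
    unfold sg4
    split_ifs
    · exact Submodule.subset_span ⟨_, rfl⟩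
    · exact zero_mem _
  · rw [tau7, Finsupp.linearCombination_apply]
    refine sum_mem fun I _ => Submodule.smul_mem _ _ ?_
    unfold sg7
    split_ifs
    · exact Submodule.subset_span ⟨_, rfl⟩
    · exact zero_mem _

theorem s_tau (i : Fin k) (u : Gen k) : s i (tau u) = tau (opS i u) := by
  suffices h : s i ∘ₗ tau = tau ∘ₗ opS i from LinearMap.congr_fun h u
  refine tau_ext (fun I => ?_) (fun I => ?_) (fun j => ?_)
  · rw [LinearMap.comp_apply, LinearMap.comp_apply, opS_apply, tau_inl, tau4_single, s_sg4]
    simp only [cr_single, map_zero, tau_inl, mul_one]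
    rw [← mul_one (sSign i I), ← smul_eq_mul, ← Finsupp.smul_single, map_smul, tau4_single]
    simp
  · rw [LinearMap.comp_apply, LinearMap.comp_apply, opS_apply, tau_inm, tau7_single, s_sg7]
    simp only [cr_single, map_zero, tau_inm, mul_one]
    rw [← mul_one (sSign i I), ← smul_eq_mul, ← Finsupp.smul_single, map_smul, tau7_single]
    simp
  · rw [LinearMap.comp_apply, LinearMap.comp_apply, opS_apply, tau_inr_single, s_w]
    simp [tau_apply]

/-! ### Degrees -/

/-- The part of `Λ(s)` spanned by the monomials of length `n`. -/
noncomputable def extPart (n : ℤ) : Submodule ℝ (Ext k) :=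
  Submodule.span ℝ {x | ∃ I : Finset (Fin k), (I.card : ℤ) = n ∧ Finsupp.single I 1 = x}

/-- The component of the model of an integral degree `n`, set to zero for `n ≤ 0`. -/
noncomputable def posGrading (n : ℤ) : Submodule ℝ (ToroidAlg k) :=
  if 0 < n then FreeGC.grading ToroidGen.deg n.toNat else ⊥

theorem single_mem_extPart (I : Finset (Fin k)) : Finsupp.single I 1 ∈ extPart (I.card : ℤ) :=
  Submodule.subset_span ⟨I, rfl, rfl⟩

theorem extPart_le {n : ℤ} {N : Type} [AddCommGroup N] [Module ℝ N] {A : Ext k →ₗ[ℝ] N}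
    {Z : Submodule ℝ N} (h : ∀ I : Finset (Fin k), (I.card : ℤ) = n → A (Finsupp.single I 1) ∈ Z)
    {x : Ext k} (hx : x ∈ extPart n) : A x ∈ Z := by
  refine (Submodule.span_le (p := Z.comap A)).mpr ?_ hx
  rintro _ ⟨I, hI, rfl⟩
  exact h I hI

theorem single_smul_mem {n : ℤ} {I : Finset (Fin k)} (h : (I.card : ℤ) = n) (c : ℝ) :
    Finsupp.single I c ∈ extPart n := by
  rw [← mul_one c, ← smul_eq_mul, ← Finsupp.smul_single]
  exact Submodule.smul_mem _ _ (h ▸ single_mem_extPart I)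

theorem cr_mem (i : Fin k) {n : ℤ} {x : Ext k} (hx : x ∈ extPart n) : cr i x ∈ extPart (n + 1) := by
  refine extPart_le (fun I hI => ?_) hx
  rw [cr_single]
  by_cases hi : i ∈ I
  · simp [sSign_of_mem hi]
  · refine single_smul_mem ?_ _
    rw [Finset.card_insert_of_notMem hi]; push_cast; omega

theorem an_mem (i : Fin k) {n : ℤ} {x : Ext k} (hx : x ∈ extPart n) : an i x ∈ extPart (n - 1) := by
  refine extPart_le (fun I hI => ?_) hx
  rw [an_single]
  split_ifs with hi
  · refine single_smul_mem ?_ _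
    have := Finset.card_erase_add_one hi
    omega
  · exact zero_mem _

theorem par_mem {n : ℤ} {x : Ext k} (hx : x ∈ extPart n) : par x ∈ extPart n := by
  refine extPart_le (fun I hI => ?_) hx
  rw [par_single]
  exact single_smul_mem hI _

theorem vac_eq_zero {n : ℤ} (hn : n ≠ 0) {x : Ext k} (hx : x ∈ extPart n) : vac x = 0 := by
  refine (Submodule.mem_bot ℝ).mp (extPart_le (A := vac) (fun I hI => ?_) hx)
  rw [Submodule.mem_bot, vac, Finsupp.lapply_apply, Finsupp.single_eq_of_ne]
  rintro rfl
  exact hn (by simpa using hI.symm)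

theorem mem_posGrading {n : ℤ} {m : ℕ} {x : ToroidAlg k}
    (hx : x ∈ FreeGC.grading ToroidGen.deg m) (h : n = m ∧ 0 < m) : x ∈ posGrading n := by
  obtain ⟨rfl, h⟩ := h
  rw [posGrading, if_pos (by exact_mod_cast h), Int.toNat_natCast]
  exact hx

theorem tau4_mem {n : ℤ} {x : Ext k} (hx : x ∈ extPart n) : tau4 x ∈ posGrading (4 - n) := by
  refine extPart_le (fun I hI => ?_) hx
  rw [tau4_single]
  by_cases h : I.card ≤ 3
  · exact mem_posGrading (sg4_mem I (4 - I.card) (by omega)) (by omega)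
  · rw [sg4, dif_neg h]; exact zero_mem _

theorem tau7_mem {n : ℤ} {x : Ext k} (hx : x ∈ extPart n) : tau7 x ∈ posGrading (7 - n) := by
  refine extPart_le (fun I hI => ?_) hx
  rw [tau7_single]
  by_cases h : I.card ≤ 6
  · exact mem_posGrading (sg7_mem I (7 - I.card) (by omega)) (by omega)
  · rw [sg7, dif_neg h]; exact zero_mem _

theorem sum_w_mem (z : Fin k → ℝ) : tau (0, 0, z) ∈ posGrading 2 := by
  rw [tau_inr]
  exact sum_mem fun i _ => Submodule.smul_mem _ _ (mem_posGrading (w_mem i) (by norm_num))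

/-- An operator on `Gen k` is homogeneous of degree `0`. In particular it preserves the kernel of
`tau`, which is spanned by the monomials of degree `≤ 0`. -/
structure IsHomog (X : Module.End ℝ (Gen k)) : Prop where
  g4 : ∀ I, tau (X (Finsupp.single I 1, 0, 0)) ∈ posGrading (4 - (I.card : ℤ))
  g7 : ∀ I, tau (X (0, Finsupp.single I 1, 0)) ∈ posGrading (7 - (I.card : ℤ))
  w : ∀ i, tau (X (0, 0, Pi.single i 1)) ∈ posGrading 2

theorem isHomog_opN (i m : Fin k) : IsHomog (opN i m) where
  g4 I := by
    have h := tau4_mem (cr_mem i (an_mem m (single_mem_extPart I)))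
    rw [sub_add_cancel] at h
    simpa [opN_apply, tau_inl] using h
  g7 I := by
    have h := tau7_mem (cr_mem i (an_mem m (single_mem_extPart I)))
    rw [sub_add_cancel] at h
    simpa [opN_apply, tau_inm] using h
  w j := by
    simp only [opN_apply, map_zero]
    exact sum_w_mem _

theorem isHomog_opC : IsHomog (opC (k := k)) where
  g4 I := by simpa [opC_apply, tau_inl] using tau4_mem (single_mem_extPart I)
  g7 I := by
    simp only [opC_apply, tau_inm, map_smul]
    exact Submodule.smul_mem _ _ (tau7_mem (single_mem_extPart I))
  w j := by
    simp only [opC_apply, smul_zero]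
    exact sum_w_mem _

theorem isHomog_opT (a b c : Fin k) : IsHomog (opT a b c) where
  g4 I := by
    simp only [opT_apply, map_zero, neg_zero]
    by_cases h : (I.card : ℤ) = 2
    · rw [h]; exact sum_w_mem _
    · have hv : ∀ i j : Fin k, vac (an i (an j (Finsupp.single I 1))) = 0 := fun i j =>
        vac_eq_zero (by omega) (an_mem i (an_mem j (single_mem_extPart I)))
      rw [hv, hv, hv]
      simp only [zero_smul, add_zero]
      rw [show ((0, 0, 0) : Gen k) = 0 from rfl, map_zero]
      exact zero_mem _
  g7 I := by
    have h := tau4_mem (an_mem c (an_mem b (an_mem a (par_mem (single_mem_extPart I)))))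
    rw [show 4 - ((I.card : ℤ) - 1 - 1 - 1) = 7 - I.card by ring] at h
    have h2 := neg_mem h
    rw [← map_neg] at h2
    simpa [opT_apply, tau_inl] using h2
  w j := by
    simp only [opT_apply, map_zero, neg_zero, zero_smul, add_zero]
    exact sum_w_mem _

/-- The derivation `D` of the model, homogeneous of degree `0`, is induced by the operator `X` on
the space of generators. -/
structure IsLift (X : Module.End ℝ (Gen k)) (D : Module.End ℝ (ToroidAlg k)) : Prop where
  tau : ∀ u, D (tau u) = tau (X u)
  mul : ∀ x y, D (x * y) = D x * y + x * D y
  mem : ∀ n, ∀ x ∈ FreeGC.grading (ToroidGen.deg (k := k)) n,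
    D x ∈ FreeGC.grading (ToroidGen.deg (k := k)) n

theorem exists_isLift {X : Module.End ℝ (Gen k)} (hX : IsHomog X) : ∃ D, IsLift X D := by
  have hpos : ∀ {n : ℤ} {x : ToroidAlg k}, x ∈ posGrading n → n ≤ 0 → x = 0 := by
    intro n x hx hn
    rw [posGrading, if_neg (not_lt.mpr hn)] at hx
    exact (Submodule.mem_bot ℝ).mp hx
  have hdeg : ∀ {n : ℤ} {m : ℕ} {x : ToroidAlg k}, x ∈ posGrading n → n = m ∧ 0 < m →
      x ∈ FreeGC.grading ToroidGen.deg m := by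
    rintro n m x hx ⟨rfl, hm⟩
    rwa [posGrading, if_pos (by exact_mod_cast hm), Int.toNat_natCast] at hx
  obtain ⟨D, hgen, hmul, hmem⟩ := FreeGC.exists_derivation (deg := ToroidGen.deg (k := k))
    (fun a => match a with
      | .g4 I _ => tau (X (Finsupp.single I 1, 0, 0))
      | .g7 I _ => tau (X (0, Finsupp.single I 1, 0))
      | .w i => tau (X (0, 0, Pi.single i 1)))
    (by
      intro a
      cases a with
      | g4 I h => exact hdeg (hX.g4 I) (by simp only [ToroidGen.deg]; omega)
      | g7 I h => exact hdeg (hX.g7 I) (by simp only [ToroidGen.deg]; omega)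
      | w i => exact hdeg (hX.w i) (by simp [ToroidGen.deg]))
  refine ⟨D, fun u => ?_, hmul, hmem⟩
  suffices h : D ∘ₗ tau = tau ∘ₗ X from LinearMap.congr_fun h u
  refine tau_ext (fun I => ?_) (fun I => ?_) (fun i => ?_)
  · rw [LinearMap.comp_apply, LinearMap.comp_apply, tau_inl, tau4_single]
    by_cases h : I.card ≤ 3
    · rw [sg4, dif_pos h, hgen]
    · rw [sg4, dif_neg h, map_zero, hpos (hX.g4 I) (by omega)]
  · rw [LinearMap.comp_apply, LinearMap.comp_apply, tau_inm, tau7_single]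
    by_cases h : I.card ≤ 6
    · rw [sg7, dif_pos h, hgen]
    · rw [sg7, dif_neg h, map_zero, hpos (hX.g7 I) (by omega)]
  · rw [LinearMap.comp_apply, LinearMap.comp_apply, tau_inr_single, w, hgen]

/-! ### Derivations induced from the space of generators -/

theorem IsLift.one {X : Module.End ℝ (Gen k)} {D : Module.End ℝ (ToroidAlg k)} (h : IsLift X D) :
    D 1 = 0 := by
  have h1 := h.mul 1 1
  simpa using h1

theorem ext_of_tau {D D' : Module.End ℝ (ToroidAlg k)}
    (h1 : ∀ x y, D (x * y) = D x * y + x * D y) (h2 : ∀ x y, D' (x * y) = D' x * y + x * D' y)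
    (h : ∀ u, D (tau u) = D' (tau u)) : D = D' := by
  refine sub_eq_zero.mp (FreeGC.eq_zero_of_gen (σ := id) rfl (fun x y => ?_) (fun a => ?_))
  · simp only [LinearMap.sub_apply, h1, h2, sub_mul, mul_sub, id]; abel
  · obtain ⟨u, hu⟩ := gen_eq_tau a
    rw [hu, LinearMap.sub_apply, h, sub_self]

/-- Commutation relations with the `s_j` may be checked on the space of generators. -/
theorem IsLift.lie_s {X : Module.End ℝ (Gen k)} {D : Module.End ℝ (ToroidAlg k)} (h : IsLift X D)
    {i j : Fin k} {c : ℝ} (hX : ⁅X, opS j⁆ = c • opS i) : ⁅D, s j⁆ = c • s i := by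
  refine sub_eq_zero.mp (FreeGC.eq_zero_of_gen (σ := FreeGC.sgn _) FreeGC.sgn_one
    (fun x y => ?_) (fun a => ?_))
  · simp only [lie_apply, LinearMap.sub_apply, LinearMap.smul_apply, s_mul, h.mul, map_add,
      FreeGC.sgn_comm h.mem, sub_mul, mul_sub, smul_add, smul_mul_assoc,
      mul_smul_comm]
    abel
  · obtain ⟨u, hu⟩ := gen_eq_tau a
    have h1 := LinearMap.congr_fun hX u
    rw [lie_apply, LinearMap.smul_apply] at h1
    rw [hu, LinearMap.sub_apply, LinearMap.smul_apply, lie_apply, s_tau, h.tau, h.tau, s_tau,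
      s_tau, ← map_sub, ← map_smul, ← map_sub, sub_eq_zero.mpr h1, map_zero]

theorem IsLift.apply_s {X : Module.End ℝ (Gen k)} {D : Module.End ℝ (ToroidAlg k)}
    (h : IsLift X D) {i j : Fin k} {c : ℝ} (hX : ⁅X, opS j⁆ = c • opS i) (x : ToroidAlg k) :
    D (s j x) = s j (D x) + c • s i x := by
  have h1 := LinearMap.congr_fun (h.lie_s hX) x
  rw [lie_apply, LinearMap.smul_apply] at h1
  rw [← h1]; abel

/-- If a linear map commutes with `s_i` up to a scalar for all `i ∉ S`, then it vanishes on all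
`s_I g` as soon as it does so for `I ⊆ S`. -/
theorem eq_zero_of_subset {g : Finset (Fin k) → ToroidAlg k}
    (hg : ∀ i I, s i (g I) = sSign i I • g (insert i I)) {X : Module.End ℝ (ToroidAlg k)}
    {S : Finset (Fin k)} {c : ℝ} (hX : ∀ i ∉ S, ∀ x, X (s i x) = c • s i (X x))
    (h : ∀ K ⊆ S, X (g K) = 0) (I : Finset (Fin k)) : X (g I) = 0 := by
  induction I using Finset.strongInduction with
  | H I ih =>
    by_cases hI : I ⊆ S
    · exact h I hI
    · obtain ⟨i, hi, hiS⟩ := Finset.not_subset.mp hI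
      have h1 := hg i (I.erase i)
      rw [Finset.insert_erase hi] at h1
      have h2 : g I = sSign i (I.erase i) • s i (g (I.erase i)) := by
        rw [h1, smul_smul, sSign_mul_self (Finset.notMem_erase _ _), one_smul]
      rw [h2, map_smul, hX i hiS, ih _ (Finset.erase_ssubset hi), map_zero, smul_zero, smul_zero]

theorem IsLift.lie_d_mul {X : Module.End ℝ (Gen k)} {D : Module.End ℝ (ToroidAlg k)}
    (h : IsLift X D) (x y : ToroidAlg k) :
    ⁅D, d k⁆ (x * y) = ⁅D, d k⁆ x * y + FreeGC.sgn _ x * ⁅D, d k⁆ y := by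
  simp only [lie_apply, d_mul, h.mul, map_add, FreeGC.sgn_comm h.mem, sub_mul, mul_sub]
  abel

theorem IsLift.lie_d_s {X : Module.End ℝ (Gen k)} {D : Module.End ℝ (ToroidAlg k)}
    (h : IsLift X D) {i j : Fin k} {c : ℝ} (hX : ⁅X, opS j⁆ = c • opS i) (x : ToroidAlg k) :
    ⁅D, d k⁆ (s j x) = (-1 : ℝ) • s j (⁅D, d k⁆ x) := by
  have hd : ∀ i y, d k (s i y) = -s i (d k y) := fun i y => eq_neg_of_add_eq_zero_left (d_s i y)
  rw [lie_apply, lie_apply, hd, map_neg, h.apply_s hX, h.apply_s hX, map_add, map_smul, hd, hd,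
    map_sub]
  module

/-- A derivation induced from the space of generators commutes with `d` if it does so on the `w_i`,
and on `s_I g₄` and `s_I g₇` for `I ⊆ S`, where `S` contains all indices `j` such that `[D, s_j]` is
not a multiple of some `s_i`. -/
theorem IsLift.comm_d {X : Module.End ℝ (Gen k)} {D : Module.End ℝ (ToroidAlg k)}
    (h : IsLift X D) (S : Finset (Fin k)) (hS : ∀ j ∉ S, ∃ i, ∃ c : ℝ, ⁅X, opS j⁆ = c • opS i)
    (h4 : ∀ K ⊆ S, ⁅D, d k⁆ (sg4 K) = 0) (h7 : ∀ K ⊆ S, ⁅D, d k⁆ (sg7 K) = 0)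
    (hw : ∀ i, ⁅D, d k⁆ (w i) = 0) : ⁅D, d k⁆ = 0 := by
  have hs : ∀ i ∉ S, ∀ x, ⁅D, d k⁆ (s i x) = (-1 : ℝ) • s i (⁅D, d k⁆ x) := by
    intro i hi x
    obtain ⟨j, c, hX⟩ := hS i hi
    exact h.lie_d_s hX x
  refine FreeGC.eq_zero_of_gen (σ := FreeGC.sgn _) FreeGC.sgn_one h.lie_d_mul fun a => ?_
  cases a with
  | g4 I hI =>
    have h1 := eq_zero_of_subset s_sg4 hs h4 I
    rwa [sg4, dif_pos hI] at h1
  | g7 I hI =>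
    have h1 := eq_zero_of_subset s_sg7 hs h7 I
    rwa [sg7, dif_pos hI] at h1
  | w i => exact hw i

theorem IsLift.mem_der {X : Module.End ℝ (Gen k)} {D : Module.End ℝ (ToroidAlg k)}
    (h : IsLift X D) (hd : ⁅D, d k⁆ = 0) : D ∈ (toroidModel k).der := by
  refine ⟨h.mem, h.mul, fun x => sub_eq_zero.mp (LinearMap.congr_fun hd x), ?_⟩
  change ∀ x, aug k (D x) = 0
  refine FreeGC.mono_induction (fun l => ?_) (by simp) (fun x y hx hy => ?_) (fun r x hx => ?_)
  · cases l with
    | nil => rw [FreeGC.mono_nil, h.one, map_zero]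
    | cons a l =>
      refine aug_mem (h.mem _ _ (FreeGC.mono_mem _ _)) ?_
      have := deg_pos a
      rw [List.map_cons, List.sum_cons]
      omega
  · rw [map_add, map_add, hx, hy, add_zero]
  · rw [map_smul, map_smul, hx, smul_zero]

/-- The operators on the space of generators that are induced by elements of `Der M(T^k S⁴)`. -/
noncomputable def liftable (k : ℕ) : Submodule ℝ (Module.End ℝ (Gen k)) where
  carrier := {X | ∃ D : (toroidModel k).der, ∀ u, D.1 (tau u) = tau (X u)}
  add_mem' := by
    rintro X Y ⟨D, hD⟩ ⟨E, hE⟩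
    refine ⟨D + E, fun u => ?_⟩
    rw [LinearMap.add_apply, map_add, ← hD, ← hE]; rfl
  zero_mem' := ⟨0, fun u => by simp⟩
  smul_mem' := by
    rintro c X ⟨D, hD⟩
    refine ⟨c • D, fun u => ?_⟩
    rw [LinearMap.smul_apply, map_smul, ← hD]; rfl

theorem mem_liftable {X : Module.End ℝ (Gen k)} (hX : IsHomog X)
    (hd : ∀ D, IsLift X D → ⁅D, d k⁆ = 0) : X ∈ liftable k := by
  obtain ⟨D, hD⟩ := exists_isLift hX
  exact ⟨⟨D, hD.mem_der (hd D hD)⟩, hD.tau⟩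

/-! ### The general linear part commutes with the differential -/

theorem g4_eq_tau : g4 k = tau (Finsupp.single ∅ 1, 0, 0) := by rw [tau_inl, tau4_single, g4]

theorem g7_eq_tau : g7 k = tau (0, Finsupp.single ∅ 1, 0) := by rw [tau_inm, tau7_single, g7]

theorem tau_zero : tau ((0, 0, 0) : Gen k) = 0 := map_zero tau

theorem w_eq_tau (i : Fin k) : w i = tau (0, 0, Pi.single i 1) := (tau_inr_single i).symm

theorem opN_mem_liftable (i m : Fin k) : opN i m ∈ liftable k := by
  refine mem_liftable (isHomog_opN i m) fun D hD => ?_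
  have hw : ∀ j, D (w j) = -(if j = i then (1 : ℝ) else 0) • w m := by
    intro j
    rw [w_eq_tau, hD.tau, opN_apply, w_eq_tau m, ← map_smul]
    simp [single_apply']
  have hQ : ∀ x, D (∑ j, w j * s j x) = ∑ j, w j * s j (D x) := by
    intro x
    rw [map_sum]
    simp only [hD.mul, hw, hD.apply_s (lie_opN_opS i m _), mul_add, neg_smul, ite_smul, one_smul,
      zero_smul, Finset.sum_add_distrib, neg_mul, ite_mul, zero_mul,
      mul_ite, mul_zero, Finset.sum_neg_distrib, Finset.sum_ite_eq, Finset.sum_ite_eq',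
      Finset.mem_univ, if_true]
    abel
  have h4 : D (g4 k) = 0 := by
    rw [g4_eq_tau, hD.tau, opN_apply]
    simp [an_single, tau_zero]
  have h7 : D (g7 k) = 0 := by
    rw [g7_eq_tau, hD.tau, opN_apply]
    simp [an_single, tau_zero]
  refine hD.comm_d ∅ (fun j _ => ⟨i, _, lie_opN_opS i m j⟩) ?_ ?_ ?_
  · intro K hK
    rw [Finset.subset_empty.mp hK]
    change ⁅D, d k⁆ (g4 k) = 0
    rw [lie_apply, d_g4, hQ, h4]
    simp
  · intro K hK
    rw [Finset.subset_empty.mp hK]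
    change ⁅D, d k⁆ (g7 k) = 0
    rw [lie_apply, d_g7, map_add, hQ, map_smul, hD.mul, h4, h7]
    simp
  · intro j
    rw [lie_apply, d_w, hw, map_smul, d_w]
    simp

theorem opC_mem_liftable : opC ∈ liftable k := by
  refine mem_liftable isHomog_opC fun D hD => ?_
  have hS : ∀ j : Fin k, ⁅opC, opS j⁆ = (0 : ℝ) • opS j := fun j => by
    rw [lie_opC_opS]; exact (LinearMap.ext fun u => (zero_smul ℝ (opS j u)).symm)
  have hw : ∀ j, D (w j) = 0 := by
    intro j
    rw [w_eq_tau, hD.tau, opC_apply]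
    simp [tau_zero]
  have hQ : ∀ x, D (∑ j, w j * s j x) = ∑ j, w j * s j (D x) := by
    intro x
    rw [map_sum]
    simp [hD.mul, hw, hD.apply_s (hS _)]
  have h4 : D (g4 k) = g4 k := by
    rw [g4_eq_tau, hD.tau, opC_apply]
    simp
  have h7 : D (g7 k) = (2 : ℝ) • g7 k := by
    rw [g7_eq_tau, hD.tau, opC_apply, ← map_smul]
    simp
  refine hD.comm_d ∅ (fun j _ => ⟨j, _, hS j⟩) ?_ ?_ ?_
  · intro K hK
    rw [Finset.subset_empty.mp hK]
    change ⁅D, d k⁆ (g4 k) = 0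
    rw [lie_apply, d_g4, hQ, h4, d_g4, sub_self]
  · intro K hK
    rw [Finset.subset_empty.mp hK]
    change ⁅D, d k⁆ (g7 k) = 0
    rw [lie_apply, d_g7, map_add, hQ, map_smul, hD.mul, h4, h7, map_smul, d_g7]
    simp only [map_smul, mul_smul_comm, ← Finset.smul_sum]
    module
  · intro j
    rw [lie_apply, d_w, hw, map_zero, map_zero, sub_zero]

/-! ### The differential on the space of generators -/

theorem sWord_s (l : List (Fin k)) (i : Fin k) (x : ToroidAlg k) :
    sWord l (s i x) = (-1 : ℝ) ^ l.length • s i (sWord l x) := by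
  induction l with
  | nil => simp [sWord]
  | cons j l ih =>
    rw [sWord_cons, sWord_cons, ih, map_smul, eq_neg_of_add_eq_zero_left (s_anticomm j i _),
      List.length_cons, pow_succ]
    module

theorem sSet_insert {i : Fin k} {I : Finset (Fin k)} (hi : i ∉ I) (x : ToroidAlg k) :
    sSet (insert i I) x = sSign i I • s i (sSet I x) := by
  rw [s_sSet, smul_smul, sSign_mul_self hi, one_smul]

/-- The elements `s_I x` are determined by `x` and the action of the `s_i`. -/
theorem sSet_eq {g : Finset (Fin k) → ToroidAlg k}
    (hg : ∀ i I, s i (g I) = sSign i I • g (insert i I)) (I : Finset (Fin k)) :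
    sSet I (g ∅) = g I := by
  induction I using Finset.induction_on with
  | empty => simp [sSet, sWord]
  | insert i I hi ih => rw [sSet_insert hi, ih, hg, smul_smul, sSign_mul_self hi, one_smul]

theorem sSet_sum_w (I : Finset (Fin k)) (x : ToroidAlg k) :
    (-1 : ℝ) ^ I.card • sSet I (∑ i, w i * s i x) = ∑ i, w i * s i (sSet I x) := by
  rw [map_sum, Finset.smul_sum]
  refine Finset.sum_congr rfl fun i _ => ?_
  rw [sSet, sWord_w_mul, sWord_s, Finset.length_sort, mul_smul_comm, smul_smul, ← pow_add,
    Even.neg_one_pow ⟨_, rfl⟩, one_smul]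

/-- The map `x ↦ x (g₄²)`. -/
noncomputable def sqMap : Ext k →ₗ[ℝ] ToroidAlg k :=
  Finsupp.linearCombination ℝ fun I => sSet I (g4 k * g4 k)

theorem s_sqMap (i : Fin k) (x : Ext k) : s i (sqMap x) = sqMap (cr i x) := by
  suffices h : s i ∘ₗ sqMap = sqMap ∘ₗ cr i from LinearMap.congr_fun h x
  refine Finsupp.lhom_ext' fun I => LinearMap.ext_ring ?_
  simp only [LinearMap.comp_apply, Finsupp.lsingle_apply, sqMap, Finsupp.linearCombination_single,
    cr_single, mul_one, one_smul, s_sSet]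

theorem d_tau4 (x : Ext k) : d k (tau4 x) = ∑ i, w i * s i (tau4 x) := by
  suffices h : d k ∘ₗ tau4 = (∑ i, LinearMap.mulLeft ℝ (w i) ∘ₗ s i) ∘ₗ tau4 by
    simpa using LinearMap.congr_fun h x
  refine Finsupp.lhom_ext' fun I => LinearMap.ext_ring ?_
  simp only [LinearMap.comp_apply, Finsupp.lsingle_apply, tau4_single, LinearMap.sum_apply,
    LinearMap.mulLeft_apply]
  rw [d_sg4, dg4, sSet_sum_w, g4, sSet_eq s_sg4]

theorem d_tau7 (x : Ext k) :
    d k (tau7 x) = ∑ i, w i * s i (tau7 x) - (1 / 2 : ℝ) • sqMap (par x) := by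
  suffices h : d k ∘ₗ tau7 = (∑ i, LinearMap.mulLeft ℝ (w i) ∘ₗ s i) ∘ₗ tau7 -
      (1 / 2 : ℝ) • sqMap ∘ₗ par by
    simpa using LinearMap.congr_fun h x
  refine Finsupp.lhom_ext' fun I => LinearMap.ext_ring ?_
  simp only [LinearMap.comp_apply, Finsupp.lsingle_apply, tau7_single, LinearMap.sum_apply,
    LinearMap.mulLeft_apply, LinearMap.sub_apply, LinearMap.smul_apply, par_single, sqMap,
    Finsupp.linearCombination_single]
  rw [d_sg7, dg7, map_add, smul_add, sSet_sum_w, g7, sSet_eq s_sg7, map_smul]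
  module

/-! ### The trivectors commute with the differential -/

theorem s_tau4 (i : Fin k) (x : Ext k) : s i (tau4 x) = tau4 (cr i x) := by
  rw [← tau_inl, s_tau, opS_apply, ← tau_inl]
  simp

theorem s_tau7 (i : Fin k) (x : Ext k) : s i (tau7 x) = tau7 (cr i x) := by
  rw [← tau_inm, s_tau, opS_apply, ← tau_inm]
  simp

/-- The unit of the exterior algebra. -/
noncomputable def vacuum : Ext k := Finsupp.single ∅ 1

theorem an_vacuum (i : Fin k) : an i vacuum = 0 :=
  an_single_of_notMem (Finset.notMem_empty i) 1

theorem vac_vacuum : vac (vacuum (k := k)) = 1 := by simp [vac, vacuum]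

theorem par_vacuum : par (vacuum (k := k)) = vacuum := by simp [par_single, vacuum]

theorem tau4_vacuum : tau4 vacuum = g4 k := tau4_single ∅

theorem tau7_vacuum : tau7 vacuum = g7 k := tau7_single ∅

theorem single_insert {i : Fin k} {I : Finset (Fin k)} (hi : i ∉ I) :
    (Finsupp.single (insert i I) 1 : Ext k) = sSign i I • cr i (Finsupp.single I 1) := by
  rw [cr_single, Finsupp.smul_single, mul_one, smul_eq_mul, sSign_mul_self hi]

theorem single_singleton (i : Fin k) :
    (Finsupp.single {i} 1 : Ext k) = sSign i ∅ • cr i vacuum := by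
  rw [← insert_empty_eq, single_insert (Finset.notMem_empty _), vacuum]

/-- A linear map vanishes on the exterior algebra of `s_a, s_b, s_c` if it does so on the products
of at most three of them. -/
theorem eq_zero_of_triple {N : Type} [AddCommGroup N] [Module ℝ N] (A : Ext k →ₗ[ℝ] N)
    {a b c : Fin k} (hab : a ≠ b) (hac : a ≠ c) (hbc : b ≠ c)
    (h0 : A vacuum = 0)
    (h1 : ∀ i ∈ ({a, b, c} : Finset (Fin k)), A (cr i vacuum) = 0)
    (h2 : ∀ i ∈ ({a, b, c} : Finset (Fin k)), ∀ j ∈ ({a, b, c} : Finset (Fin k)), i ≠ j →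
      A (cr i (cr j vacuum)) = 0)
    (h3 : A (cr a (cr b (cr c vacuum))) = 0) :
    ∀ K ⊆ ({a, b, c} : Finset (Fin k)), A (Finsupp.single K 1) = 0 := by
  intro K hK
  have hcard : ({a, b, c} : Finset (Fin k)).card = 3 := Finset.card_eq_three.mpr
    ⟨a, b, c, hab, hac, hbc, rfl⟩
  have hle := Finset.card_le_card hK
  rw [hcard] at hle
  obtain h | h | h | h : K.card = 0 ∨ K.card = 1 ∨ K.card = 2 ∨ K.card = 3 := by omega
  · rw [Finset.card_eq_zero.mp h]; exact h0
  · obtain ⟨i, rfl⟩ := Finset.card_eq_one.mp h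
    rw [single_singleton, map_smul, h1 i (hK (Finset.mem_singleton_self i)), smul_zero]
  · obtain ⟨i, j, hij, rfl⟩ := Finset.card_eq_two.mp h
    rw [single_insert (by simpa using hij), single_singleton, map_smul, map_smul, map_smul,
      h2 i (hK (by simp)) j (hK (by simp)) hij, smul_zero, smul_zero]
  · rw [Finset.eq_of_subset_of_card_le hK (by rw [hcard, h]), single_insert (by simp [hab, hac]),
      single_insert (by simpa using hbc), single_singleton]
    simp only [map_smul, h3, smul_zero]

theorem w_mul_comm (i : Fin k) {n : ℕ} {x : ToroidAlg k}
    (hx : x ∈ FreeGC.grading (ToroidGen.deg (k := k)) n) : w i * x = x * w i := by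
  rw [FreeGC.graded_comm (w_mem i) hx, Even.neg_one_pow (even_two.mul_right n), one_smul]

theorem sgn_s (i : Fin k) (x : ToroidAlg k) :
    FreeGC.sgn ToroidGen.deg (s i x) = -s i (FreeGC.sgn ToroidGen.deg x) :=
  FreeGC.sgn_oddDer _ _ x

theorem sgn_g4 : FreeGC.sgn ToroidGen.deg (g4 k) = g4 k := by
  rw [FreeGC.sgn_of_mem _ (g4_mem k), Even.neg_one_pow (by decide), one_smul]

/-- The Kronecker symbol. -/
def delta (i j : Fin k) : ℝ := if i = j then 1 else 0

theorem delta_self (i : Fin k) : delta i i = 1 := if_pos rfl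

theorem delta_ne {i j : Fin k} (h : i ≠ j) : delta i j = 0 := if_neg h

theorem an_cr_delta (i j : Fin k) (x : Ext k) :
    an i (cr j x) = delta i j • x - cr j (an i x) := an_cr i j x

theorem sum_delta {N : Type} [AddCommGroup N] [Module ℝ N] (i : Fin k) (f : Fin k → N) :
    ∑ j, delta i j • f j = f i := by
  simp [delta]

section Trivector

variable {a b c : Fin k} {D : Module.End ℝ (ToroidAlg k)}

theorem IsLift.opT_w (hD : IsLift (opT a b c) D) (i : Fin k) : D (w i) = 0 := by
  rw [w_eq_tau, hD.tau, opT_apply]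
  simp [tau_zero]

theorem IsLift.opT_tau4 (hD : IsLift (opT a b c) D) (x : Ext k) : D (tau4 x) =
    vac (an b (an a x)) • w c + vac (an c (an b x)) • w a + vac (an a (an c x)) • w b := by
  rw [← tau_inl, hD.tau, opT_apply, w_eq_tau, w_eq_tau, w_eq_tau, ← map_smul, ← map_smul,
    ← map_smul, ← map_add, ← map_add]
  simp

theorem IsLift.opT_tau7 (hD : IsLift (opT a b c) D) (x : Ext k) : D (tau7 x) =
    -tau4 (an c (an b (an a (par x)))) := by
  rw [← tau_inm, hD.tau, opT_apply, ← map_neg tau4, ← tau_inl]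
  simp only [map_zero, zero_smul, add_zero]

/-- The six terms of `D (∑ w_i s_i x g₄)` cancel in pairs, as the `w_i` commute with each other. -/
theorem IsLift.opT_comm_tau4 (hD : IsLift (opT a b c) D) (x : Ext k) :
    ⁅D, d k⁆ (tau4 x) = 0 := by
  have e1 := w_mul_comm a (w_mem (k := k) b)
  have e2 := w_mul_comm a (w_mem (k := k) c)
  have e3 := w_mul_comm b (w_mem (k := k) c)
  have h1 : d k (D (tau4 x)) = 0 := by simp [hD.opT_tau4, d_w]
  have h2 : D (d k (tau4 x)) = 0 := by
    rw [d_tau4, map_sum]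
    simp only [s_tau4, hD.mul, hD.opT_w, hD.opT_tau4, an_cr_delta, map_sub, map_smul, vac_cr, sub_zero,
      zero_mul, zero_add, smul_eq_mul, mul_add, mul_smul_comm, sub_smul, mul_smul, mul_sub,
      Finset.sum_add_distrib, Finset.sum_sub_distrib, sum_delta]
    rw [e1, e2, e3]
    abel
  rw [lie_apply, h1, h2, sub_zero]

/-- On `x g₇` the bracket `[D, d]` is the difference of two terms: the value of `D` on `x g₄²`, and
the terms that arise in `D (∑ w_i s_i x g₇)` when the contractions are moved past `s_i`. -/
theorem IsLift.opT_comm_tau7 (hD : IsLift (opT a b c) D) (x : Ext k) :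
    ⁅D, d k⁆ (tau7 x) = -(1 / 2 : ℝ) • (D (sqMap (par x)) -
      (2 : ℝ) • (w a * tau4 (an c (an b (par x))) - w b * tau4 (an c (an a (par x))) +
        w c * tau4 (an b (an a (par x))))) := by
  have h1 : d k (D (tau7 x)) = -∑ i, w i * tau4 (cr i (an c (an b (an a (par x))))) := by
    rw [hD.opT_tau7, map_neg, d_tau4]
    simp only [s_tau4]
  have h2 : D (d k (tau7 x)) = (w a * tau4 (an c (an b (par x))) -
      w b * tau4 (an c (an a (par x))) + w c * tau4 (an b (an a (par x)))) -
      ∑ i, w i * tau4 (cr i (an c (an b (an a (par x))))) - (1 / 2 : ℝ) • D (sqMap (par x)) := by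
    rw [d_tau7, map_sub, map_smul, map_sum]
    congr 1
    simp only [s_tau7, hD.mul, hD.opT_w, hD.opT_tau7, par_cr, an_cr_delta, map_sub, map_neg, map_smul,
      zero_mul, zero_add, neg_neg, mul_sub, mul_smul_comm, Finset.sum_sub_distrib, sum_delta]
    abel
  rw [lie_apply, h1, h2]
  module

theorem IsLift.opT_g4 (hD : IsLift (opT a b c) D) : D (g4 k) = 0 := by
  simp [← tau4_vacuum, hD.opT_tau4, an_vacuum]

theorem IsLift.opT_s_g4 (hD : IsLift (opT a b c) D) (i : Fin k) : D (s i (g4 k)) = 0 := by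
  simp [← tau4_vacuum, s_tau4, hD.opT_tau4, an_vacuum, an_cr_delta]

theorem IsLift.opT_ss_g4 (hD : IsLift (opT a b c) D) (i j : Fin k) : D (s i (s j (g4 k))) =
    (delta a i * delta b j - delta b i * delta a j) • w c +
    (delta b i * delta c j - delta c i * delta b j) • w a +
    (delta c i * delta a j - delta a i * delta c j) • w b := by
  simp [← tau4_vacuum, s_tau4, hD.opT_tau4, an_vacuum, an_cr_delta, vac_vacuum]
  module

theorem IsLift.opT_sss_g4 (hD : IsLift (opT a b c) D) : D (s a (s b (s c (g4 k)))) = 0 := by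
  simp [← tau4_vacuum, s_tau4, hD.opT_tau4, an_vacuum, an_cr_delta, vac_cr]

theorem IsLift.opT_g7 (hD : IsLift (opT a b c) D) : D (g7 k) = 0 := by
  simp [← tau7_vacuum, hD.opT_tau7, par_vacuum, an_vacuum]

theorem IsLift.opT_s_g7 (hD : IsLift (opT a b c) D) (i : Fin k) : D (s i (g7 k)) = 0 := by
  simp [← tau7_vacuum, s_tau7, hD.opT_tau7, par_vacuum, par_cr, an_vacuum, an_cr_delta]

theorem IsLift.opT_ss_g7 (hD : IsLift (opT a b c) D) (i j : Fin k) :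
    D (s i (s j (g7 k))) = 0 := by
  simp [← tau7_vacuum, s_tau7, hD.opT_tau7, par_vacuum, par_cr, an_vacuum, an_cr_delta]

theorem IsLift.opT_sss_g7 (hD : IsLift (opT a b c) D) (hab : a ≠ b) (hac : a ≠ c) (hbc : b ≠ c) :
    D (s a (s b (s c (g7 k)))) = g4 k := by
  simp [← tau7_vacuum, s_tau7, hD.opT_tau7, par_vacuum, par_cr, an_vacuum, an_cr_delta, delta_self,
    delta_ne, hab, hac, hbc, tau4_vacuum]

theorem sqMap_vacuum : sqMap vacuum = g4 k * g4 k := by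
  simp [sqMap, vacuum, sSet, sWord]

/-- The two terms of `IsLift.opT_comm_tau7` cancel for the monomials in `s_a, s_b, s_c`. Indeed
`D` annihilates `s_I g₄` unless `|I| = 2`, so that in the expansion of `s_I (g₄²)` only the terms with
a factor of this form contribute. -/
theorem IsLift.opT_sqMap (hD : IsLift (opT a b c) D) (hab : a ≠ b) (hac : a ≠ c) (hbc : b ≠ c)
    {K : Finset (Fin k)} (hK : K ⊆ {a, b, c}) :
    D (sqMap (Finsupp.single K 1)) - (2 : ℝ) • (w a * tau4 (an c (an b (Finsupp.single K 1))) -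
      w b * tau4 (an c (an a (Finsupp.single K 1))) +
        w c * tau4 (an b (an a (Finsupp.single K 1)))) = 0 := by
  have e0 := hD.opT_g4
  have e1 := hD.opT_s_g4
  have e2 := hD.opT_ss_g4
  have e3 := hD.opT_sss_g4
  have c0 : ∀ i, g4 k * w i = w i * g4 k := fun i => (w_mul_comm i (g4_mem k)).symm
  have c1 : ∀ i j, s j (g4 k) * w i = w i * s j (g4 k) := fun i j =>
    (w_mul_comm i (s_mem j (g4_mem k))).symm
  let A : Ext k →ₗ[ℝ] ToroidAlg k := D ∘ₗ sqMap - (2 : ℝ) •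
    (LinearMap.mulLeft ℝ (w a) ∘ₗ tau4 ∘ₗ an c ∘ₗ an b -
      LinearMap.mulLeft ℝ (w b) ∘ₗ tau4 ∘ₗ an c ∘ₗ an a +
        LinearMap.mulLeft ℝ (w c) ∘ₗ tau4 ∘ₗ an b ∘ₗ an a)
  have hA : ∀ x, A x = D (sqMap x) - (2 : ℝ) • (w a * tau4 (an c (an b x)) -
      w b * tau4 (an c (an a x)) + w c * tau4 (an b (an a x))) := fun x => rfl
  rw [← hA]
  refine eq_zero_of_triple A hab hac hbc ?_ (fun i _ => ?_) (fun i _ j _ hij => ?_) ?_ K hK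
  · simp [hA, sqMap_vacuum, an_vacuum, hD.mul, e0]
  · simp [hA, ← s_sqMap, sqMap_vacuum, an_vacuum, an_cr_delta, hD.mul, e0, e1, s_mul, sgn_g4]
  · simp only [hA, ← s_sqMap, sqMap_vacuum, an_vacuum, an_cr_delta, hD.mul, e0, e1, e2,
      s_mul, sgn_g4, sgn_s, map_add, map_neg, neg_mul, tau4_vacuum, map_sub, map_smul]
    simp only [mul_zero, zero_mul, add_zero, map_zero, neg_zero, add_mul, mul_add, smul_mul_assoc,
      mul_smul_comm, c0, sub_zero, smul_zero, mul_sub]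
    module
  · simp only [hA, ← s_sqMap, sqMap_vacuum, an_vacuum, an_cr_delta, hD.mul, e0, e1, e2, e3,
      s_mul, sgn_g4, sgn_s, map_add, map_neg, neg_mul, map_sub, map_smul]
    simp [delta_self, delta_ne, hab, hac, hbc, hab.symm, hac.symm, hbc.symm]
    simp only [← s_tau4, tau4_vacuum, c1, two_smul]
    abel

end Trivector

theorem opT_mem_liftable {a b c : Fin k} (hab : a ≠ b) (hac : a ≠ c) (hbc : b ≠ c) :
    opT a b c ∈ liftable k := by
  refine mem_liftable (isHomog_opT a b c) fun D hD => ?_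
  refine hD.comm_d {a, b, c} (fun j hj => ?_) (fun K _ => ?_) (fun K hK => ?_) fun i => ?_
  · simp only [Finset.mem_insert, Finset.mem_singleton, not_or] at hj
    refine ⟨j, 0, ?_⟩
    rw [lie_opT_opS (Ne.symm hj.1) (Ne.symm hj.2.1) (Ne.symm hj.2.2)]
    exact LinearMap.ext fun u => (zero_smul ℝ (opS j u)).symm
  · rw [← tau4_single, hD.opT_comm_tau4]
  · have h : ∃ r : ℝ, par (Finsupp.single K (1 : ℝ)) = r • Finsupp.single K (1 : ℝ) :=
      ⟨(-1) ^ K.card, by rw [par_single]; simp⟩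
    obtain ⟨r, hr⟩ := h
    have h1 := hD.opT_sqMap hab hac hbc hK
    rw [← tau7_single, hD.opT_comm_tau7, hr]
    simp only [map_smul, mul_smul_comm, ← smul_sub, ← smul_add]
    rw [smul_comm (2 : ℝ) r, ← smul_sub, h1, smul_zero, smul_zero]
  · rw [lie_apply, d_w, map_zero, hD.opT_w, map_zero, sub_zero]

/-! ### The action of the parabolic subalgebra -/

theorem lie_neg_opN_opS (i m j : Fin k) :
    ⁅-opN i m, opS j⁆ = (if m = j then (-1 : ℝ) else 0) • opS i := by
  refine LinearMap.ext fun u => ?_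
  have h := LinearMap.congr_fun (lie_opN_opS i m j) u
  rw [lie_apply, LinearMap.smul_apply] at h
  rw [lie_apply, LinearMap.smul_apply, LinearMap.neg_apply, LinearMap.neg_apply, map_neg,
    ← neg_sub', h]
  split_ifs
  · exact (neg_smul (1 : ℝ) (opS i u)).symm
  · simp

theorem lie_repH_opS (v : CartanE k) (j : Fin k) :
    ⁅TrivectorRel.repH opC opN v, opS j⁆ = v j.succ • opS j :=
  TrivectorRel.lie_repH_of_lie v lie_opC_opS lie_opN_opS j

section Levi

variable {D : Module.End ℝ (ToroidAlg k)} {i m : Fin k} {v : CartanE k}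

theorem IsLift.neg_opN_g4 (hD : IsLift (-opN i m) D) : D (g4 k) = 0 := by
  rw [g4_eq_tau, hD.tau, LinearMap.neg_apply, opN_apply, map_neg, neg_eq_zero]
  simp [an_single, tau_zero]

theorem IsLift.neg_opN_g7 (hD : IsLift (-opN i m) D) : D (g7 k) = 0 := by
  rw [g7_eq_tau, hD.tau, LinearMap.neg_apply, opN_apply, map_neg, neg_eq_zero]
  simp [an_single, tau_zero]

theorem IsLift.neg_opN_w (hD : IsLift (-opN i m) D) (j : Fin k) :
    D (w j) = if i = j then w m else 0 := by
  rw [w_eq_tau, hD.tau, LinearMap.neg_apply, opN_apply]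
  split_ifs with h
  · subst h
    simp [w_eq_tau]
  · simp [h, tau_zero]

theorem IsLift.neg_opN_s (hD : IsLift (-opN i m) D) (j : Fin k) :
    ⁅D, s j⁆ = if m = j then -s i else 0 := by
  rw [hD.lie_s (lie_neg_opN_opS i m j)]
  split_ifs <;> exact LinearMap.ext fun x => by simp

theorem IsLift.repH_g4 (hD : IsLift (TrivectorRel.repH opC opN v) D) :
    D (g4 k) = v 0 • g4 k := by
  rw [g4_eq_tau, hD.tau, TrivectorRel.repH_apply, ← map_smul]
  simp [LinearMap.sum_apply, opC_apply, opN_apply, an_single]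

theorem IsLift.repH_g7 (hD : IsLift (TrivectorRel.repH opC opN v) D) :
    D (g7 k) = (2 * v 0) • g7 k := by
  rw [g7_eq_tau, hD.tau, TrivectorRel.repH_apply, ← map_smul]
  simp [LinearMap.sum_apply, opC_apply, opN_apply, an_single, mul_comm]

theorem IsLift.repH_w (hD : IsLift (TrivectorRel.repH opC opN v) D) (j : Fin k) :
    D (w j) = -v j.succ • w j := by
  rw [w_eq_tau, hD.tau, TrivectorRel.repH_apply, ← map_smul, LinearMap.add_apply,
    LinearMap.sum_apply, Finset.sum_eq_single j]
  · simp [opC_apply, opN_apply]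
  · intro l _ hl
    rw [LinearMap.smul_apply, opN_apply]
    simp [hl]
  · simp

end Levi

theorem isLift_of_mem_der {X : Module.End ℝ (Gen k)} {D : (toroidModel k).der}
    (h : ∀ u, D.1 (tau u) = tau (X u)) : IsLift X D.1 where
  tau := h
  mul := D.2.2.1
  mem := D.2.1

theorem castLE_ne (hk : 3 ≤ k) {i j : Fin 3} (h : i ≠ j) : i.castLE hk ≠ j.castLE hk :=
  fun h' => h (Fin.castLE_injective hk h')

theorem neg_mem_liftable {X : Module.End ℝ (Gen k)} : X ∈ liftable k → -X ∈ liftable k := by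
  rintro ⟨D, hD⟩
  refine ⟨-D, fun u => ?_⟩
  rw [LinearMap.neg_apply, map_neg, ← hD]; rfl

theorem repE_mem_liftable (hk : 3 ≤ k) (i : Fin k) :
    TrivectorRel.repE opN opT hk i ∈ liftable k := by
  unfold TrivectorRel.repE
  split_ifs
  · exact neg_mem_liftable (opN_mem_liftable _ _)
  · exact opT_mem_liftable (castLE_ne hk (by decide)) (castLE_ne hk (by decide))
      (castLE_ne hk (by decide))

theorem repF_mem_liftable (i : Fin k) : TrivectorRel.repF opN i ∈ liftable k := by
  unfold TrivectorRel.repF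
  split_ifs
  · exact neg_mem_liftable (opN_mem_liftable _ _)
  · exact zero_mem _

theorem repH_mem_liftable (v : CartanE k) : TrivectorRel.repH opC opN v ∈ liftable k := by
  rw [TrivectorRel.repH_apply]
  exact add_mem (Submodule.smul_mem _ _ opC_mem_liftable)
    (sum_mem fun i _ => Submodule.smul_mem _ _ (opN_mem_liftable i i))

/-- The representation of `𝔭_k` on the space of generators induces the action on the model. The
map `tau` is not injective, so that it is the graph of the action which is defined first. -/
theorem exists_action (hk : 3 ≤ k) : ∃ ρ : LieE.parabolic k →ₗ⁅ℝ⁆ (toroidModel k).der,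
    (∀ i, IsLift (TrivectorRel.repE opN opT hk i) (ρ (LieE.pe i)).1) ∧
    (∀ i hi, IsLift (TrivectorRel.repF opN i) (ρ (LieE.pf i hi)).1) ∧
    (∀ v, IsLift (TrivectorRel.repH opC opN v) (ρ (LieE.ph v)).1) ∧
    ∀ x, ∃ X, IsLift X (ρ x).1 := by
  obtain ⟨φ, φe, φf, φh⟩ := LieE.exists_parabolic_rep hk ((trivectorRel k).parabolicRel hk)
  choose E hE using repE_mem_liftable hk
  choose F hF using repF_mem_liftable (k := k)
  choose H hH using repH_mem_liftable (k := k)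
  obtain ⟨ρ, ρe, ρf, ρh, hρ⟩ := LieE.exists_parabolic_hom_of_graph
    (fun x (D : (toroidModel k).der) => ∀ u, D.1 (tau u) = tau (φ x u))
    (E := E) (F := fun i _ => F i) (H := H)
    (fun {x y a b} h1 h2 u => by
      rw [map_add, LinearMap.add_apply, map_add, ← h1, ← h2]; rfl)
    (fun r {x a} h u => by rw [map_smul, LinearMap.smul_apply, map_smul, ← h]; rfl)
    (fun {x y a b} h1 h2 u => by
      rw [LieHom.map_lie, lie_apply, map_sub, ← h1, ← h2, ← h2, ← h1]; rfl)
    (fun a h => Subtype.ext (ext_of_tau a.2.2.1 (by simp) fun u => by rw [h]; simp))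
    (fun i u => by rw [hE, φe]) (fun i hi u => by rw [hF, φf]) (fun v u => by rw [hH, φh])
  refine ⟨ρ, fun i => ?_, fun i hi => ?_, fun v => ?_, fun x => ⟨φ x, isLift_of_mem_der (hρ x)⟩⟩
  · rw [ρe]; exact isLift_of_mem_der (hE i)
  · rw [ρf]; exact isLift_of_mem_der (hF i)
  · rw [ρh]; exact isLift_of_mem_der (hH v)

theorem perm_fin_three (p : Equiv.Perm (Fin 3)) :
    (p 0 = 0 ∧ p 1 = 1 ∧ p 2 = 2 ∧ p.sign = 1) ∨ (p 0 = 1 ∧ p 1 = 2 ∧ p 2 = 0 ∧ p.sign = 1) ∨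
    (p 0 = 2 ∧ p 1 = 0 ∧ p 2 = 1 ∧ p.sign = 1) ∨ (p 0 = 1 ∧ p 1 = 0 ∧ p 2 = 2 ∧ p.sign = -1) ∨
    (p 0 = 0 ∧ p 1 = 2 ∧ p 2 = 1 ∧ p.sign = -1) ∨ (p 0 = 2 ∧ p 1 = 1 ∧ p 2 = 0 ∧ p.sign = -1) := by
  revert p; decide

theorem exists_perm_fin_three {i j : Fin 3} (h : i ≠ j) :
    ∃ p : Equiv.Perm (Fin 3), p 0 = i ∧ p 1 = j := by
  revert i j; decide

/-- An action induced by the operators of `TrivectorRel` on the space of generators is given by the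
required formulas. -/
theorem isParabolicAction (hk : 3 ≤ k) {ρ : LieE.parabolic k →ₗ⁅ℝ⁆ (toroidModel k).der}
    (he : ∀ i, IsLift (TrivectorRel.repE opN opT hk i) (ρ (LieE.pe i)).1)
    (hf : ∀ i hi, IsLift (TrivectorRel.repF opN i) (ρ (LieE.pf i hi)).1)
    (hh : ∀ v, IsLift (TrivectorRel.repH opC opN v) (ρ (LieE.ph v)).1) :
    IsParabolicAction k hk ρ := by
  have hT : ∀ last : Fin k, last.val + 1 = k →
      IsLift (opT (Fin.castLE hk 0) (Fin.castLE hk 1) (Fin.castLE hk 2)) (ρ (LieE.pe last)).1 :=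
    fun last h => by
      have h1 := he last
      rwa [TrivectorRel.repE_of_eq hk last (by omega)] at h1
  have hE : ∀ (i : Fin k) (h : i.val + 1 < k),
      IsLift (-opN i ⟨i.val + 1, h⟩) (ρ (LieE.pe i)).1 :=
    fun i h => by
      have h1 := he i
      rwa [TrivectorRel.repE_of_lt hk i h] at h1
  have hF : ∀ (i : Fin k) (h : i.val + 1 < k),
      IsLift (-opN ⟨i.val + 1, h⟩ i) (ρ (LieE.pf i h)).1 :=
    fun i h => by
      have h1 := hf i h
      rwa [TrivectorRel.repF_of_lt i h] at h1
  have h01 : Fin.castLE hk 0 ≠ Fin.castLE hk 1 := castLE_ne hk (by decide)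
  have h02 : Fin.castLE hk 0 ≠ Fin.castLE hk 2 := castLE_ne hk (by decide)
  have h12 : Fin.castLE hk 1 ≠ Fin.castLE hk 2 := castLE_ne hk (by decide)
  have eps0 : ∀ v : CartanE k, epsE k 0 v = -v 0 := fun v => by simp [epsE]
  have epsS : ∀ (i : Fin k) (v : CartanE k), epsE k i.succ v = v i.succ := fun i v => by
    simp [epsE, Fin.succ_ne_zero]
  exact {
    ek_g4 := fun l h => (hT l h).opT_g4
    ek_g7 := fun l h => (hT l h).opT_g7
    ek_s_g4 := fun l h i => (hT l h).opT_s_g4 _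
    ek_s_g7 := fun l h i => (hT l h).opT_s_g7 _
    ek_ss_g7 := fun l h i j => (hT l h).opT_ss_g7 _ _
    ek_sss_g4 := fun l h => (hT l h).opT_sss_g4
    ek_w := fun l h i => (hT l h).opT_w i
    ek_ss_g4 := fun l h p => by
      rw [(hT l h).opT_ss_g4]
      rcases perm_fin_three p with h | h | h | h | h | h <;>
        · obtain ⟨h0, h1, h2, hs⟩ := h
          rw [h0, h1, h2, hs]
          simp [delta_self, delta_ne, h01, h02, h12, h01.symm, h02.symm, h12.symm]
    ek_sss_g7 := fun l h => (hT l h).opT_sss_g7 h01 h02 h12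
    ek_s := fun l h i hi => by
      have hne : ∀ j : Fin 3, j.castLE hk ≠ i := fun j hj => by
        have h1 : j.val = i.val := congrArg Fin.val hj
        omega
      have h1 : ⁅opT (Fin.castLE hk 0) (Fin.castLE hk 1) (Fin.castLE hk 2), opS i⁆ =
          (0 : ℝ) • opS i := by
        rw [lie_opT_opS (hne 0) (hne 1) (hne 2)]
        exact LinearMap.ext fun u => (zero_smul ℝ (opS i u)).symm
      rw [(hT l h).lie_s h1]
      exact LinearMap.ext fun u => zero_smul ℝ (s i u)
    h_g4 := fun v => by rw [(hh v).repH_g4, eps0, neg_neg]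
    h_g7 := fun v => by rw [(hh v).repH_g7, eps0, neg_mul_neg]
    h_s := fun v i => by rw [(hh v).lie_s (lie_repH_opS v i), epsS]
    h_w := fun v i => by rw [(hh v).repH_w, epsS]
    e_g4 := fun i hi => (hE i hi).neg_opN_g4
    e_g7 := fun i hi => (hE i hi).neg_opN_g7
    e_w := fun i hi j => (hE i hi).neg_opN_w j
    e_s := fun i hi j => by
      rw [(hE i hi).neg_opN_s]; simp only [Fin.ext_iff]
    f_g4 := fun i hi => (hF i hi).neg_opN_g4
    f_g7 := fun i hi => (hF i hi).neg_opN_g7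
    f_w := fun i hi j => by
      rw [(hF i hi).neg_opN_w]; simp only [Fin.ext_iff]
    f_s := fun i hi j => (hF i hi).neg_opN_s j }

/-! ### Uniqueness -/

/-- A derivation is determined by its values on the `w_i`, its commutators with the `s_i` for
`i ∉ S`, and its values on `s_I g₄` and `s_I g₇` for `I ⊆ S`. -/
theorem der_ext {D D' : (toroidModel k).der} (S : Finset (Fin k))
    (hs : ∀ i ∉ S, ⁅D.1, s i⁆ = ⁅D'.1, s i⁆) (h4 : ∀ K ⊆ S, D.1 (sg4 K) = D'.1 (sg4 K))
    (h7 : ∀ K ⊆ S, D.1 (sg7 K) = D'.1 (sg7 K)) (hw : ∀ i, D.1 (w i) = D'.1 (w i)) : D = D' := by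
  have hX : ∀ i ∉ S, ∀ x, (D.1 - D'.1) (s i x) = (1 : ℝ) • s i ((D.1 - D'.1) x) := by
    intro i hi x
    have h := LinearMap.congr_fun (hs i hi) x
    rw [lie_apply, lie_apply] at h
    rw [one_smul, LinearMap.sub_apply, LinearMap.sub_apply, map_sub]
    exact sub_eq_sub_iff_sub_eq_sub.mp h
  refine Subtype.ext (sub_eq_zero.mp (FreeGC.eq_zero_of_gen (σ := id) rfl (fun x y => ?_)
    fun a => ?_))
  · simp only [LinearMap.sub_apply, D.2.2.1 x y, D'.2.2.1 x y, sub_mul, mul_sub, id]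
    abel
  · cases a with
    | g4 I hI =>
      have h1 := eq_zero_of_subset s_sg4 hX (fun K hK => sub_eq_zero.mpr (h4 K hK)) I
      rwa [sg4, dif_pos hI] at h1
    | g7 I hI =>
      have h1 := eq_zero_of_subset s_sg7 hX (fun K hK => sub_eq_zero.mpr (h7 K hK)) I
      rwa [sg7, dif_pos hI] at h1
    | w i => exact sub_eq_zero.mpr (hw i)

theorem der_ext_levi {D D' : (toroidModel k).der}
    (hs : ∀ i : Fin k, ⁅D.1, s i⁆ = ⁅D'.1, s i⁆)
    (h4 : D.1 (g4 k) = D'.1 (g4 k)) (h7 : D.1 (g7 k) = D'.1 (g7 k))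
    (hw : ∀ i, D.1 (w i) = D'.1 (w i)) : D = D' :=
  der_ext ∅ (fun i _ => hs i) (fun _ hK => Finset.subset_empty.mp hK ▸ h4)
    (fun _ hK => Finset.subset_empty.mp hK ▸ h7) hw

/-- The formulas for the generators of `𝔭_k` determine the action. For `e_k` the values on
`s_i s_j g₄` are listed by the permutations of three letters, which account for all `i ≠ j`. -/
theorem parabolicAction_unique (hk : 3 ≤ k) {ρ ρ' : LieE.parabolic k →ₗ⁅ℝ⁆ (toroidModel k).der}
    (h : IsParabolicAction k hk ρ) (h' : IsParabolicAction k hk ρ') : ρ = ρ' := by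
  refine LieE.parabolic_hom_ext (fun i => ?_) (fun i hi => ?_) (fun v => ?_)
  · by_cases hi : i.val + 1 < k
    · exact der_ext_levi (fun j => by rw [h.e_s i hi, h'.e_s i hi])
        (by rw [h.e_g4 i hi, h'.e_g4 i hi]) (by rw [h.e_g7 i hi, h'.e_g7 i hi])
        fun j => by rw [h.e_w i hi, h'.e_w i hi]
    · have hl : i.val + 1 = k := by omega
      have hmem : ∀ j ∈ ({Fin.castLE hk 0, Fin.castLE hk 1, Fin.castLE hk 2} : Finset (Fin k)),
          ∃ l : Fin 3, j = l.castLE hk := by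
        intro j hj
        simp only [Finset.mem_insert, Finset.mem_singleton] at hj
        rcases hj with hj | hj | hj
        exacts [⟨0, hj⟩, ⟨1, hj⟩, ⟨2, hj⟩]
      have h01 : Fin.castLE hk 0 ≠ Fin.castLE hk 1 := castLE_ne hk (by decide)
      have h02 : Fin.castLE hk 0 ≠ Fin.castLE hk 2 := castLE_ne hk (by decide)
      have h12 : Fin.castLE hk 1 ≠ Fin.castLE hk 2 := castLE_ne hk (by decide)
      refine der_ext {Fin.castLE hk 0, Fin.castLE hk 1, Fin.castLE hk 2} (fun j hj => ?_)
        (fun K hK => ?_) (fun K hK => ?_) fun j => by rw [h.ek_w i hl, h'.ek_w i hl]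
      · have hj3 : 3 ≤ j.val := by
          by_contra! hlt
          refine hj ?_
          simp only [Finset.mem_insert, Finset.mem_singleton, Fin.ext_iff, Fin.val_castLE]
          change j.val = 0 ∨ j.val = 1 ∨ j.val = 2
          omega
        rw [h.ek_s i hl j hj3, h'.ek_s i hl j hj3]
      · rw [← tau4_single]
        refine sub_eq_zero.mp (eq_zero_of_triple
          (((ρ (LieE.pe i)).1 - (ρ' (LieE.pe i)).1) ∘ₗ tau4) h01 h02 h12 ?_ ?_ ?_ ?_ K hK)
        all_goals
          simp only [LinearMap.comp_apply, LinearMap.sub_apply, ← s_tau4, tau4_vacuum]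
        · rw [h.ek_g4 i hl, h'.ek_g4 i hl, sub_self]
        · intro j hj
          obtain ⟨l, rfl⟩ := hmem j hj
          rw [h.ek_s_g4 i hl, h'.ek_s_g4 i hl, sub_self]
        · intro j hj j' hj' hne
          obtain ⟨l, rfl⟩ := hmem j hj
          obtain ⟨l', rfl⟩ := hmem j' hj'
          obtain ⟨p, rfl, rfl⟩ := exists_perm_fin_three (i := l) (j := l')
            (fun e => hne (e ▸ rfl))
          rw [h.ek_ss_g4 i hl, h'.ek_ss_g4 i hl, sub_self]
        · rw [h.ek_sss_g4 i hl, h'.ek_sss_g4 i hl, sub_self]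
      · rw [← tau7_single]
        refine sub_eq_zero.mp (eq_zero_of_triple
          (((ρ (LieE.pe i)).1 - (ρ' (LieE.pe i)).1) ∘ₗ tau7) h01 h02 h12 ?_ ?_ ?_ ?_ K hK)
        all_goals
          simp only [LinearMap.comp_apply, LinearMap.sub_apply, ← s_tau7, tau7_vacuum]
        · rw [h.ek_g7 i hl, h'.ek_g7 i hl, sub_self]
        · intro j hj
          obtain ⟨l, rfl⟩ := hmem j hj
          rw [h.ek_s_g7 i hl, h'.ek_s_g7 i hl, sub_self]
        · intro j hj j' hj' _
          obtain ⟨l, rfl⟩ := hmem j hj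
          obtain ⟨l', rfl⟩ := hmem j' hj'
          rw [h.ek_ss_g7 i hl, h'.ek_ss_g7 i hl, sub_self]
        · rw [h.ek_sss_g7 i hl, h'.ek_sss_g7 i hl, sub_self]
  · exact der_ext_levi (fun j => by rw [h.f_s i hi, h'.f_s i hi])
      (by rw [h.f_g4 i hi, h'.f_g4 i hi]) (by rw [h.f_g7 i hi, h'.f_g7 i hi])
      fun j => by rw [h.f_w i hi, h'.f_w i hi]
  · exact der_ext_levi (fun j => by rw [h.h_s, h'.h_s]) (by rw [h.h_g4, h'.h_g4])
      (by rw [h.h_g7, h'.h_g7]) fun j => by rw [h.h_w, h'.h_w]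

end Fock

theorem theorem4p6 (k : ℕ) (hk : 3 ≤ k) :
    ∃ ρ : LieE.parabolic k →ₗ⁅ℝ⁆ (toroidModel k).der,
      IsParabolicAction k hk ρ ∧
      (∀ x : LieE.parabolic k, IsLinearDer (ρ x : Module.End ℝ (ToroidAlg k))) ∧
      ∀ ρ' : LieE.parabolic k →ₗ⁅ℝ⁆ (toroidModel k).der, IsParabolicAction k hk ρ' → ρ' = ρ := by
  obtain ⟨ρ, he, hf, hh, hx⟩ := Fock.exists_action hk
  have h := Fock.isParabolicAction hk he hf hh
  refine ⟨ρ, h, fun x a => ?_, fun ρ' h' => Fock.parabolicAction_unique hk h' h⟩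
  obtain ⟨X, hX⟩ := hx x
  obtain ⟨u, hu⟩ := Fock.gen_eq_tau a
  rw [hu, hX.tau]
  exact Fock.tau_mem_span _
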